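/- Let $n\ge 1$, let $A_1,\dots,A_s\subset\mathbb Z^n$ ($s\le n$) be non-empty finite sets, put $\mathcal A_i=\mathrm{conv}(A_i)\subset\mathbb R^n$ and $\mathcal A=\mathcal A_1+\cdots+\mathcal A_s$, and let $B^n$ be the Euclidean unit ball of $\mathbb R^n$. Let $m_1,\dots,m_s\ge 0$ be integers with $m_1+\cdots+m_s=n$, and for each $i$ let $0=m_i(0)\le m_i(1)\le\cdots\le m_i(n)=m_i$ be integers such that $\sum_i m_i(d)=d$ for $0\le d\le n$. Write $V(K_1,k_1;\dots;K_r,k_r)$ for the mixed volume of the $n$ convex bodies in which $K_j$ is repeated $k_j$ times ($\sum_j k_j=n$), normalized by $V(K,n)=\mathrm{Vol}_n(K)$. Let $b:A_1\sqcup\cdots\sqcup A_s\to\mathbb R$ be in general position, i.e. for every set $S$ of at most $n+s+1$ of the vectors $[-\mathrm e_i,a,b(i,a)]\in\mathbb R^s\times\mathbb R^n\times\mathbb R$ ($a\in A_i$, $1\le i\le s$), either $S$ is linearly independent or $[0,\dots,0,1]$ is a linear combination of elements of $S$. For $\xi\in(\mathbb R^n)^*$ let $\lambda_i(\xi)=\max_{a\in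 A_i}\bigl(\xi(a)-b(i,a)\bigr)$, and let $m_i(\xi)\ge 0$ be the integer such that this maximum is attained at exactly $m_i(\xi)+1$ points $a\in A_i$. For $Q\in O(n)$ with rows $Q_1,\dots,Q_n$, for $R>0$ and for $1\le d\le n$ let $$F_d=F_d(Q,R)=\{\xi: Q_j\xi=R^{\,n-j+1}\text{ for } d<j\le n\},\qquad X'_d=\{\xi\in F_d: m_i(\xi)\ge m_i(d-1)\text{ for all } i\}.$$ A vertex of $X'_d$ is a point $\xi\in X'_d$ with $\sum_i m_i(\xi)=d$. Suppose that $V(\mathcal A_1,m_1;\dots;\mathcal A_s,m_s)\ne 0$, and let $1\le d\le n$. Then for almost every $Q\in O(n)$ with respect to the Haar probability measure, $X'_d$ has finitely many vertices for all sufficiently large $R$, and their number is a constant $v_d(Q)$ for all sufficiently large $R$. The function $v_d$ is integrable, and its average $\bar v_d=\int_{O(n)}v_d(Q)\,dQ$ satisfies $$\bar v_d\le\frac{n!}{2^{\,n-d}}\,V\bigl(\mathcal A_1,m_1(d-1);\dots;\mathcal A_s,m_s(d-1);\mathcal A,1;B^n,n-d\bigr).$$ -/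

import Mathlib

open MeasureTheory Filter
open scoped Pointwise Nat

noncomputable section

/-- The mixed volume, in the normalization `V(K, …, K) = vol K`, of a family of convex bodies in
`ℝⁿ` indexed by a set `ι` with `n` elements, through the polarization formula
`n! V(K) = ∑_{J ⊆ ι} (-1)^(n - #J) vol(∑_{j ∈ J} K_j)` (Minkowski sums). -/
def mixedVolume {n : ℕ} {ι : Type*} [Fintype ι] (K : ι → Set (EuclideanSpace ℝ (Fin n))) : ℝ :=
  (∑ J : Finset ι, (-1 : ℝ) ^ (n + J.card) * volume.real (∑ j ∈ J, K j)) / (n ! : ℝ)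

/-- The semi-mixed volume `V(K_1, m_1; …; K_r, m_r)`: the mixed volume of the family in which the
body `K_k` occurs `m_k` times (where `∑ m_k = n`). -/
def semiMixedVolume {n : ℕ} {κ : Type*} [Fintype κ] (K : κ → Set (EuclideanSpace ℝ (Fin n)))
    (m : κ → ℕ) : ℝ :=
  mixedVolume (fun p : (Σ k : κ, Fin (m k)) => K p.1)

/-- The convex hull in `ℝⁿ` of a finite set of lattice points. -/
def supportPolytope {n : ℕ} (A : Finset (Fin n → ℤ)) : Set (EuclideanSpace ℝ (Fin n)) :=
  convexHull ℝ ((fun a : Fin n → ℤ => WithLp.toLp 2 (fun k => (a k : ℝ))) '' (A : Set (Fin n → ℤ)))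

/-- The disjoint union `A_1 ⊔ ⋯ ⊔ A_s`. -/
abbrev SupportUnion {n s : ℕ} (A : Fin s → Finset (Fin n → ℤ)) : Type :=
  Σ i : Fin s, {a : Fin n → ℤ // a ∈ A i}

/-- The vector `[-e_i, a, b(i, a)] ∈ ℝˢ × ℝⁿ × ℝ`. -/
def liftedCayleyVector {n s : ℕ} {A : Fin s → Finset (Fin n → ℤ)} (b : SupportUnion A → ℝ)
    (p : SupportUnion A) : (Fin s → ℝ) × (Fin n → ℝ) × ℝ :=
  (-Pi.single p.1 1, (fun k => (p.2.1 k : ℝ)), b p)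

/-- The lifting `b` is in general position: at most `n + s + 1` of the vectors
`[-e_i, a, b(i, a)]` are linearly independent or have `[0, …, 0, 1]` in their span. -/
def LiftingInGeneralPosition {n s : ℕ} {A : Fin s → Finset (Fin n → ℤ)}
    (b : SupportUnion A → ℝ) : Prop :=
  ∀ S : Finset (SupportUnion A), S.card ≤ n + s + 1 →
    LinearIndependent ℝ (fun p : S => liftedCayleyVector b p.1) ∨
      ((0, 0, 1) : (Fin s → ℝ) × (Fin n → ℝ) × ℝ) ∈
        Submodule.span ℝ (liftedCayleyVector b '' (S : Set (SupportUnion A)))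

/-- The value `ξ(a)` of a linear form with real coordinates `ξ` at a lattice point `a`. -/
def latticePairing {n : ℕ} (ξ : Fin n → ℝ) (a : Fin n → ℤ) : ℝ := ∑ k, ξ k * (a k : ℝ)

/-- The Legendre dual `λ_i(ξ) = max_{a ∈ A_i} (ξ(a) - b(i, a))` (for `A_i` non-empty). -/
def legendreDual {n s : ℕ} {A : Fin s → Finset (Fin n → ℤ)} (b : SupportUnion A → ℝ)
    (i : Fin s) (ξ : Fin n → ℝ) : ℝ :=
  ⨆ a : {a : Fin n → ℤ // a ∈ A i}, (latticePairing ξ a.1 - b ⟨i, a⟩)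

/-- The number `m_i(ξ)`: the maximum `λ_i(ξ)` is attained for exactly `m_i(ξ) + 1` values of
`a ∈ A_i` (for `A_i` non-empty). -/
def tropicalType {n s : ℕ} {A : Fin s → Finset (Fin n → ℤ)} (b : SupportUnion A → ℝ)
    (i : Fin s) (ξ : Fin n → ℝ) : ℕ :=
  {a : {a : Fin n → ℤ // a ∈ A i} |
    latticePairing ξ a.1 - b ⟨i, a⟩ = legendreDual b i ξ}.ncard - 1

/-- The member `F_d` of the affine flag given by the rows `Q_1, …, Q_n` of an orthogonal matrix
and by `R`: it is cut out by the equations `Q_j ξ = R^(n - j + 1)` for `d < j ≤ n`. Here `j` runs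
over `Fin n`, so that the row called `Q_{j+1}` in this description is row `j` of the matrix. -/
def flagSpace {n : ℕ} (Q : Matrix.orthogonalGroup (Fin n) ℝ) (R : ℝ) (d : ℕ) :
    Set (Fin n → ℝ) :=
  {ξ | ∀ j : Fin n, d ≤ (j : ℕ) → (Q.1.mulVec ξ) j = R ^ (n - (j : ℕ))}

/-- The set `X'_d` of the points `ξ ∈ F_d` with `m_i(ξ) ≥ m_i(d-1)` for all `i`. The given
sequences `m_i(0), …, m_i(n)` are written `M 0 i, …, M n i`. -/
def tropicalCurve {n s : ℕ} {A : Fin s → Finset (Fin n → ℤ)} (b : SupportUnion A → ℝ)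
    (M : ℕ → Fin s → ℕ) (Q : Matrix.orthogonalGroup (Fin n) ℝ) (R : ℝ) (d : ℕ) :
    Set (Fin n → ℝ) :=
  {ξ | ξ ∈ flagSpace Q R d ∧ ∀ i, M (d - 1) i ≤ tropicalType b i ξ}

/-- The vertices of `X'_d`: its points `ξ` with `∑ m_i(ξ) = d`. -/
def tropicalCurveVertices {n s : ℕ} {A : Fin s → Finset (Fin n → ℤ)} (b : SupportUnion A → ℝ)
    (M : ℕ → Fin s → ℕ) (Q : Matrix.orthogonalGroup (Fin n) ℝ) (R : ℝ) (d : ℕ) :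
    Set (Fin n → ℝ) :=
  {ξ | ξ ∈ tropicalCurve b M Q R d ∧ ∑ i, tropicalType b i ξ = d}

end

/-! The number of vertices for large `R` is controlled by the polyhedral subdivision of `ℝⁿ` into
the cells on which the set of the active affine functions `ξ(a) - b(i, a)` is constant.

**Vertices and recession cones.** As `b` is in general position, the edge vectors of the active
simplices of a cell are linearly independent, so that a cell of type `(e_i)`, with `e_i + 1`
active points in `A_i`, has dimension `k = n - ∑ e_i`. Vertices therefore lie on cells of
codimension `d`, one per cell at most: for almost every `Q` the affine hull of such a cell meets
`F_d` in one point. As `R → ∞` this point escapes in a direction depending on `Q` only, so the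
cell contributes a vertex if and only if its open recession cone contains this direction
(`CellFrame.eventually_activeSet_flagPoint_eq_iff`). By the invariance of the Haar measure the
direction is uniformly distributed on the sphere (`measure_rowSolution_mul_volume_ball`), and the
cell contributes with probability `vol (C ∩ B) / vol B`, where `C` is the cone and `B` the unit
ball of `ℝᵏ`. The cross-polytope in `B` gives `vol B ≥ 2ᵏ / k!` (`le_volume_ball`), whence the
factor `1 / 2 ^ (n - d)`: it remains to bound `∑ k! vol (C ∩ B)` by `n!` times the mixed volume.

**A volume polynomial.** The convex function `x ↦ ∑ c_i λ_i(x) + r √(t² + ‖x‖²)` has its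
subgradients in `∑ c_i 𝒜_i + r B`, and every interior point of this body is a subgradient at
exactly one point. So the body decomposes, up to a null set, into the images of the cells under
the subdifferential (`measure_mixedCell_add_eq_sum`). The image of a cell is, up to shears, the
product of the simplices spanned by its active points, scaled by the `c_i`, and of the dilation by
`r` of a slice, a subset of the unit ball of `ℝᵏ`. So `vol (∑ c_i 𝒜_i + r B)` is a sum over the
cells of type `(e_i)` of monomials `∏ c_i ^ e_i / e_i! · r ^ k` times the volume of the slice and
the volume of the parallelepiped spanned by the edge vectors (`exists_volume_mixedBody_eq`). The
latter is at least `1`, since the Gram determinant of linearly independent lattice vectors is a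
positive integer (`one_le_volume_parallelepiped`).

**Polarization.** The polarization of a monomial is the permanent that counts the ways to
distribute the factors over the `n` bodies. All terms are non-negative, so the cells of type
`(e_i)` with `e_i ≥ m_i(d-1)` and `∑ e_i = d`, where equality holds but for one `i`, which uses
the factor `𝒜_1 + ⋯ + 𝒜_s`, give the lower bound `∑ k! vol (slice)`
(`sum_factorial_mul_slice_le`). As `t → ∞` the slices exhaust `C ∩ B`
(`sum_mul_volume_openRecessionCone_le`), and the estimate follows. -/

/-! ### Active sets and the smoothed gradient -/

section Convexity

variable {ι P E : Type*} [Fintype P] [NormedAddCommGroup E] [InnerProductSpace ℝ E]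

open Classical in
/-- The set of the indices `p` at which the affine function `⟪a p, x⟫ - b p` attains the maximum
within the class of `p`; the classes are the fibres of `cls`. -/
noncomputable def activeSet (cls : P → ι) (a : P → E) (b : P → ℝ) (x : E) : Finset P :=
  Finset.univ.filter fun p => ∀ q, cls q = cls p → inner ℝ (a q) x - b q ≤ inner ℝ (a p) x - b p

theorem mem_activeSet {cls : P → ι} {a : P → E} {b : P → ℝ} {x : E} {p : P} :
    p ∈ activeSet cls a b x ↔
      ∀ q, cls q = cls p → inner ℝ (a q) x - b q ≤ inner ℝ (a p) x - b p := by
  simp [activeSet]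

theorem exists_mem_activeSet {cls : P → ι} (hcls : Function.Surjective cls) (a : P → E)
    (b : P → ℝ) (x : E) (i : ι) : ∃ p ∈ activeSet cls a b x, cls p = i := by
  classical
  obtain ⟨p₀, hp₀⟩ := hcls i
  obtain ⟨p, hp, hmax⟩ := Finset.exists_max_image (Finset.univ.filter fun p => cls p = i)
    (fun p => inner ℝ (a p) x - b p) ⟨p₀, by simpa using hp₀⟩
  have hpi : cls p = i := by simpa using hp
  exact ⟨p, mem_activeSet.2 fun q hq => hmax q (by simp [hq, hpi]), hpi⟩

/-- The gradient `x / √(t² + ‖x‖²)` of the strictly convex function `√(t² + ‖x‖²)`; it maps the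
space bijectively to the open unit ball. -/
noncomputable def ballGradient (t : ℝ) (x : E) : E := (√(t ^ 2 + ‖x‖ ^ 2))⁻¹ • x

omit [Fintype P] in
theorem norm_ballGradient_lt_one {t : ℝ} (ht : 0 < t) (x : E) : ‖ballGradient t x‖ < 1 := by
  have h : 0 < √(t ^ 2 + ‖x‖ ^ 2) := by positivity
  rw [ballGradient, norm_smul, norm_inv, Real.norm_of_nonneg h.le, inv_mul_lt_iff₀ h, mul_one]
  apply Real.lt_sqrt_of_sq_lt
  nlinarith

theorem inner_ballGradient_sub_pos {t : ℝ} (ht : 0 < t) {x y : E} (hxy : x ≠ y) :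
    0 < inner ℝ (ballGradient t x - ballGradient t y) (x - y) := by
  set α := √(t ^ 2 + ‖x‖ ^ 2) with hα
  set β := √(t ^ 2 + ‖y‖ ^ 2) with hβ
  have hα0 : 0 < α := by positivity
  have hβ0 : 0 < β := by positivity
  have hα2 : α ^ 2 = t ^ 2 + ‖x‖ ^ 2 := Real.sq_sqrt (by positivity)
  have hβ2 : β ^ 2 = t ^ 2 + ‖y‖ ^ 2 := Real.sq_sqrt (by positivity)
  have hcs : inner ℝ x y ≤ ‖x‖ * ‖y‖ := real_inner_le_norm x y
  have hcs' : inner ℝ x y ^ 2 ≤ (‖x‖ * ‖y‖) ^ 2 := by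
    rw [sq_le_sq, abs_of_nonneg (by positivity : (0 : ℝ) ≤ ‖x‖ * ‖y‖)]
    exact abs_real_inner_le_norm x y
  have hsub : 0 < ‖x‖ ^ 2 - 2 * inner ℝ x y + ‖y‖ ^ 2 := by
    rw [← norm_sub_sq_real]
    have : 0 < ‖x - y‖ := norm_pos_iff.2 (sub_ne_zero.2 hxy)
    positivity
  -- the Cauchy-Schwarz inequality for the vectors `(t, x)` and `(t, y)`, which are not parallel
  have hlt : t ^ 2 + inner ℝ x y < α * β := by
    apply lt_of_pow_lt_pow_left₀ 2 (by positivity)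
    rw [mul_pow, hα2, hβ2]
    nlinarith [mul_pos (pow_pos ht 2) hsub]
  have key : inner ℝ (ballGradient t x - ballGradient t y) (x - y)
      = (α + β) * (α * β - (t ^ 2 + inner ℝ x y)) / (α * β) := by
    simp only [ballGradient, ← hα, ← hβ, inner_sub_left, inner_sub_right, real_inner_smul_left,
      real_inner_self_eq_norm_sq, real_inner_comm x y]
    have h1 : ‖x‖ ^ 2 = α ^ 2 - t ^ 2 := by linarith
    have h2 : ‖y‖ ^ 2 = β ^ 2 - t ^ 2 := by linarith
    rw [h1, h2]
    field_simp
    ring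
  rw [key]
  have : 0 < α * β - (t ^ 2 + inner ℝ x y) := by linarith
  positivity

/-! ### The Minkowski sums attached to a set of indices -/

/-- The Minkowski sum `∑ c_i conv {a p : p ∈ S, cls p = i}`. -/
def mixedCell [Fintype ι] (cls : P → ι) (a : P → E) (c : ι → ℝ) (S : Set P) : Set E :=
  ∑ i, c i • convexHull ℝ (a '' {p | p ∈ S ∧ cls p = i})

variable [Fintype ι]

omit [Fintype P] in
theorem mem_mixedCell {cls : P → ι} {a : P → E} {c : ι → ℝ} {S : Set P} {y : E} :
    y ∈ mixedCell cls a c S ↔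
      ∃ z : ι → E, (∀ i, z i ∈ convexHull ℝ (a '' {p | p ∈ S ∧ cls p = i})) ∧
        ∑ i, c i • z i = y := by
  rw [mixedCell, Set.mem_finsetSum]
  constructor
  · rintro ⟨g, hg, rfl⟩
    choose z hz hzg using fun i => Set.mem_smul_set.1 (hg (Finset.mem_univ i))
    exact ⟨z, hz, by simp [hzg]⟩
  · rintro ⟨z, hz, rfl⟩
    exact ⟨fun i => c i • z i, fun {i} _ => Set.smul_mem_smul_set (hz i), rfl⟩

omit [Fintype P] in
theorem convex_mixedCell (cls : P → ι) (a : P → E) (c : ι → ℝ) (S : Set P) :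
    Convex ℝ (mixedCell cls a c S) :=
  Finset.sum_induction _ (fun K => Convex ℝ K) (fun _ _ h h' => Convex.add h h') (convex_singleton (𝕜 := ℝ) 0)
    fun i _ => (convex_convexHull ℝ (a '' {p | p ∈ S ∧ cls p = i})).smul (c i)

theorem isCompact_mixedCell (cls : P → ι) (a : P → E) (c : ι → ℝ)
    (S : Set P) : IsCompact (mixedCell cls a c S) :=
  Finset.sum_induction _ IsCompact (fun _ _ => IsCompact.add) isCompact_singleton
    fun _ _ => (((Set.toFinite _).image _).isCompact_convexHull (𝕜 := ℝ)).smul _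

omit [Fintype P] in
theorem mixedCell_mono (cls : P → ι) (a : P → E) (c : ι → ℝ) {S T : Set P} (h : S ⊆ T) :
    mixedCell cls a c S ⊆ mixedCell cls a c T := by
  intro y hy
  obtain ⟨z, hz, rfl⟩ := mem_mixedCell.1 hy
  have hsub : ∀ i, {p | p ∈ S ∧ cls p = i} ⊆ {p | p ∈ T ∧ cls p = i} :=
    fun i p hp => ⟨h hp.1, hp.2⟩
  exact mem_mixedCell.2 ⟨z, fun i => convexHull_mono (Set.image_mono (hsub i)) (hz i), rfl⟩

omit [Fintype ι] in
/-- Monotonicity of the subdifferential of a maximum of affine functions. -/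
theorem inner_sub_nonneg_of_mem_convexHull {cls : P → ι} {a : P → E} {b : P → ℝ} {x x' : E}
    {i : ι} {z z' : E}
    (hz : z ∈ convexHull ℝ (a '' {p | p ∈ (activeSet cls a b x : Set P) ∧ cls p = i}))
    (hz' : z' ∈ convexHull ℝ (a '' {p | p ∈ (activeSet cls a b x' : Set P) ∧ cls p = i})) :
    0 ≤ inner ℝ (z - z') (x - x') := by
  have hlin : ∀ w : E, Convex ℝ {z : E | 0 ≤ inner ℝ (z - w) (x - x')} := by
    intro w
    have : {z : E | 0 ≤ inner ℝ (z - w) (x - x')} =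
        {z : E | inner ℝ w (x - x') ≤ inner ℝ (x - x') z} := by
      ext z; simp only [Set.mem_ofPred_eq, inner_sub_left z, sub_nonneg,
        real_inner_comm z]
    rw [this]
    exact convex_halfSpace_ge (innerₛₗ ℝ (x - x')).isLinear _
  have hlin' : ∀ w : E, Convex ℝ {z : E | 0 ≤ inner ℝ (w - z) (x - x')} := by
    intro w
    have : {z : E | 0 ≤ inner ℝ (w - z) (x - x')} =
        {z : E | inner ℝ (x - x') z ≤ inner ℝ w (x - x')} := by
      ext z; simp only [Set.mem_ofPred_eq, inner_sub_left w, sub_nonneg,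
        real_inner_comm z]
    rw [this]
    exact convex_halfSpace_le (innerₛₗ ℝ (x - x')).isLinear _
  refine convexHull_min ?_ (hlin z') hz
  rintro _ ⟨p, ⟨hp, hpi⟩, rfl⟩
  refine convexHull_min ?_ (hlin' (a p)) hz'
  rintro _ ⟨q, ⟨hq, hqi⟩, rfl⟩
  have h1 := mem_activeSet.1 hp q (hqi.trans hpi.symm)
  have h2 := mem_activeSet.1 hq p (hpi.trans hqi.symm)
  simp only [Set.mem_ofPred_eq, inner_sub_left, inner_sub_right]
  linarith

/-- The image of the cell `{x | activeSet x = S}` under the subdifferential of the convex function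
`∑ c_i max_{cls p = i} (⟪a p, x⟫ - b p) + r √(t² + ‖x‖²)`. -/
def gradientCell (cls : P → ι) (a : P → E) (b : P → ℝ) (t : ℝ) (c : ι → ℝ) (r : ℝ)
    (S : Finset P) : Set E :=
  {y | ∃ x, activeSet cls a b x = S ∧ y - r • ballGradient t x ∈ mixedCell cls a c S}

theorem eq_of_mem_gradientCell {cls : P → ι} {a : P → E} {b : P → ℝ} {t : ℝ} (ht : 0 < t)
    {c : ι → ℝ} (hc : ∀ i, 0 ≤ c i) {r : ℝ} (hr : 0 < r) {y x x' : E}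
    (h : y - r • ballGradient t x ∈ mixedCell cls a c (activeSet cls a b x))
    (h' : y - r • ballGradient t x' ∈ mixedCell cls a c (activeSet cls a b x')) : x = x' := by
  by_contra hne
  obtain ⟨z, hz, hzy⟩ := mem_mixedCell.1 h
  obtain ⟨z', hz', hzy'⟩ := mem_mixedCell.1 h'
  have h1 : 0 ≤ inner ℝ (∑ i, c i • z i - ∑ i, c i • z' i) (x - x') := by
    rw [← Finset.sum_sub_distrib, sum_inner]
    refine Finset.sum_nonneg fun i _ => ?_
    rw [← smul_sub, real_inner_smul_left]
    exact mul_nonneg (hc i) (inner_sub_nonneg_of_mem_convexHull (hz i) (hz' i))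
  have h2 := inner_ballGradient_sub_pos ht hne
  rw [hzy, hzy', show y - r • ballGradient t x - (y - r • ballGradient t x') =
    -(r • (ballGradient t x - ballGradient t x')) by rw [smul_sub]; abel, inner_neg_left,
    real_inner_smul_left] at h1
  have := mul_pos hr h2
  linarith

theorem pairwise_disjoint_gradientCell (cls : P → ι) (a : P → E) (b : P → ℝ) {t : ℝ}
    (ht : 0 < t) {c : ι → ℝ} (hc : ∀ i, 0 ≤ c i) {r : ℝ} (hr : 0 < r) :
    Pairwise (Function.onFun Disjoint (gradientCell cls a b t c r)) := by
  intro S T hST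
  rw [Function.onFun, Set.disjoint_left]
  rintro y ⟨x, rfl, hx⟩ ⟨x', rfl, hx'⟩
  exact hST (by rw [eq_of_mem_gradientCell ht hc hr hx hx'])

theorem gradientCell_subset (cls : P → ι) (a : P → E) (b : P → ℝ) {t : ℝ}
    (ht : 0 < t) (c : ι → ℝ) (r : ℝ) (S : Finset P) :
    gradientCell cls a b t c r S ⊆
      mixedCell cls a c Set.univ + r • Metric.closedBall (0 : E) 1 := by
  rintro y ⟨x, -, hx⟩
  refine Set.mem_add.2 ⟨_, mixedCell_mono cls a c (Set.subset_univ _) hx, r • ballGradient t x,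
    Set.smul_mem_smul_set ?_, by abel⟩
  simpa using (norm_ballGradient_lt_one ht x).le

/-- The maximum `max_{cls p = i} (⟪a p, x⟫ - b p)` as a function of `x`. -/
noncomputable def classMax [DecidableEq ι] {cls : P → ι} (hcls : Function.Surjective cls)
    (a : P → E) (b : P → ℝ) (i : ι) : E → ℝ :=
  (Finset.univ.filter fun p => cls p = i).sup'
    (let ⟨p, hp⟩ := hcls i; ⟨p, by simpa using hp⟩) (fun p x => inner ℝ (a p) x - b p)

section ClassMax

variable [DecidableEq ι] {cls : P → ι} (hcls : Function.Surjective cls) (a : P → E) (b : P → ℝ)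

omit [Fintype ι] in
theorem continuous_classMax (i : ι) : Continuous (classMax hcls a b i) :=
  Continuous.finset_sup' _ fun _ _ => by fun_prop

omit [Fintype ι] in
theorem le_classMax (p : P) (x : E) :
    inner ℝ (a p) x - b p ≤ classMax hcls a b (cls p) x := by
  rw [classMax, Finset.sup'_apply]
  exact Finset.le_sup' (fun p => inner ℝ (a p) x - b p) (by simp)

omit [Fintype ι] in
theorem classMax_eq {p : P} {x : E} (hp : p ∈ activeSet cls a b x) :
    classMax hcls a b (cls p) x = inner ℝ (a p) x - b p := by
  refine le_antisymm ?_ (le_classMax hcls a b p x)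
  rw [classMax, Finset.sup'_apply]
  refine Finset.sup'_le _ _ fun q hq => mem_activeSet.1 hp q (by simpa using hq)

omit [Fintype ι] in
/-- A directional upper bound for the maximum of affine functions: to first order only the active
functions matter. -/
theorem eventually_classMax_add_le (i : ι) (x v : E) {s : ℝ}
    (hs : ∀ p ∈ activeSet cls a b x, cls p = i → inner ℝ (a p) v ≤ s) :
    ∀ᶠ τ : ℝ in nhdsWithin 0 (Set.Ioi 0),
      classMax hcls a b i (x + τ • v) ≤ classMax hcls a b i x + τ * s := by
  have h : ∀ p : P, ∀ᶠ τ : ℝ in nhdsWithin 0 (Set.Ioi 0), cls p = i →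
      inner ℝ (a p) (x + τ • v) - b p ≤ classMax hcls a b i x + τ * s := by
    intro p
    by_cases hpi : cls p = i
    · subst hpi
      by_cases hp : p ∈ activeSet cls a b x
      · filter_upwards [self_mem_nhdsWithin] with τ hτ _
        rw [classMax_eq hcls a b hp, inner_add_right, real_inner_smul_right]
        have := mul_le_mul_of_nonneg_left (hs p hp rfl) (le_of_lt (Set.mem_Ioi.1 hτ))
        linarith
      · have hlt : inner ℝ (a p) x - b p < classMax hcls a b (cls p) x := by
          obtain ⟨q, hq, hqp⟩ := exists_mem_activeSet hcls a b x (cls p)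
          refine lt_of_not_ge fun hge => hp (mem_activeSet.2 fun q' hq' => ?_)
          rw [← hqp, classMax_eq hcls a b hq] at hge
          exact (mem_activeSet.1 hq q' (hq'.trans hqp.symm)).trans hge
        have hc1 : ContinuousAt (fun τ : ℝ => inner ℝ (a p) (x + τ • v) - b p) 0 := by fun_prop
        have hc2 : ContinuousAt (fun τ : ℝ => classMax hcls a b (cls p) x + τ * s) 0 := by
          fun_prop
        filter_upwards [nhdsWithin_le_nhds (hc1.eventually_lt hc2 (by simpa using hlt))] with τ hτ _
        exact hτ.le
    · exact Eventually.of_forall fun τ h => absurd h hpi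
  filter_upwards [eventually_all.2 h] with τ hτ
  rw [classMax, Finset.sup'_apply]
  exact Finset.sup'_le _ _ fun p hp => hτ p (by simpa using hp)

end ClassMax

omit [Fintype P] [Fintype ι] in
theorem sqrt_add_norm_sq_le {t : ℝ} (ht : 0 < t) (x v : E) (τ : ℝ) :
    √(t ^ 2 + ‖x + τ • v‖ ^ 2) ≤ √(t ^ 2 + ‖x‖ ^ 2) + τ * inner ℝ (ballGradient t x) v
      + τ ^ 2 * (‖v‖ ^ 2 / √(t ^ 2 + ‖x‖ ^ 2)) := by
  set α := √(t ^ 2 + ‖x‖ ^ 2) with hα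
  have hα0 : 0 < α := by positivity
  have hα2 : α ^ 2 = t ^ 2 + ‖x‖ ^ 2 := Real.sq_sqrt (by positivity)
  have h1 : ‖x + τ • v‖ ^ 2 = ‖x‖ ^ 2 + 2 * (τ * inner ℝ x v) + τ ^ 2 * ‖v‖ ^ 2 := by
    rw [norm_add_sq_real, real_inner_smul_right, norm_smul, mul_pow, Real.norm_eq_abs, sq_abs]
  have h2 : inner ℝ (ballGradient t x) v = inner ℝ x v / α := by
    rw [ballGradient, real_inner_smul_left, ← hα]; ring
  set w := α + τ * (inner ℝ x v / α) + τ ^ 2 * (‖v‖ ^ 2 / α) with hw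
  have hβ2 : √(t ^ 2 + ‖x + τ • v‖ ^ 2) ^ 2 = t ^ 2 + ‖x + τ • v‖ ^ 2 :=
    Real.sq_sqrt (by positivity)
  have hβ0 : 0 ≤ √(t ^ 2 + ‖x + τ • v‖ ^ 2) := Real.sqrt_nonneg _
  set β := √(t ^ 2 + ‖x + τ • v‖ ^ 2)
  rw [h2]
  -- the inequality of the arithmetic and the geometric mean for `α` and `β`
  have h3 : 2 * α * β ≤ α ^ 2 + β ^ 2 := by nlinarith [sq_nonneg (α - β)]
  have h4 : α * w = α ^ 2 + τ * inner ℝ x v + τ ^ 2 * ‖v‖ ^ 2 := by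
    rw [hw]; field_simp
  have h5 : α * β ≤ α * w := by
    rw [h4]
    nlinarith [mul_nonneg (sq_nonneg τ) (sq_nonneg ‖v‖)]
  exact le_of_mul_le_mul_left h5 hα0

variable [FiniteDimensional ℝ E]

/-- Every interior point of the Minkowski sum is a subgradient of the convex function at some
point: the minimizer of the function minus the linear form. -/
theorem exists_mem_gradientCell {cls : P → ι} (hcls : Function.Surjective cls) (a : P → E)
    (b : P → ℝ) {t : ℝ} (ht : 0 < t) {c : ι → ℝ} (hc : ∀ i, 0 ≤ c i) {r : ℝ} (hr : 0 < r) {y : E}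
    (hy : y ∈ interior (mixedCell cls a c Set.univ + r • Metric.closedBall (0 : E) 1)) :
    ∃ S, y ∈ gradientCell cls a b t c r S := by
  classical
  set Φ : E → ℝ := fun x => ∑ i, c i * classMax hcls a b i x + r * √(t ^ 2 + ‖x‖ ^ 2)
    - inner ℝ y x with hΦ
  have hcont : Continuous Φ := by
    have := continuous_classMax hcls a b
    simp only [hΦ]
    fun_prop
  obtain ⟨ρ, hρ, hball⟩ := Metric.nhds_basis_closedBall.mem_iff.1 (mem_interior_iff_mem_nhds.1 hy)
  set β : ℝ := ∑ p, |b p| with hβ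
  have hconv : ∀ (x : E) (i : ι) (z : E),
      z ∈ convexHull ℝ (a '' {p | p ∈ (Set.univ : Set P) ∧ cls p = i}) →
        inner ℝ x z ≤ classMax hcls a b i x + β := by
    intro x i z hz
    refine convexHull_min (t := {z | inner ℝ x z ≤ classMax hcls a b i x + β}) ?_
      (convex_halfSpace_le (innerₛₗ ℝ x).isLinear _) hz
    rintro _ ⟨p, ⟨-, rfl⟩, rfl⟩
    have h1 := le_classMax hcls a b p x
    have h2 : |b p| ≤ β := Finset.single_le_sum (f := fun p => |b p|) (fun _ _ => abs_nonneg _)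
      (Finset.mem_univ p)
    have h3 := le_abs_self (b p)
    simp only [Set.mem_ofPred_eq, real_inner_comm (a p) x]
    linarith
  have hlow : ∀ x, ρ * ‖x‖ + -∑ i, c i * β ≤ Φ x := by
    intro x
    have hmem : y + (ρ / ‖x‖) • x ∈ Metric.closedBall y ρ := by
      rw [Metric.mem_closedBall, dist_eq_norm, add_sub_cancel_left, norm_smul, norm_div, norm_norm,
        Real.norm_of_nonneg hρ.le]
      rcases eq_or_ne ‖x‖ 0 with h | h
      · simpa [h] using hρ.le
      · rw [div_mul_cancel₀ _ h]
    obtain ⟨u, hu, w', hw', huw⟩ := Set.mem_add.1 (hball hmem)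
    obtain ⟨w, hw, rfl⟩ := Set.mem_smul_set.1 hw'
    obtain ⟨z, hz, rfl⟩ := mem_mixedCell.1 hu
    have h1 : inner ℝ x (y + (ρ / ‖x‖) • x) = inner ℝ y x + ρ * ‖x‖ := by
      rw [inner_add_right, real_inner_smul_right, real_inner_self_eq_norm_sq, real_inner_comm x y]
      rcases eq_or_ne ‖x‖ 0 with h | h
      · simp [h]
      · field_simp
    have h2 : inner ℝ x (∑ i, c i • z i) ≤ ∑ i, c i * classMax hcls a b i x + ∑ i, c i * β := by
      rw [inner_sum, ← Finset.sum_add_distrib]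
      refine Finset.sum_le_sum fun i _ => ?_
      rw [real_inner_smul_right, ← mul_add]
      exact mul_le_mul_of_nonneg_left (hconv x i (z i) (hz i)) (hc i)
    have h3 : inner ℝ x (r • w) ≤ r * √(t ^ 2 + ‖x‖ ^ 2) := by
      rw [real_inner_smul_right]
      refine mul_le_mul_of_nonneg_left ?_ hr.le
      have hw1 : ‖w‖ ≤ 1 := by simpa using hw
      calc inner ℝ x w ≤ ‖x‖ * ‖w‖ := real_inner_le_norm x w
        _ ≤ ‖x‖ := mul_le_of_le_one_right (norm_nonneg _) hw1
        _ ≤ √(t ^ 2 + ‖x‖ ^ 2) := Real.le_sqrt_of_sq_le (by nlinarith)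
    rw [← huw, inner_add_right] at h1
    simp only [hΦ]
    linarith
  have htend : Tendsto Φ (cocompact E) atTop :=
    tendsto_atTop_mono hlow (tendsto_atTop_add_const_right _ _
      (Tendsto.const_mul_atTop hρ (tendsto_norm_cocompact_atTop)))
  obtain ⟨x, hx⟩ := hcont.exists_forall_le htend
  refine ⟨activeSet cls a b x, x, rfl, ?_⟩
  by_contra hnot
  -- separate `y - r ∇` from the subdifferential: this gives a direction of descent
  obtain ⟨f, u, hfu, huf⟩ := geometric_hahn_banach_closed_point
    (convex_mixedCell cls a c (activeSet cls a b x))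
    (isCompact_mixedCell cls a c (activeSet cls a b x)).isClosed hnot
  set v : E := (InnerProductSpace.toDual ℝ E).symm f with hv
  have hf : ∀ z, f z = inner ℝ z v := fun z => by
    rw [real_inner_comm, hv, InnerProductSpace.toDual_symm_apply]
  have hchoice : ∀ i, ∃ p ∈ activeSet cls a b x, cls p = i ∧
      ∀ q ∈ activeSet cls a b x, cls q = i → inner ℝ (a q) v ≤ inner ℝ (a p) v := by
    intro i
    obtain ⟨p₀, hp₀, hpi₀⟩ := exists_mem_activeSet hcls a b x i
    obtain ⟨p, hp, hmax⟩ := Finset.exists_max_image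
      ((activeSet cls a b x).filter fun p => cls p = i)
      (fun p => inner ℝ (a p) v) ⟨p₀, by simp [hp₀, hpi₀]⟩
    rw [Finset.mem_filter] at hp
    exact ⟨p, hp.1, hp.2, fun q hq hqi => hmax q (by simp [hq, hqi])⟩
  choose π hπ hπi hπmax using hchoice
  have hzmem : ∑ i, c i • a (π i) ∈ mixedCell cls a c (activeSet cls a b x) :=
    mem_mixedCell.2 ⟨fun i => a (π i), fun i => subset_convexHull ℝ _ ⟨π i, ⟨hπ i, hπi i⟩, rfl⟩, rfl⟩
  have hneg := (hfu _ hzmem).trans huf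
  rw [hf, hf, sum_inner, inner_sub_left, real_inner_smul_left] at hneg
  simp only [real_inner_smul_left] at hneg
  set δ := ∑ i, c i * inner ℝ (a (π i)) v + r * inner ℝ (ballGradient t x) v - inner ℝ y v
  have hδ : δ < 0 := by simp only [δ]; linarith
  set κ := r * (‖v‖ ^ 2 / √(t ^ 2 + ‖x‖ ^ 2)) with hκ
  have hev : ∀ᶠ τ : ℝ in nhdsWithin 0 (Set.Ioi 0), ∀ i,
      classMax hcls a b i (x + τ • v) ≤ classMax hcls a b i x + τ * inner ℝ (a (π i)) v :=
    eventually_all.2 fun i => eventually_classMax_add_le hcls a b i x v (hπmax i)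
  have hev2 : ∀ᶠ τ : ℝ in nhdsWithin 0 (Set.Ioi 0), δ + τ * κ < 0 := by
    have hca : ContinuousAt (fun τ : ℝ => δ + τ * κ) 0 := by fun_prop
    exact nhdsWithin_le_nhds (hca.eventually_lt continuousAt_const (by simpa using hδ))
  obtain ⟨τ, ⟨hτ1, hτ2⟩, hτ0⟩ := ((hev.and hev2).and self_mem_nhdsWithin).exists
  have hτ0 : 0 < τ := hτ0
  have hS : ∑ i, c i * classMax hcls a b i (x + τ • v) ≤
      ∑ i, c i * classMax hcls a b i x + τ * ∑ i, c i * inner ℝ (a (π i)) v := by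
    rw [Finset.mul_sum, ← Finset.sum_add_distrib]
    refine Finset.sum_le_sum fun i _ => ?_
    calc c i * classMax hcls a b i (x + τ • v)
        ≤ c i * (classMax hcls a b i x + τ * inner ℝ (a (π i)) v) :=
          mul_le_mul_of_nonneg_left (hτ1 i) (hc i)
      _ = _ := by ring
  have hR := mul_le_mul_of_nonneg_left (sqrt_add_norm_sq_le ht x v τ) hr.le
  have hmin := hx (x + τ • v)
  simp only [hΦ, inner_add_right, real_inner_smul_right] at hmin
  have hfin : 0 ≤ τ * (δ + τ * κ) := by
    have hexp : τ * (δ + τ * κ) = τ * ∑ i, c i * inner ℝ (a (π i)) v +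
      r * (τ * inner ℝ (ballGradient t x) v + τ ^ 2 * (‖v‖ ^ 2 / √(t ^ 2 + ‖x‖ ^ 2)))
      - τ * inner ℝ y v := by
      simp only [δ, hκ]; ring
    rw [hexp]
    linarith
  exact absurd hfin (not_le.2 (mul_neg_of_pos_of_neg hτ0 hτ2))

/-- The gradient cells are disjoint as the subdifferential is strictly monotone, and they cover the
interior of the Minkowski sum, whose frontier is a null set. -/
theorem measure_mixedCell_add_eq_sum [MeasurableSpace E] [BorelSpace E] (μ : Measure E)
    [μ.IsAddHaarMeasure] {cls : P → ι} (hcls : Function.Surjective cls) (a : P → E)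
    (b : P → ℝ) {t : ℝ} (ht : 0 < t) {c : ι → ℝ} (hc : ∀ i, 0 ≤ c i) {r : ℝ} (hr : 0 < r)
    (hmeas : ∀ S, MeasurableSet (gradientCell cls a b t c r S)) :
    μ (mixedCell cls a c Set.univ + r • Metric.closedBall (0 : E) 1) =
      ∑ S : Finset P, μ (gradientCell cls a b t c r S) := by
  have hU : μ (⋃ S ∈ (Finset.univ : Finset (Finset P)), gradientCell cls a b t c r S) =
      ∑ S : Finset P, μ (gradientCell cls a b t c r S) :=
    measure_biUnion_finset ((pairwise_disjoint_gradientCell cls a b ht hc hr).set_pairwise _)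
      fun S _ => hmeas S
  rw [← hU]
  have hconv : Convex ℝ (mixedCell cls a c Set.univ + r • Metric.closedBall (0 : E) 1) :=
    (convex_mixedCell cls a c _).add ((convex_closedBall _ _).smul _)
  refine le_antisymm ?_ (measure_mono (Set.iUnion₂_subset fun S _ =>
    gradientCell_subset cls a b ht c r S))
  rw [← measure_congr (interior_ae_eq_of_null_frontier (hconv.addHaar_frontier μ))]
  refine measure_mono fun y hy => ?_
  obtain ⟨S, hS⟩ := exists_mem_gradientCell hcls a b ht hc hr hy
  exact Set.mem_iUnion₂.2 ⟨S, Finset.mem_univ S, hS⟩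

end Convexity

/-! ### Volumes in coordinates adapted to a lattice subspace -/

section FrameVolume

variable {n k : ℕ} {D : Type*} [Fintype D]

/-- The Gram determinant of linearly independent integral vectors is a positive integer, hence the
parallelepiped spanned by such vectors and an orthonormal family of their orthogonal complement
has volume at least one. -/
theorem one_le_volume_parallelepiped [DecidableEq D] {f : D → EuclideanSpace ℝ (Fin n)}
    {u : Fin k → EuclideanSpace ℝ (Fin n)} (hcard : Fintype.card D + k = n)
    (hint : ∀ d, ∃ w : Fin n → ℤ, f d = WithLp.toLp 2 (fun j => (w j : ℝ)))
    (hu : Orthonormal ℝ u) (hfu : ∀ d j, inner ℝ (f d) (u j) = 0)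
    (hli : LinearIndependent ℝ (Sum.elim f u)) :
    1 ≤ (volume : Measure (EuclideanSpace ℝ (Fin n))) (parallelepiped (Sum.elim f u)) := by
  classical
  have hcard' : Fintype.card (D ⊕ Fin k) = n := by simpa using hcard
  let e : Fin n ≃ D ⊕ Fin k := (Fintype.equivFinOfCardEq hcard').symm
  let B : OrthonormalBasis (D ⊕ Fin k) ℝ (EuclideanSpace ℝ (Fin n)) :=
    (EuclideanSpace.basisFun (Fin n) ℝ).reindex e
  have hvol := Measure.addHaar_parallelepiped B.toBasis (Sum.elim f u)
  rw [OrthonormalBasis.addHaar_eq_volume] at hvol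
  rw [hvol, ENNReal.one_le_ofReal]
  set V := B.toBasis.toMatrix (Sum.elim f u) with hV
  rw [Module.Basis.det_apply, ← hV]
  have hgram : ∀ p q, (V.transpose * V) p q =
      inner ℝ (Sum.elim f u p : EuclideanSpace ℝ (Fin n)) (Sum.elim f u q) := by
    intro p q
    rw [Matrix.mul_apply, ← B.sum_inner_mul_inner]
    refine Finset.sum_congr rfl fun l _ => ?_
    simp [hV, Module.Basis.toMatrix_apply, OrthonormalBasis.repr_apply_apply, real_inner_comm]
  choose w hw using hint
  let G : Matrix D D ℤ := Matrix.of fun p q => ∑ j, w p j * w q j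
  have hblock : V.transpose * V = Matrix.fromBlocks (G.map (Int.cast : ℤ → ℝ)) 0 0 1 := by
    ext p q
    rw [hgram]
    rcases p with p | p <;> rcases q with q | q
    · simp [G, hw, PiLp.inner_apply, mul_comm]
    · simpa using hfu p q
    · simpa [real_inner_comm] using hfu q p
    · simpa [Matrix.one_apply] using orthonormal_iff_ite.1 hu p q
  have hdet : V.det ^ 2 = (G.det : ℝ) := by
    have h := congrArg Matrix.det hblock
    rw [Matrix.det_mul, Matrix.det_transpose, Matrix.det_fromBlocks_zero₂₁, Matrix.det_one,
      mul_one] at h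
    rw [pow_two, h]
    exact (Int.cast_det G).symm
  have hne : V.det ≠ 0 := by
    have hunit := Module.Basis.is_basis_iff_det B.toBasis (v := Sum.elim f u)
    have hspan : Submodule.span ℝ (Set.range (Sum.elim f u)) = ⊤ :=
      hli.span_eq_top_of_card_eq_finrank' (by simp [hcard])
    have := (hunit.1 ⟨hli, hspan⟩).ne_zero
    rwa [Module.Basis.det_apply] at this
  have hpos : 0 < G.det := by
    have h2 : (0 : ℝ) < (G.det : ℝ) := by rw [← hdet]; positivity
    exact_mod_cast h2
  have h1 : (1 : ℝ) ≤ V.det ^ 2 := by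
    rw [hdet]; exact_mod_cast hpos
  exact one_le_sq_iff_one_le_abs _ |>.1 h1

/-- Coordinates with respect to integral vectors `f` and an orthonormal basis `u` of their
orthogonal complement: the volume is multiplied by a constant which is at least one. -/
theorem exists_frame_equiv {f : D → EuclideanSpace ℝ (Fin n)}
    {u : Fin k → EuclideanSpace ℝ (Fin n)} (hcard : Fintype.card D + k = n)
    (hint : ∀ d, ∃ w : Fin n → ℤ, f d = WithLp.toLp 2 (fun j => (w j : ℝ)))
    (hu : Orthonormal ℝ u) (hfu : ∀ d j, inner ℝ (f d) (u j) = 0) (hf : LinearIndependent ℝ f) :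
    ∃ T : ((D → ℝ) × EuclideanSpace ℝ (Fin k)) ≃L[ℝ] EuclideanSpace ℝ (Fin n),
      (∀ x y, T (x, y) = ∑ d, x d • f d + ∑ j, y j • u j) ∧
      ∃ C : ENNReal, 1 ≤ C ∧ C ≠ ⊤ ∧ ∀ X, volume (T '' X) = C * volume X := by
  classical
  have hortho : Submodule.IsOrtho (Submodule.span ℝ (Set.range f))
      (Submodule.span ℝ (Set.range u)) := by
    rw [Submodule.isOrtho_span]
    rintro _ ⟨d, rfl⟩ _ ⟨j, rfl⟩
    exact hfu d j
  have hli : LinearIndependent ℝ (Sum.elim f u) :=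
    hf.sum_type hu.linearIndependent hortho.disjoint
  let T₀ : ((D → ℝ) × EuclideanSpace ℝ (Fin k)) →ₗ[ℝ] EuclideanSpace ℝ (Fin n) :=
    { toFun := fun x => ∑ d, x.1 d • f d + ∑ j, x.2 j • u j
      map_add' := fun x y => by
        simp only [Prod.fst_add, Prod.snd_add, Pi.add_apply, PiLp.add_apply, add_smul,
          Finset.sum_add_distrib]
        abel
      map_smul' := fun r x => by
        simp [Finset.smul_sum, smul_smul] }
  have hT₀ : ∀ x y, T₀ (x, y) = ∑ d, x d • f d + ∑ j, y j • u j := fun _ _ => rfl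
  have hinj : Function.Injective T₀ := by
    rw [← LinearMap.ker_eq_bot, LinearMap.ker_eq_bot']
    rintro ⟨x, y⟩ hxy
    have h := Fintype.linearIndependent_iff.1 hli (Sum.elim x y)
      (by rw [hT₀] at hxy; simpa using hxy)
    refine Prod.ext (funext fun d => h (Sum.inl d)) ?_
    ext j
    exact h (Sum.inr j)
  have hrank : Module.finrank ℝ ((D → ℝ) × EuclideanSpace ℝ (Fin k)) =
      Module.finrank ℝ (EuclideanSpace ℝ (Fin n)) := by simp [hcard]
  let T := (LinearMap.linearEquivOfInjective T₀ hinj hrank).toContinuousLinearEquiv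
  have hT : ∀ x y, T (x, y) = ∑ d, x d • f d + ∑ j, y j • u j := fun _ _ => rfl
  refine ⟨T, hT, ?_⟩
  let ν : Measure ((D → ℝ) × EuclideanSpace ℝ (Fin k)) := (volume : Measure _).map T.symm
  have hν : ν.IsAddHaarMeasure := T.symm.isAddHaarMeasure_map volume
  have hνX : ∀ X, ν X = volume (T '' X) := by
    intro X
    have : ν X = volume (T.symm ⁻¹' X) :=
      T.symm.toHomeomorph.toMeasurableEquiv.map_apply X
    rw [this]
    exact congrArg _ (T.toHomeomorph.image_eq_preimage_symm X).symm
  have hV : (volume : Measure ((D → ℝ) × EuclideanSpace ℝ (Fin k))).IsAddHaarMeasure :=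
    Measure.prod.instIsAddHaarMeasure _ _
  have hprod : ν = ν.addHaarScalarFactor
      (volume : Measure ((D → ℝ) × EuclideanSpace ℝ (Fin k))) • volume :=
    Measure.isAddLeftInvariant_eq_smul ν volume
  set C := ν.addHaarScalarFactor (volume : Measure ((D → ℝ) × EuclideanSpace ℝ (Fin k)))
  have hC : ∀ X, volume (T '' X) = (C : ENNReal) * volume X := by
    intro X
    rw [← hνX, hprod]
    rfl
  refine ⟨C, ?_, ENNReal.coe_ne_top, hC⟩
  let Q : Set (EuclideanSpace ℝ (Fin k)) :=
    (MeasurableEquiv.toLp 2 (Fin k → ℝ)).symm ⁻¹' (Set.univ.pi fun _ => Set.Icc 0 1)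
  have hQ : volume Q = 1 := by
    rw [(EuclideanSpace.volume_preserving_symm_measurableEquiv_toLp (Fin k)).measure_preimage_equiv,
      volume_pi_pi]
    simp
  have hbox := hC ((Set.univ.pi fun _ => Set.Icc 0 1) ×ˢ Q)
  have hvolbox : volume ((Set.univ.pi fun _ : D => Set.Icc (0 : ℝ) 1) ×ˢ Q) = 1 := by
    rw [Measure.volume_eq_prod, Measure.prod_prod, hQ, volume_pi_pi]
    simp
  rw [hvolbox, mul_one] at hbox
  rw [← hbox]
  refine (one_le_volume_parallelepiped hcard hint hu hfu hli).trans (measure_mono ?_)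
  intro x hx
  obtain ⟨s, hs, rfl⟩ := (mem_parallelepiped_iff _ _).1 hx
  refine ⟨(fun d => s (Sum.inl d), WithLp.toLp 2 fun j => s (Sum.inr j)), ⟨?_, ?_⟩, ?_⟩
  · exact fun d _ => ⟨hs.1 _, hs.2 _⟩
  · exact fun j _ => ⟨hs.1 _, hs.2 _⟩
  · rw [hT]; simp

end FrameVolume

/-! ### Products of simplices and cross-polytopes -/

section Simplices

theorem volume_sum_abs_lt_one (κ : Type*) [Fintype κ] :
    volume {x : κ → ℝ | ∑ i, |x i| < 1} =
      ENNReal.ofReal (2 ^ Fintype.card κ / (Fintype.card κ)!) := by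
  have h := volume_sum_rpow_lt_one κ (le_refl (1 : ℝ))
  simp only [Real.rpow_one, div_one] at h
  rw [h, show (1 : ℝ) + 1 = 2 by norm_num, Real.Gamma_two, mul_one, Real.Gamma_nat_eq_factorial]

/-- The ball contains the cross-polytope. -/
theorem le_volume_ball (k : ℕ) :
    ENNReal.ofReal (2 ^ k / k !) ≤ volume (Metric.ball (0 : EuclideanSpace ℝ (Fin k)) 1) := by
  have h := volume_sum_abs_lt_one (Fin k)
  rw [Fintype.card_fin] at h
  rw [← h, ← (EuclideanSpace.volume_preserving_symm_measurableEquiv_toLp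
    (Fin k)).measure_preimage_equiv]
  refine measure_mono fun x hx => ?_
  have hx : ∑ i, |x i| < 1 := hx
  rw [mem_ball_zero_iff, EuclideanSpace.norm_eq, Real.sqrt_lt' one_pos]
  have h0 : 0 ≤ ∑ i, |x i| := Finset.sum_nonneg fun _ _ => abs_nonneg _
  calc ∑ i, ‖x i‖ ^ 2 ≤ (∑ i, |x i|) ^ 2 := by
        simp only [Real.norm_eq_abs]
        exact Finset.sum_sq_le_sq_sum_of_nonneg fun i _ => abs_nonneg _
    _ < 1 ^ 2 := by gcongr

/-- The cross-polytope is covered by the reflected copies of the simplex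
`{x ≥ 0, ∑ x_i ≤ 1}`. -/
theorem le_volume_simplex (κ : Type*) [Fintype κ] :
    ENNReal.ofReal (1 / (Fintype.card κ)!) ≤
      volume {x : κ → ℝ | (∀ i, 0 ≤ x i) ∧ ∑ i, x i ≤ 1} := by
  classical
  set Δ := {x : κ → ℝ | (∀ i, 0 ≤ x i) ∧ ∑ i, x i ≤ 1} with hΔ
  let R : (κ → Bool) → (κ → ℝ) → (κ → ℝ) := fun ε x i => if ε i then x i else -x i
  have hR : ∀ ε, MeasurePreserving (R ε) volume volume := by
    intro ε
    refine volume_preserving_pi (f := fun i (y : ℝ) => if ε i then y else -y) fun i => ?_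
    by_cases h : ε i
    · simp only [h, if_true]
      exact MeasurePreserving.id volume
    · simpa [h] using Measure.measurePreserving_neg (volume : Measure ℝ)
  have hmeas : MeasurableSet Δ := by
    apply IsClosed.measurableSet
    simp only [hΔ, Set.ofPred_and]
    refine IsClosed.inter ?_ (isClosed_le (by fun_prop) (by fun_prop))
    simp only [Set.ofPred_forall]
    exact isClosed_iInter fun i => isClosed_le (by fun_prop) (by fun_prop)
  have hcover : {x : κ → ℝ | ∑ i, |x i| < 1} ⊆ ⋃ ε : κ → Bool, R ε ⁻¹' Δ := by
    intro x hx
    refine Set.mem_iUnion.2 ⟨fun i => decide (0 ≤ x i), ?_⟩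
    have habs : R (fun i => decide (0 ≤ x i)) x = fun i => |x i| := by
      funext i
      by_cases h : 0 ≤ x i
      · simp [R, h, abs_of_nonneg h]
      · simp [R, h, abs_of_neg (not_le.1 h)]
    refine ⟨fun i => ?_, ?_⟩
    · rw [habs]; exact abs_nonneg _
    · rw [habs]; exact le_of_lt hx
  have h1 := (measure_mono hcover).trans (measure_iUnion_fintype_le volume _)
  simp only [(hR _).measure_preimage hmeas.nullMeasurableSet, Finset.sum_const, nsmul_eq_mul,
    Finset.card_univ, Fintype.card_fun, Fintype.card_bool] at h1
  rw [volume_sum_abs_lt_one] at h1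
  have h2 : ENNReal.ofReal (2 ^ Fintype.card κ / (Fintype.card κ)!) =
      ((2 ^ Fintype.card κ : ℕ) : ENNReal) * ENNReal.ofReal (1 / (Fintype.card κ)!) := by
    rw [← ENNReal.ofReal_natCast, ← ENNReal.ofReal_mul (by positivity)]
    congr 1
    push_cast
    ring
  rw [h2] at h1
  exact (ENNReal.mul_le_mul_iff_right (by positivity) (ENNReal.natCast_ne_top _)).1 h1

theorem volume_preserving_sigma_uncurry {ι : Type*} [Fintype ι] (κ : ι → Type*)
    [∀ i, Fintype (κ i)] :
    MeasurePreserving (fun (x : ∀ i, κ i → ℝ) (p : Σ i, κ i) => x p.1 p.2) volume volume := by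
  have hm : Measurable (fun (x : ∀ i, κ i → ℝ) (p : Σ i, κ i) => x p.1 p.2) := by fun_prop
  refine ⟨hm, ?_⟩
  rw [volume_pi (ι := Σ i, κ i)]
  refine (Measure.pi_eq fun s hs => ?_).symm
  rw [Measure.map_apply hm (MeasurableSet.univ_pi hs)]
  have : (fun (x : ∀ i, κ i → ℝ) (p : Σ i, κ i) => x p.1 p.2) ⁻¹' Set.univ.pi s =
      Set.univ.pi fun i => Set.univ.pi fun j => s ⟨i, j⟩ := by
    ext x
    simp [Set.mem_pi, Sigma.forall]
  rw [this, volume_pi_pi]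
  simp only [volume_pi_pi, Fintype.prod_sigma]

/-- The product of the simplices `{x ≥ 0, ∑ x_j ≤ 1}` in the spaces `κ i → ℝ`. -/
def simplexProduct {ι : Type*} (κ : ι → Type*) [∀ i, Fintype (κ i)] : Set ((Σ i, κ i) → ℝ) :=
  {x | (∀ p, 0 ≤ x p) ∧ ∀ i, ∑ j, x ⟨i, j⟩ ≤ 1}

theorem isCompact_simplexProduct {ι : Type*} [Fintype ι] (κ : ι → Type*) [∀ i, Fintype (κ i)] :
    IsCompact (simplexProduct κ) := by
  refine (isCompact_univ_pi fun _ : Σ i, κ i => isCompact_Icc (a := (0 : ℝ)) (b := 1)).of_isClosed_subset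
    ?_ ?_
  · simp only [simplexProduct, Set.ofPred_and, Set.ofPred_forall]
    exact (isClosed_iInter fun i => isClosed_le (by fun_prop) (by fun_prop)).inter
      (isClosed_iInter fun i => isClosed_le (by fun_prop) (by fun_prop))
  · rintro x ⟨h0, h1⟩ ⟨i, j⟩ -
    exact ⟨h0 _, (Finset.single_le_sum (f := fun j => x ⟨i, j⟩) (fun j _ => h0 _)
      (Finset.mem_univ j)).trans (h1 i)⟩

/-- Only the lower bound by `∏ 1 / (#κ i)!` is needed; it is in fact the volume. -/
theorem le_volume_simplexProduct {ι : Type*} [Fintype ι] (κ : ι → Type*) [∀ i, Fintype (κ i)] :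
    ENNReal.ofReal (1 / ∏ i, ((Fintype.card (κ i))! : ℝ)) ≤ volume (simplexProduct κ) := by
  rw [← (volume_preserving_sigma_uncurry κ).measure_preimage
    (isCompact_simplexProduct κ).measurableSet.nullMeasurableSet]
  have : (fun (x : ∀ i, κ i → ℝ) (p : Σ i, κ i) => x p.1 p.2) ⁻¹' simplexProduct κ =
      Set.univ.pi fun i => {x : κ i → ℝ | (∀ j, 0 ≤ x j) ∧ ∑ j, x j ≤ 1} := by
    ext x
    simp only [simplexProduct, Set.mem_preimage, Set.mem_ofPred_eq, Set.mem_pi, Set.mem_univ,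
      true_imp_iff, Sigma.forall]
    exact ⟨fun h i => ⟨h.1 i, h.2 i⟩, fun h => ⟨fun i => (h i).1, fun i => (h i).2⟩⟩
  rw [this, volume_pi_pi, one_div, ← Finset.prod_inv_distrib, ENNReal.ofReal_prod_of_nonneg
    (fun i _ => by positivity)]
  refine Finset.prod_le_prod' fun i _ => ?_
  rw [← one_div]
  exact le_volume_simplex (κ i)

end Simplices

/-! ### The cells of the arrangement -/

section Cells

variable {n : ℕ} {ι P : Type*} [Fintype ι] [Fintype P]

/-- The vectors `(e_{cls p}, a p)`, for `p` active at one point, are linearly independent. -/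
def ActiveSetsIndependent [DecidableEq ι] (cls : P → ι) (a : P → EuclideanSpace ℝ (Fin n))
    (b : P → ℝ) : Prop :=
  ∀ x, LinearIndependent ℝ (fun p : activeSet cls a b x =>
    ((Pi.single (cls p) 1 : ι → ℝ), a p))

/-- The elements of `S` in the class `i`, except for a base point. -/
abbrev OffBase (cls : P → ι) (S : Finset P) (base : ι → P) (i : ι) : Type _ :=
  {p : P // p ∈ S ∧ cls p = i ∧ p ≠ base i}

noncomputable instance (cls : P → ι) (S : Finset P) (base : ι → P) (i : ι) :
    Fintype (OffBase cls S base i) := Fintype.ofFinite _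

/-- The edge vectors `a p - a (base i)` of the simplices with the vertices `a p`, where `p ∈ S` and
`cls p = i`. -/
def edgeVector (cls : P → ι) (a : P → EuclideanSpace ℝ (Fin n)) (S : Finset P) (base : ι → P)
    (d : Σ i, OffBase cls S base i) : EuclideanSpace ℝ (Fin n) :=
  a d.2 - a (base d.1)

/-- Coordinates adapted to the cell `{x | activeSet x = S}`: the cell is a relatively open subset of
the affine space through `origin` with the orthonormal direction vectors `u`, and the edge vectors
form a basis of the orthogonal complement of that direction, which contains `origin`. -/
structure CellFrame (cls : P → ι) (a : P → EuclideanSpace ℝ (Fin n)) (b : P → ℝ)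
    (S : Finset P) where
  base : ι → P
  base_mem : ∀ i, base i ∈ S
  cls_base : ∀ i, cls (base i) = i
  k : ℕ
  u : Fin k → EuclideanSpace ℝ (Fin n)
  orthonormal : Orthonormal ℝ u
  inner_edgeVector : ∀ d j, inner ℝ (edgeVector cls a S base d) (u j) = 0
  linearIndependent : LinearIndependent ℝ (edgeVector cls a S base)
  card_add : Fintype.card (Σ i, OffBase cls S base i) + k = n
  coeff : (Σ i, OffBase cls S base i) → ℝ
  point : EuclideanSpace ℝ (Fin k)
  activeSet_point : activeSet cls a b
    (∑ d, coeff d • edgeVector cls a S base d + ∑ j, point j • u j) = S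

variable {cls : P → ι} {a : P → EuclideanSpace ℝ (Fin n)} {b : P → ℝ}

omit [Fintype ι] in
theorem card_offBase [DecidableEq ι] {S : Finset P} {base : ι → P} (hmem : ∀ i, base i ∈ S)
    (hbase : ∀ i, cls (base i) = i) (i : ι) :
    Fintype.card (OffBase cls S base i) = (S.filter fun p => cls p = i).card - 1 := by
  classical
  have h1 : base i ∈ S.filter fun p => cls p = i := by simp [hmem, hbase]
  rw [← Finset.card_erase_of_mem h1, Fintype.card_of_subtype]
  intro p
  simp only [Finset.mem_erase, Finset.mem_filter]
  tauto

/-- A relation between the edge vectors is one between the vectors `(e_{cls p}, a p)`: the coefficient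
of the base point of a class is minus the sum of the others. -/
theorem linearIndependent_edgeVector [DecidableEq ι] {S : Finset P} {base : ι → P}
    (hmem : ∀ i, base i ∈ S) (hbase : ∀ i, cls (base i) = i)
    (h : LinearIndependent ℝ (fun p : S => ((Pi.single (cls p) 1 : ι → ℝ), a p))) :
    LinearIndependent ℝ (edgeVector cls a S base) := by
  classical
  have hbasis : LinearIndependent ℝ (fun d : Σ i, OffBase cls S base i =>
      (Pi.single ⟨d.2.1, d.2.2.1⟩ 1 - Pi.single ⟨base d.1, hmem d.1⟩ 1 : S → ℝ)) := by
    rw [Fintype.linearIndependent_iff]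
    intro g hg d
    have h1 := congrFun hg ⟨d.2.1, d.2.2.1⟩
    simp only [Finset.sum_apply, Pi.smul_apply, Pi.sub_apply, Pi.single_apply, Subtype.mk.injEq,
      smul_eq_mul, Pi.zero_apply] at h1
    rw [Finset.sum_eq_single d] at h1
    · have : d.2.1 ≠ base d.1 := d.2.2.2.2
      simpa [this] using h1
    · rintro ⟨i, p, hp⟩ - hne
      have h2 : d.2.1 ≠ base i := by
        intro h3
        have h4 : d.1 = i := by rw [← d.2.2.2.1, h3, hbase]
        exact d.2.2.2.2 (h3.trans (congrArg base h4.symm))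
      have h3 : d.2.1 ≠ p := by
        intro h4
        apply hne
        obtain ⟨j, q, hq⟩ := d
        simp only at h4
        subst h4
        obtain rfl : i = j := hp.2.1.symm.trans hq.2.1
        rfl
      simp [h2, h3]
    · simp
  have hinj := LinearIndependent.fintypeLinearCombination_injective h
  have h2 := hbasis.map' (Fintype.linearCombination ℝ fun p : S =>
    ((Pi.single (cls p) 1 : ι → ℝ), a p)) (LinearMap.ker_eq_bot.2 hinj)
  have h3 : (Fintype.linearCombination ℝ fun p : S => ((Pi.single (cls p) 1 : ι → ℝ), a p)) ∘
      (fun d : Σ i, OffBase cls S base i =>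
      (Pi.single ⟨d.2.1, d.2.2.1⟩ 1 - Pi.single ⟨base d.1, hmem d.1⟩ 1 : S → ℝ)) =
      (LinearMap.inr ℝ (ι → ℝ) (EuclideanSpace ℝ (Fin n))) ∘ edgeVector cls a S base := by
    funext d
    simp only [Function.comp_apply, map_sub, Fintype.linearCombination_apply_single, one_smul,
      edgeVector, LinearMap.inr_apply, hbase, d.2.2.2.1, Prod.mk_sub_mk, sub_self]
  rw [h3] at h2
  exact h2.of_comp

omit [Fintype ι] [Fintype P] in
theorem inner_sum_smul_orthonormal {k : ℕ} {u : Fin k → EuclideanSpace ℝ (Fin n)}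
    (hu : Orthonormal ℝ u) (z w : EuclideanSpace ℝ (Fin k)) :
    inner ℝ (∑ j, z j • u j) (∑ j, w j • u j) = inner ℝ z w := by
  rw [hu.inner_sum]
  simp [PiLp.inner_apply, mul_comm]

omit [Fintype ι] [Fintype P] in
theorem edgeVector_integral (hint : ∀ p, ∃ w : Fin n → ℤ, a p = WithLp.toLp 2 (fun j => (w j : ℝ)))
    (S : Finset P) (base : ι → P) (d : Σ i, OffBase cls S base i) :
    ∃ w : Fin n → ℤ, edgeVector cls a S base d = WithLp.toLp 2 (fun j => (w j : ℝ)) := by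
  obtain ⟨w₁, h₁⟩ := hint d.2
  obtain ⟨w₂, h₂⟩ := hint (base d.1)
  refine ⟨w₁ - w₂, ?_⟩
  rw [edgeVector, h₁, h₂]
  ext j
  simp

/-- The frame of a cell; linear independence of the edge vectors gives the dimension `k`, and `origin` is
the projection of a point of the cell to the span of the edge vectors. -/
theorem nonempty_cellFrame [DecidableEq ι] (hcls : Function.Surjective cls)
    (hint : ∀ p, ∃ w : Fin n → ℤ, a p = WithLp.toLp 2 (fun j => (w j : ℝ)))
    (hgen : ActiveSetsIndependent cls a b) (x : EuclideanSpace ℝ (Fin n)) :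
    Nonempty (CellFrame cls a b (activeSet cls a b x)) := by
  classical
  choose base hmem hbase using exists_mem_activeSet hcls a b x
  set S := activeSet cls a b x with hS
  have hli := linearIndependent_edgeVector (a := a) hmem hbase (hgen x)
  set K := Submodule.span ℝ (Set.range (edgeVector cls a S base)) with hK
  have hrank := K.finrank_add_finrank_orthogonal
  rw [hK, finrank_span_eq_card hli, ← hK, finrank_euclideanSpace_fin] at hrank
  let v := stdOrthonormalBasis ℝ Kᗮ
  let u : Fin (Module.finrank ℝ Kᗮ) → EuclideanSpace ℝ (Fin n) := fun j => v j
  have hu : Orthonormal ℝ u := v.orthonormal.comp_linearIsometry Kᗮ.subtypeₗᵢ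
  have hfu : ∀ d j, inner ℝ (edgeVector cls a S base d) (u j) = 0 := fun d j =>
    (Submodule.mem_orthogonal _ _).1 (v j).2 _ (Submodule.subset_span ⟨d, rfl⟩)
  obtain ⟨T, hT, -⟩ := exists_frame_equiv hrank (edgeVector_integral hint S base) hu hfu hli
  refine ⟨⟨base, hmem, hbase, _, u, hu, hfu, hli, hrank, (T.symm x).1, (T.symm x).2, ?_⟩⟩
  rw [← hT, Prod.mk.eta, T.apply_symm_apply]

namespace CellFrame

variable {S : Finset P} (F : CellFrame cls a b S)

/-- The edge vectors of the cell. -/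
abbrev edge : (Σ i, OffBase cls S F.base i) → EuclideanSpace ℝ (Fin n) :=
  edgeVector cls a S F.base

/-- The base point of the affine hull of the cell, orthogonal to the direction of the hull. -/
noncomputable def origin : EuclideanSpace ℝ (Fin n) := ∑ d, F.coeff d • F.edge d

/-- The isometric embedding of `ℝᵏ` onto the direction of the affine hull of the cell. -/
noncomputable def incl (z : EuclideanSpace ℝ (Fin F.k)) : EuclideanSpace ℝ (Fin n) := ∑ j, z j • F.u j

theorem continuous_incl : Continuous F.incl := by
  unfold incl
  fun_prop

theorem incl_smul (r : ℝ) (z : EuclideanSpace ℝ (Fin F.k)) : F.incl (r • z) = r • F.incl z := by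
  simp [incl, Finset.smul_sum, smul_smul]

theorem inner_incl_incl (z w : EuclideanSpace ℝ (Fin F.k)) :
    inner ℝ (F.incl z) (F.incl w) = inner ℝ z w :=
  inner_sum_smul_orthonormal F.orthonormal z w

theorem inner_edge_incl (d : Σ i, OffBase cls S F.base i) (z : EuclideanSpace ℝ (Fin F.k)) :
    inner ℝ (F.edge d) (F.incl z) = 0 := by
  simp [incl, inner_sum, real_inner_smul_right, F.inner_edgeVector]

theorem inner_origin_incl (z : EuclideanSpace ℝ (Fin F.k)) :
    inner ℝ F.origin (F.incl z) = 0 := by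
  simp [origin, sum_inner, real_inner_smul_left, F.inner_edge_incl]

theorem norm_sq_origin_add_incl (z : EuclideanSpace ℝ (Fin F.k)) :
    ‖F.origin + F.incl z‖ ^ 2 = ‖F.origin‖ ^ 2 + ‖z‖ ^ 2 := by
  rw [norm_add_sq_real, F.inner_origin_incl, ← real_inner_self_eq_norm_sq (F.incl z),
    F.inner_incl_incl, real_inner_self_eq_norm_sq]
  ring

theorem activeSet_origin_add_incl_point :
    activeSet cls a b (F.origin + F.incl F.point) = S := F.activeSet_point

theorem inner_sub_base_eq {x : EuclideanSpace ℝ (Fin n)} (hx : activeSet cls a b x = S) {p : P}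
    (hp : p ∈ S) : inner ℝ (a p - a (F.base (cls p))) x = b p - b (F.base (cls p)) := by
  have h1 : p ∈ activeSet cls a b x := hx ▸ hp
  have h2 : F.base (cls p) ∈ activeSet cls a b x := hx ▸ F.base_mem (cls p)
  have h3 := mem_activeSet.1 h1 (F.base (cls p)) (F.cls_base _)
  have h4 := mem_activeSet.1 h2 p (F.cls_base _).symm
  rw [inner_sub_left]
  linarith

theorem inner_sub_base_lt {x : EuclideanSpace ℝ (Fin n)} (hx : activeSet cls a b x = S) {p : P}
    (hp : p ∉ S) : inner ℝ (a p - a (F.base (cls p))) x < b p - b (F.base (cls p)) := by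
  have h2 : F.base (cls p) ∈ activeSet cls a b x := hx ▸ F.base_mem (cls p)
  by_contra hge
  rw [inner_sub_left] at hge
  refine hp (hx ▸ mem_activeSet.2 fun q hq => ?_)
  have h3 := mem_activeSet.1 h2 q (hq.trans (F.cls_base _).symm)
  linarith

theorem exists_eq_origin_add_incl {x : EuclideanSpace ℝ (Fin n)}
    (hint : ∀ p, ∃ w : Fin n → ℤ, a p = WithLp.toLp 2 (fun j => (w j : ℝ)))
    (hx : activeSet cls a b x = S) : ∃ z, x = F.origin + F.incl z := by
  obtain ⟨T, hT, -⟩ := exists_frame_equiv F.card_add (edgeVector_integral hint S F.base) F.orthonormal F.inner_edgeVector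
    F.linearIndependent
  obtain ⟨⟨y, z⟩, hyz⟩ := T.surjective (x - F.origin)
  rw [hT] at hyz
  have hedge : ∀ d, inner ℝ (F.edge d) (x - F.origin) = 0 := by
    rintro ⟨i, p, hp, hpi, hne⟩
    subst hpi
    have h1 := F.inner_sub_base_eq hx hp
    have h2 := F.inner_sub_base_eq F.activeSet_origin_add_incl_point hp
    have h3 := F.inner_edge_incl ⟨_, p, hp, rfl, hne⟩ F.point
    simp only [edge, edgeVector] at h3 ⊢
    rw [inner_add_right, h3] at h2
    rw [inner_sub_right]
    linarith
  have hzero : ∑ d, y d • F.edge d = 0 := by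
    rw [← inner_self_eq_zero (𝕜 := ℝ)]
    have h1 : inner ℝ (∑ d, y d • F.edge d) (x - F.origin) = 0 := by
      simp [sum_inner, real_inner_smul_left, hedge]
    have h2 : inner ℝ (∑ d, y d • F.edge d) (F.incl z) = 0 := by
      simp [sum_inner, real_inner_smul_left, F.inner_edge_incl]
    rw [← hyz, inner_add_right] at h1
    simp only [incl] at h2
    linarith
  refine ⟨z, ?_⟩
  rw [hzero, zero_add] at hyz
  rw [incl, hyz]
  abel

theorem activeSet_eq_iff (z : EuclideanSpace ℝ (Fin F.k)) :
    activeSet cls a b (F.origin + F.incl z) = S ↔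
      ∀ p ∉ S, inner ℝ (a p - a (F.base (cls p))) (F.origin + F.incl z) <
        b p - b (F.base (cls p)) := by
  refine ⟨fun h p hp => F.inner_sub_base_lt h hp, fun h => ?_⟩
  have hS : ∀ p ∈ S, inner ℝ (a p - a (F.base (cls p))) (F.origin + F.incl z) =
      b p - b (F.base (cls p)) := by
    intro p hp
    have h1 := F.inner_sub_base_eq F.activeSet_origin_add_incl_point hp
    have h2 : ∀ w, inner ℝ (a p - a (F.base (cls p))) (F.incl w) = 0 := by
      intro w
      by_cases hne : p = F.base (cls p)
      · rw [← hne, sub_self, inner_zero_left]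
      · exact F.inner_edge_incl ⟨_, p, hp, rfl, hne⟩ w
    rw [inner_add_right, h2] at h1 ⊢
    exact h1
  have hle : ∀ p, inner ℝ (a p - a (F.base (cls p))) (F.origin + F.incl z) ≤
      b p - b (F.base (cls p)) := fun p =>
    (Classical.em (p ∈ S)).elim (fun hp => (hS p hp).le) fun hp => (h p hp).le
  ext p
  rw [mem_activeSet]
  constructor
  · intro hp
    by_contra hpS
    have h1 := h p hpS
    have h2 := hp (F.base (cls p)) (F.cls_base _)
    rw [inner_sub_left] at h1
    linarith
  · intro hp q hq
    have h1 := hS p hp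
    have h2 := hle q
    rw [hq] at h2
    rw [inner_sub_left] at h1 h2
    linarith

end CellFrame

end Cells

/-! ### The volume of the gradient image of a cell -/

section GradientInverse

variable {E : Type*} [NormedAddCommGroup E] [InnerProductSpace ℝ E]

/-- The inverse `w ↦ σ w / √(1 - ‖w‖²)` of `ballGradient σ` on the open unit ball. -/
noncomputable def ballGradientInv (σ : ℝ) (w : E) : E := (σ / √(1 - ‖w‖ ^ 2)) • w

omit [InnerProductSpace ℝ E] in
theorem one_sub_norm_sq_pos {w : E} (hw : ‖w‖ < 1) : 0 < 1 - ‖w‖ ^ 2 := by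
  have := norm_nonneg w
  nlinarith

theorem sqrt_add_norm_ballGradientInv_sq {σ : ℝ} (hσ : 0 < σ) {w : E} (hw : ‖w‖ < 1) :
    √(σ ^ 2 + ‖ballGradientInv σ w‖ ^ 2) = σ / √(1 - ‖w‖ ^ 2) := by
  have h := one_sub_norm_sq_pos hw
  have h1 : σ ^ 2 + ‖ballGradientInv σ w‖ ^ 2 = (σ / √(1 - ‖w‖ ^ 2)) ^ 2 := by
    rw [ballGradientInv, norm_smul, mul_pow, Real.norm_eq_abs, sq_abs, div_pow, Real.sq_sqrt h.le]
    field_simp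
    ring
  rw [h1, Real.sqrt_sq (by positivity)]

theorem ballGradientInv_ballGradient {σ : ℝ} (hσ : 0 < σ) (z : E) :
    ballGradientInv σ (ballGradient σ z) = z := by
  have hα : 0 < √(σ ^ 2 + ‖z‖ ^ 2) := by positivity
  have hα2 : √(σ ^ 2 + ‖z‖ ^ 2) ^ 2 = σ ^ 2 + ‖z‖ ^ 2 := Real.sq_sqrt (by positivity)
  set α := √(σ ^ 2 + ‖z‖ ^ 2) with hα'
  have h1 : 1 - ‖ballGradient σ z‖ ^ 2 = (σ / α) ^ 2 := by
    rw [ballGradient, norm_smul, ← hα', mul_pow, Real.norm_eq_abs, sq_abs, inv_pow, div_pow]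
    field_simp
    linarith
  rw [ballGradientInv, h1, Real.sqrt_sq (by positivity), ballGradient, ← hα', smul_smul]
  have : σ / (σ / α) * α⁻¹ = 1 := by field_simp
  rw [this, one_smul]

theorem measurable_ballGradientInv [MeasurableSpace E] [BorelSpace E]
    [SecondCountableTopology E] (σ : ℝ) : Measurable (ballGradientInv σ : E → E) := by
  unfold ballGradientInv
  fun_prop

end GradientInverse

section CellVolume

variable {n : ℕ} {ι P : Type*} [Fintype ι] [Fintype P]
variable {cls : P → ι} {a : P → EuclideanSpace ℝ (Fin n)} {b : P → ℝ} {S : Finset P}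

namespace CellFrame

variable (F : CellFrame cls a b S)

/-- The effective smoothing parameter on the affine hull of the cell. -/
noncomputable def scale (t : ℝ) : ℝ := √(t ^ 2 + ‖F.origin‖ ^ 2)

theorem scale_pos {t : ℝ} (ht : 0 < t) : 0 < F.scale t := by
  unfold scale
  positivity

/-- The projection of the image of the cell under `ballGradient t` to the direction of the
cell. -/
def gradientSlice (t : ℝ) : Set (EuclideanSpace ℝ (Fin F.k)) :=
  {w | ‖w‖ < 1 ∧ activeSet cls a b (F.origin + F.incl (ballGradientInv (F.scale t) w)) = S}

theorem measurableSet_gradientSlice (t : ℝ) : MeasurableSet (F.gradientSlice t) := by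
  have hm : Measurable fun w : EuclideanSpace ℝ (Fin F.k) =>
      F.origin + F.incl (ballGradientInv (F.scale t) w) :=
    (F.continuous_incl.measurable.comp (measurable_ballGradientInv _)).const_add _
  simp only [gradientSlice, F.activeSet_eq_iff, Set.ofPred_and, Set.ofPred_forall]
  refine (measurableSet_lt measurable_norm measurable_const).inter
    (MeasurableSet.iInter fun p => MeasurableSet.iInter fun _ => ?_)
  exact measurableSet_lt (measurable_const.inner hm) measurable_const

theorem ballGradient_origin_add_incl {t : ℝ} (ht : 0 < t) {w : EuclideanSpace ℝ (Fin F.k)}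
    (hw : ‖w‖ < 1) :
    ballGradient t (F.origin + F.incl (ballGradientInv (F.scale t) w)) =
      (√(1 - ‖w‖ ^ 2) / F.scale t) • F.origin + F.incl w := by
  have h0 := Real.sqrt_pos.2 (one_sub_norm_sq_pos hw)
  have hσ := F.scale_pos ht
  have h1 : t ^ 2 + ‖F.origin + F.incl (ballGradientInv (F.scale t) w)‖ ^ 2 =
      F.scale t ^ 2 + ‖ballGradientInv (F.scale t) w‖ ^ 2 := by
    rw [F.norm_sq_origin_add_incl, scale, Real.sq_sqrt (by positivity)]
    ring
  rw [ballGradient, h1, sqrt_add_norm_ballGradientInv_sq hσ hw, inv_div, smul_add]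
  congr 1
  rw [ballGradientInv, F.incl_smul, smul_smul]
  have : √(1 - ‖w‖ ^ 2) / F.scale t * (F.scale t / √(1 - ‖w‖ ^ 2)) = 1 := by field_simp
  rw [this, one_smul]

theorem mem_convexHull_iff (i : ι) (z : EuclideanSpace ℝ (Fin n)) :
    z ∈ convexHull ℝ (a '' {p | p ∈ (S : Set P) ∧ cls p = i}) ↔
      ∃ δ : OffBase cls S F.base i → ℝ, ((∀ p, 0 ≤ δ p) ∧ ∑ p, δ p ≤ 1) ∧
        z = a (F.base i) + ∑ p, δ p • F.edge ⟨i, p⟩ := by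
  classical
  constructor
  · intro hz
    refine convexHull_min (t := {z | ∃ δ : OffBase cls S F.base i → ℝ,
      ((∀ p, 0 ≤ δ p) ∧ ∑ p, δ p ≤ 1) ∧ z = a (F.base i) + ∑ p, δ p • F.edge ⟨i, p⟩}) ?_ ?_ hz
    · rintro _ ⟨p, ⟨hp, hpi⟩, rfl⟩
      by_cases hne : p = F.base i
      · exact ⟨0, by simp, by simp [hne]⟩
      · refine ⟨Pi.single ⟨p, hp, hpi, hne⟩ 1, ⟨fun q => ?_, ?_⟩, ?_⟩
        · rw [Pi.single_apply]; split_ifs <;> norm_num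
        · simp
        · rw [Finset.sum_eq_single ⟨p, hp, hpi, hne⟩]
          · simp [edge, edgeVector]
          · intro q _ hq
            simp [hq]
          · simp
    · rintro _ ⟨δ, ⟨h0, h1⟩, rfl⟩ _ ⟨δ', ⟨h0', h1'⟩, rfl⟩ s s' hs hs' hss
      refine ⟨s • δ + s' • δ', ⟨fun p => ?_, ?_⟩, ?_⟩
      · have := mul_nonneg hs (h0 p)
        have := mul_nonneg hs' (h0' p)
        simp only [Pi.add_apply, Pi.smul_apply, smul_eq_mul]
        linarith
      · simp only [Pi.add_apply, Pi.smul_apply, smul_eq_mul, Finset.sum_add_distrib,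
          ← Finset.mul_sum]
        nlinarith
      · simp only [Pi.add_apply, Pi.smul_apply, smul_eq_mul, add_smul, mul_smul,
          Finset.sum_add_distrib, ← Finset.smul_sum, smul_add]
        have hb : a (F.base i) = s • a (F.base i) + s' • a (F.base i) := by
          rw [← add_smul, hss, one_smul]
        nth_rewrite 3 [hb]
        abel
  · rintro ⟨δ, ⟨h0, h1⟩, rfl⟩
    have hmem : ∑ o : Option (OffBase cls S F.base i),
        (o.elim (1 - ∑ p, δ p) δ) • (o.elim (a (F.base i)) fun p => a p) ∈
          convexHull ℝ (a '' {p | p ∈ (S : Set P) ∧ cls p = i}) := by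
      refine (convex_convexHull ℝ _).sum_mem ?_ ?_ ?_
      · rintro (_ | p) -
        · simpa using h1
        · exact h0 p
      · simp [Fintype.sum_option]
      · rintro (_ | p) -
        · exact subset_convexHull ℝ _ ⟨_, ⟨F.base_mem i, F.cls_base i⟩, rfl⟩
        · exact subset_convexHull ℝ _ ⟨_, ⟨p.2.1, p.2.2.1⟩, rfl⟩
    convert hmem using 1
    simp only [Fintype.sum_option, Option.elim, edge, edgeVector, smul_sub, sub_smul, one_smul,
      Finset.sum_sub_distrib, Finset.sum_smul]
    abel

/-- The vertex `∑ c_i a (base i)` of the mixed cell. -/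
noncomputable def vertex (c : ι → ℝ) : EuclideanSpace ℝ (Fin n) := ∑ i, c i • a (F.base i)

theorem mem_mixedCell_iff (c : ι → ℝ) (y : EuclideanSpace ℝ (Fin n)) :
    y ∈ mixedCell cls a c S ↔
      ∃ δ ∈ simplexProduct (OffBase cls S F.base),
        y = F.vertex c + ∑ d, (c d.1 * δ d) • F.edge d := by
  rw [mem_mixedCell]
  simp only [F.mem_convexHull_iff]
  constructor
  · rintro ⟨z, hz, rfl⟩
    choose δ hδ hzδ using hz
    refine ⟨fun d => δ d.1 d.2, ⟨fun d => (hδ d.1).1 d.2, fun i => (hδ i).2⟩, ?_⟩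
    simp only [hzδ, smul_add, Finset.sum_add_distrib, vertex, Fintype.sum_sigma, Finset.smul_sum,
      smul_smul]
  · rintro ⟨δ, hδ, rfl⟩
    refine ⟨fun i => a (F.base i) + ∑ p, δ ⟨i, p⟩ • F.edge ⟨i, p⟩,
      fun i => ⟨fun p => δ ⟨i, p⟩, ⟨fun p => hδ.1 _, hδ.2 i⟩, rfl⟩, ?_⟩
    simp only [smul_add, Finset.sum_add_distrib, vertex, Fintype.sum_sigma, Finset.smul_sum,
      smul_smul]

/-- The gradient image of the cell is, in adapted coordinates, a family of translates of a product
of simplices over the dilated slice. -/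
theorem mem_gradientCell_iff
    (hint : ∀ p, ∃ w : Fin n → ℤ, a p = WithLp.toLp 2 (fun j => (w j : ℝ))) {t : ℝ} (ht : 0 < t)
    (c : ι → ℝ) (r : ℝ) (y : EuclideanSpace ℝ (Fin n)) :
    y ∈ gradientCell cls a b t c r S ↔
      ∃ w ∈ F.gradientSlice t, ∃ δ ∈ simplexProduct (OffBase cls S F.base),
        y = F.vertex c + (∑ d, (c d.1 * δ d + r * (√(1 - ‖w‖ ^ 2) / F.scale t) * F.coeff d) •
          F.edge d + ∑ j, (r • w) j • F.u j) := by
  have key : ∀ w : EuclideanSpace ℝ (Fin F.k), ‖w‖ < 1 →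
      ((y - r • ballGradient t (F.origin + F.incl (ballGradientInv (F.scale t) w)) ∈
        mixedCell cls a c S) ↔ ∃ δ ∈ simplexProduct (OffBase cls S F.base),
        y = F.vertex c + (∑ d, (c d.1 * δ d + r * (√(1 - ‖w‖ ^ 2) / F.scale t) * F.coeff d) •
          F.edge d + ∑ j, (r • w) j • F.u j)) := by
    intro w hw
    rw [F.mem_mixedCell_iff, F.ballGradient_origin_add_incl ht hw]
    refine exists_congr fun δ => and_congr_right fun _ => ?_
    have h1 : ∑ d, (c d.1 * δ d + r * (√(1 - ‖w‖ ^ 2) / F.scale t) * F.coeff d) • F.edge d =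
        ∑ d, (c d.1 * δ d) • F.edge d + (r * (√(1 - ‖w‖ ^ 2) / F.scale t)) • F.origin := by
      simp only [origin, add_smul, Finset.sum_add_distrib, Finset.smul_sum, smul_smul]
    have h2 : ∑ j, (r • w) j • F.u j = r • F.incl w := (F.incl_smul r w)
    rw [h1, h2, sub_eq_iff_eq_add, smul_add, smul_smul]
    simp only [add_assoc]
  constructor
  · rintro ⟨x, hx, hy⟩
    obtain ⟨z, rfl⟩ := F.exists_eq_origin_add_incl hint hx
    have hw := norm_ballGradient_lt_one (F.scale_pos ht) z
    have hz := ballGradientInv_ballGradient (F.scale_pos ht) z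
    refine ⟨ballGradient (F.scale t) z, ⟨hw, by rwa [hz]⟩, (key _ hw).1 (by rwa [hz])⟩
  · rintro ⟨w, ⟨hw, hact⟩, hδ⟩
    exact ⟨_, hact, (key w hw).2 hδ⟩

/-- The volume of the gradient image of a cell, as a monomial in the dilation factors. -/
theorem exists_volume_gradientCell
    (hint : ∀ p, ∃ w : Fin n → ℤ, a p = WithLp.toLp 2 (fun j => (w j : ℝ))) {t : ℝ} (ht : 0 < t) :
    ∃ C : ENNReal, 1 ≤ C ∧ C ≠ ⊤ ∧ ∀ c : ι → ℝ, (∀ i, 0 ≤ c i) → ∀ r : ℝ, 0 < r →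
      MeasurableSet (gradientCell cls a b t c r S) ∧
      volume (gradientCell cls a b t c r S) =
        ENNReal.ofReal ((∏ d : Σ i, OffBase cls S F.base i, c d.1) * r ^ F.k) *
          (C * volume (simplexProduct (OffBase cls S F.base)) * volume (F.gradientSlice t)) := by
  classical
  obtain ⟨T, hT, C, hC1, hC, hvol⟩ := exists_frame_equiv F.card_add
    (edgeVector_integral hint S F.base) F.orthonormal F.inner_edgeVector F.linearIndependent
  refine ⟨C, hC1, hC, fun c hc r hr => ?_⟩
  set Δ := simplexProduct (OffBase cls S F.base) with hΔ
  let L : ((Σ i, OffBase cls S F.base i) → ℝ) →ₗ[ℝ] ((Σ i, OffBase cls S F.base i) → ℝ) :=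
    Matrix.toLin' (Matrix.diagonal fun d => c d.1)
  have hL : ∀ δ d, L δ d = c d.1 * δ d := fun δ d => by
    simp [L, Matrix.toLin'_apply, Matrix.mulVec_diagonal]
  have hLc : Continuous L := L.continuous_of_finiteDimensional
  have hLΔ : MeasurableSet (L '' Δ) :=
    ((isCompact_simplexProduct _).image hLc).measurableSet
  let h : EuclideanSpace ℝ (Fin F.k) → ((Σ i, OffBase cls S F.base i) → ℝ) :=
    fun w d => r * (√(1 - ‖r⁻¹ • w‖ ^ 2) / F.scale t) * F.coeff d
  have hh : Measurable h := by
    refine measurable_pi_lambda _ fun d => ?_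
    simp only [h]
    fun_prop
  set X : Set (((Σ i, OffBase cls S F.base i) → ℝ) × EuclideanSpace ℝ (Fin F.k)) :=
    {x | x.2 ∈ r • F.gradientSlice t ∧ x.1 - h x.2 ∈ L '' Δ} with hX
  have hrY : MeasurableSet (r • F.gradientSlice t) :=
    (F.measurableSet_gradientSlice t).const_smul₀ r
  have hXm : MeasurableSet X :=
    (measurable_snd hrY).inter ((measurable_fst.sub (hh.comp measurable_snd)) hLΔ)
  have himg : gradientCell cls a b t c r S = (fun y => F.vertex c + y) '' (T '' X) := by
    ext y
    rw [F.mem_gradientCell_iff hint ht, Set.image_image]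
    constructor
    · rintro ⟨w, hw, δ, hδ, rfl⟩
      refine ⟨(fun d => c d.1 * δ d + r * (√(1 - ‖w‖ ^ 2) / F.scale t) * F.coeff d, r • w),
        ⟨Set.smul_mem_smul_set hw, δ, hδ, ?_⟩, by simp only [hT]⟩
      funext d
      simp only [h, hL, Pi.sub_apply, inv_smul_smul₀ hr.ne']
      ring
    · rintro ⟨⟨x, w'⟩, ⟨hw', δ, hδ, hx⟩, rfl⟩
      obtain ⟨w, hw, rfl⟩ := Set.mem_smul_set.1 hw'
      refine ⟨w, hw, δ, hδ, ?_⟩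
      simp only [hT]
      congr 2
      refine Finset.sum_congr rfl fun d _ => ?_
      have := congrFun hx d
      simp only [h, hL, Pi.sub_apply, inv_smul_smul₀ hr.ne'] at this
      rw [this]
      congr 1
      ring
  have hvX : volume X = volume (L '' Δ) * volume (r • F.gradientSlice t) := by
    rw [Measure.volume_eq_prod, Measure.prod_apply_symm hXm]
    have : ∀ w, volume ((fun x => (x, w)) ⁻¹' X) =
        (r • F.gradientSlice t).indicator (fun _ => volume (L '' Δ)) w := by
      intro w
      by_cases hw : w ∈ r • F.gradientSlice t
      · rw [Set.indicator_of_mem hw]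
        have : (fun x => (x, w)) ⁻¹' X = (fun x => x - h w) ⁻¹' (L '' Δ) := by
          ext x; simp [hX, hw]
        simp only [this, sub_eq_add_neg, measure_preimage_add_right]
      · rw [Set.indicator_of_notMem hw]
        have : (fun x => (x, w)) ⁻¹' X = ∅ := by
          ext x; simp [hX, hw]
        rw [this, measure_empty]
    simp only [this]
    rw [lintegral_indicator_const hrY]
  have hmeas : MeasurableSet (gradientCell cls a b t c r S) := by
    rw [himg, Set.image_add_left]
    exact (measurable_const_add _) (T.toHomeomorph.toMeasurableEquiv.measurableSet_image.2 hXm)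
  refine ⟨hmeas, ?_⟩
  have hdet : LinearMap.det L = ∏ d : Σ i, OffBase cls S F.base i, c d.1 := by
    rw [LinearMap.det_toLin', Matrix.det_diagonal]
  have hprod : 0 ≤ ∏ d : Σ i, OffBase cls S F.base i, c d.1 :=
    Finset.prod_nonneg fun d _ => hc d.1
  rw [himg, Set.image_add_left, measure_preimage_add, hvol, hvX, Measure.addHaar_image_linearMap,
    Measure.addHaar_smul, hdet, finrank_euclideanSpace_fin, abs_of_nonneg hprod,
    abs_of_nonneg (pow_nonneg hr.le _), ENNReal.ofReal_mul hprod]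
  ring

end CellFrame

end CellVolume

/-! ### Polarization of monomials -/

section Polarization

variable {L κ : Type*} [Fintype L] [Fintype κ] [DecidableEq L] [DecidableEq κ]

theorem sum_neg_one_pow_of_subset (I : Finset κ) :
    ∑ J : Finset κ with I ⊆ J, (-1 : ℝ) ^ (Fintype.card κ + J.card) =
      if I = Finset.univ then 1 else 0 := by
  have h : ∑ J : Finset κ with I ⊆ J, (-1 : ℝ) ^ (Fintype.card κ + J.card) =
      ∑ J ∈ Iᶜ.powerset, (-1 : ℝ) ^ J.card := by
    refine Finset.sum_bij' (fun J _ => Jᶜ) (fun J _ => Jᶜ) ?_ ?_ ?_ ?_ ?_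
    · intro J hJ
      simpa using hJ
    · intro J hJ
      rw [Finset.mem_powerset] at hJ
      rw [Finset.mem_filter, ← compl_compl I]
      exact ⟨Finset.mem_univ _, Finset.compl_subset_compl.2 hJ⟩
    · simp
    · simp
    · intro J _
      rw [← Finset.card_add_card_compl J, show J.card + Jᶜ.card + J.card = 2 * J.card + Jᶜ.card by
        ring, pow_add, pow_mul]
      norm_num
  rw [h]
  have h2 := Finset.sum_powerset_neg_one_pow_card (x := Iᶜ)
  have h3 : ((∑ J ∈ Iᶜ.powerset, (-1 : ℤ) ^ J.card : ℤ) : ℝ) =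
      ((if Iᶜ = ∅ then 1 else 0 : ℤ) : ℝ) := by rw [h2]
  push_cast at h3
  rw [h3]
  simp [Finset.compl_eq_empty_iff]

/-- Ryser's formula: the polarization of a product of linear forms is a permanent. -/
theorem sum_neg_one_pow_prod_sum (B : L → κ → ℝ) :
    ∑ J : Finset κ, (-1 : ℝ) ^ (Fintype.card κ + J.card) * ∏ l, ∑ j ∈ J, B l j =
      ∑ f : L → κ with Function.Surjective f, ∏ l, B l (f l) := by
  have h1 : ∀ J : Finset κ, ∏ l, ∑ j ∈ J, B l j =
      ∑ f : L → κ, if Finset.univ.image f ⊆ J then ∏ l, B l (f l) else 0 := by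
    intro J
    rw [Finset.prod_univ_sum, ← Finset.sum_filter]
    refine Finset.sum_congr ?_ fun _ _ => rfl
    ext f
    simp [Fintype.mem_piFinset, Finset.image_subset_iff]
  simp only [h1, Finset.mul_sum]
  rw [Finset.sum_comm, Finset.sum_filter]
  refine Finset.sum_congr rfl fun f _ => ?_
  have h2 := sum_neg_one_pow_of_subset (Finset.univ.image f)
  rw [Finset.sum_filter] at h2
  have h3 : Finset.univ.image f = Finset.univ ↔ Function.Surjective f :=
    ⟨fun h j => by simpa using (Finset.ext_iff.1 h j).2 (Finset.mem_univ j), Finset.image_univ_of_surjective⟩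
  simp only [mul_ite, mul_zero]
  calc ∑ J : Finset κ, (if Finset.univ.image f ⊆ J then
        (-1 : ℝ) ^ (Fintype.card κ + J.card) * ∏ l, B l (f l) else 0)
      = (∑ J : Finset κ, if Finset.univ.image f ⊆ J then
          (-1 : ℝ) ^ (Fintype.card κ + J.card) else 0) * ∏ l, B l (f l) := by
        rw [Finset.sum_mul]
        exact Finset.sum_congr rfl fun J _ => by split_ifs <;> simp
    _ = _ := by
        rw [h2]
        simp only [h3, ite_mul, one_mul, zero_mul]

/-- If the rows and the columns of a nonnegative matrix are divided into classes of the same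
cardinalities, and the entries within a class are one, the permanent is at least the number of the
bijections which respect the classes. -/
theorem prod_factorial_le_sum_surjective {O : Type*} [Fintype O] [DecidableEq O] {B : L → κ → ℝ}
    (hB : ∀ l j, 0 ≤ B l j) (γ : L → O) (γ' : κ → O) (hγ : ∀ l j, γ l = γ' j → B l j = 1)
    (hcard : ∀ o, Fintype.card {l // γ l = o} = Fintype.card {j // γ' j = o}) :
    ((∏ o, (Fintype.card {l // γ l = o})! : ℕ) : ℝ) ≤
      ∑ f : L → κ with Function.Surjective f, ∏ l, B l (f l) := by
  classical
  let Φ : (∀ o, {l // γ l = o} ≃ {j // γ' j = o}) → (L ≃ κ) := fun F =>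
    (Equiv.sigmaFiberEquiv γ).symm.trans
      ((Equiv.sigmaCongrRight F).trans (Equiv.sigmaFiberEquiv γ'))
  have hΦ : ∀ F l, Φ F l = (F (γ l) ⟨l, rfl⟩ : κ) := fun F l => rfl
  have hinj : Function.Injective fun F => (Φ F : L → κ) := by
    intro F G hFG
    funext o
    ext ⟨l, rfl⟩
    have := congrFun hFG l
    simpa only [hΦ] using this
  have hcardF : Fintype.card (∀ o, {l // γ l = o} ≃ {j // γ' j = o}) =
      ∏ o, (Fintype.card {l // γ l = o})! := by
    rw [Fintype.card_pi]
    exact Finset.prod_congr rfl fun o _ => Fintype.card_equiv (Fintype.equivOfCardEq (hcard o))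
  have hone : ∀ F, ∏ l, B l (Φ F l) = 1 := fun F =>
    Finset.prod_eq_one fun l _ => hγ _ _ (F (γ l) ⟨l, rfl⟩).2.symm
  calc ((∏ o, (Fintype.card {l // γ l = o})! : ℕ) : ℝ)
      = ∑ F : ∀ o, {l // γ l = o} ≃ {j // γ' j = o}, ∏ l, B l (Φ F l) := by
        simp [hone, ← hcardF]
    _ = ∑ f ∈ Finset.univ.image fun F => (Φ F : L → κ), ∏ l, B l (f l) := by
        rw [Finset.sum_image fun F _ G _ h => hinj h]
    _ ≤ _ := by
        refine Finset.sum_le_sum_of_subset_of_nonneg ?_ fun f _ _ =>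
          Finset.prod_nonneg fun l _ => hB _ _
        intro f hf
        obtain ⟨F, -, rfl⟩ := Finset.mem_image.1 hf
        simpa using (Φ F).surjective

end Polarization

/-! ### The volume of a Minkowski sum as a polynomial -/

section VolumePolynomial

variable {n : ℕ} {ι P : Type*} [Fintype ι] [Fintype P]
variable {cls : P → ι} {a : P → EuclideanSpace ℝ (Fin n)} {b : P → ℝ}

omit [Fintype P] in
theorem mixedCell_add {c c' : ι → ℝ} (hc : ∀ i, 0 ≤ c i) (hc' : ∀ i, 0 ≤ c' i) (S : Set P) :
    mixedCell cls a (c + c') S = mixedCell cls a c S + mixedCell cls a c' S := by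
  simp only [mixedCell, ← Finset.sum_add_distrib]
  exact Finset.sum_congr rfl fun i _ => (convex_convexHull ℝ _).add_smul (hc i) (hc' i)

omit [Fintype P] in
theorem mixedCell_zero (hcls : Function.Surjective cls) :
    mixedCell cls a 0 Set.univ = 0 := by
  refine Finset.sum_eq_zero fun i _ => ?_
  obtain ⟨p, hp⟩ := hcls i
  exact Set.zero_smul_set ⟨a p, subset_convexHull ℝ _ ⟨p, ⟨trivial, hp⟩, rfl⟩⟩

/-- The convex body `∑ c_i conv {a p : cls p = i} + r B`. -/
def mixedBody (cls : P → ι) (a : P → EuclideanSpace ℝ (Fin n)) (c : ι → ℝ) (r : ℝ) :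
    Set (EuclideanSpace ℝ (Fin n)) :=
  mixedCell cls a c Set.univ + r • Metric.closedBall 0 1

omit [Fintype P] in
theorem sum_mixedBody (hcls : Function.Surjective cls) {κ : Type*} {c : κ → ι → ℝ}
    (hc : ∀ j i, 0 ≤ c j i) {ρ : κ → ℝ} (hρ : ∀ j, 0 ≤ ρ j) (J : Finset κ) :
    ∑ j ∈ J, mixedBody cls a (c j) (ρ j) =
      mixedBody cls a (fun i => ∑ j ∈ J, c j i) (∑ j ∈ J, ρ j) := by
  classical
  induction J using Finset.induction_on with
  | empty =>
    have : (fun i : ι => ∑ j ∈ (∅ : Finset κ), c j i) = 0 := by funext i; simp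
    rw [mixedBody, this, mixedCell_zero hcls, Finset.sum_empty, Finset.sum_empty,
      Set.zero_smul_set ⟨0, by simp⟩, zero_add]
  | insert j J hj ih =>
    have : (fun i : ι => ∑ j' ∈ insert j J, c j' i) = c j + fun i => ∑ j ∈ J, c j i := by
      funext i; simp [Finset.sum_insert hj]
    rw [mixedBody, this, Finset.sum_insert hj, ih, mixedBody, mixedBody, Finset.sum_insert hj,
      mixedCell_add (hc j) (fun i => Finset.sum_nonneg fun j _ => hc j i),
      (convex_closedBall (0 : EuclideanSpace ℝ (Fin n)) 1).add_smul (hρ j)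
        (Finset.sum_nonneg fun j _ => hρ j)]
    abel

/-- The sets which occur as the set of the active indices at a point. -/
abbrev Cell (cls : P → ι) (a : P → EuclideanSpace ℝ (Fin n)) (b : P → ℝ) : Type _ :=
  {S : Finset P // S ∈ Set.range (activeSet cls a b)}

noncomputable instance (cls : P → ι) (a : P → EuclideanSpace ℝ (Fin n)) (b : P → ℝ) :
    Fintype (Cell cls a b) := Fintype.ofFinite _

/-- The volume of `mixedBody cls a c r` is a polynomial in `c` and `r` with one monomial for each
cell. The case `r = 0` is the limit of the case `r > 0`, where the gradient cells are available. -/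
theorem exists_volume_mixedBody_eq
    (hint : ∀ p, ∃ w : Fin n → ℤ, a p = WithLp.toLp 2 (fun j => (w j : ℝ)))
    (hcls : Function.Surjective cls)
    (F : ∀ S : Cell cls a b, CellFrame cls a b S.1) {t : ℝ} (ht : 0 < t) :
    ∃ W : Cell cls a b → ℝ,
      (∀ S, 0 ≤ W S) ∧
      (∀ S, volume.real ((F S).gradientSlice t) ≤
        (∏ i, (Fintype.card (OffBase cls S.1 (F S).base i))! : ℕ) * W S) ∧
      ∀ c : ι → ℝ, (∀ i, 0 ≤ c i) → ∀ r : ℝ, 0 ≤ r →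
        volume.real (mixedBody cls a c r) =
          ∑ S : Cell cls a b,
            ((∏ d : Σ i, OffBase cls S.1 (F S).base i, c d.1) * r ^ (F S).k) * W S := by
  classical
  choose C hC1 hC hvol using fun S => (F S).exists_volume_gradientCell hint ht
  have hslice : ∀ S, volume ((F S).gradientSlice t) ≠ ⊤ := fun S =>
    ((measure_mono (fun w hw => by simpa using hw.1)).trans_lt
      (measure_ball_lt_top (x := (0 : EuclideanSpace ℝ (Fin (F S).k))) (r := 1))).ne
  have hsimp : ∀ S, volume (simplexProduct (OffBase cls S.1 (F S).base)) ≠ ⊤ := fun S =>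
    (isCompact_simplexProduct _).measure_lt_top.ne
  refine ⟨fun S => (C S * volume (simplexProduct (OffBase cls S.1 (F S).base)) *
    volume ((F S).gradientSlice t)).toReal, fun S => ENNReal.toReal_nonneg, fun S => ?_, ?_⟩
  · have h1 : ENNReal.ofReal (1 / ∏ i, ((Fintype.card (OffBase cls S.1 (F S).base i))! : ℝ)) ≤
        C S * volume (simplexProduct (OffBase cls S.1 (F S).base)) :=
      (le_volume_simplexProduct _).trans (le_mul_of_one_le_left (zero_le) (hC1 S))
    have hpos : (0 : ℝ) < ∏ i, ((Fintype.card (OffBase cls S.1 (F S).base i))! : ℝ) :=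
      Finset.prod_pos fun i _ => by positivity
    have h2 := ENNReal.toReal_mono (ENNReal.mul_ne_top (hC S) (hsimp S)) h1
    rw [ENNReal.toReal_ofReal (by positivity)] at h2
    dsimp only
    rw [ENNReal.toReal_mul, measureReal_def, ← mul_assoc]
    push_cast
    refine le_mul_of_one_le_left ENNReal.toReal_nonneg ?_
    calc (1 : ℝ) = (∏ i, ((Fintype.card (OffBase cls S.1 (F S).base i))! : ℝ)) *
          (1 / ∏ i, ((Fintype.card (OffBase cls S.1 (F S).base i))! : ℝ)) := by field_simp
      _ ≤ _ := mul_le_mul_of_nonneg_left h2 hpos.le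
  · intro c hc r hr
    have hpos : ∀ r : ℝ, 0 < r → volume.real (mixedBody cls a c r) =
        ∑ S : Cell cls a b,
          ((∏ d : Σ i, OffBase cls S.1 (F S).base i, c d.1) * r ^ (F S).k) *
          (C S * volume (simplexProduct (OffBase cls S.1 (F S).base)) *
            volume ((F S).gradientSlice t)).toReal := by
      intro r hr
      have hempty : ∀ S ∉ Set.range (activeSet cls a b),
          gradientCell cls a b t c r S = ∅ := by
        intro S hS
        refine Set.eq_empty_of_forall_notMem ?_
        rintro y ⟨x, hx, -⟩
        exact hS ⟨x, hx⟩
      have hmeas : ∀ S, MeasurableSet (gradientCell cls a b t c r S) := by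
        intro S
        by_cases hS : S ∈ Set.range (activeSet cls a b)
        · exact (hvol ⟨S, hS⟩ c hc r hr).1
        · rw [hempty S hS]; exact MeasurableSet.empty
      have h1 := measure_mixedCell_add_eq_sum volume hcls a b ht hc hr hmeas
      have h2 : ∑ S : Finset P, volume (gradientCell cls a b t c r S) =
          ∑ S : Cell cls a b, volume (gradientCell cls a b t c r S.1) := by
        rw [← Finset.sum_subtype (Finset.univ.filter fun S => S ∈ Set.range (activeSet cls a b))
          (by simp) (fun S => volume (gradientCell cls a b t c r S)), Finset.sum_filter]
        refine Finset.sum_congr rfl fun S _ => ?_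
        split_ifs with hS
        · rfl
        · rw [hempty S hS, measure_empty]
      rw [measureReal_def, mixedBody, h1, h2, ENNReal.toReal_sum]
      · refine Finset.sum_congr rfl fun S _ => ?_
        rw [(hvol S c hc r hr).2, ENNReal.toReal_mul, ENNReal.toReal_ofReal
          (mul_nonneg (Finset.prod_nonneg fun d _ => hc d.1) (by positivity))]
      · intro S _
        rw [(hvol S c hc r hr).2]
        exact ENNReal.mul_ne_top ENNReal.ofReal_ne_top
          (ENNReal.mul_ne_top (ENNReal.mul_ne_top (hC S) (hsimp S)) (hslice S))
    rcases hr.eq_or_lt with rfl | hr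
    swap
    · exact hpos r hr
    -- both sides are continuous as the radius of the ball tends to zero
    have hK := isCompact_mixedCell cls a c Set.univ
    have hbody : ∀ r : ℝ, 0 ≤ r → mixedBody cls a c r =
        Metric.cthickening r (mixedCell cls a c Set.univ) := by
      intro r hr
      rw [mixedBody, ← hK.add_closedBall_zero hr, smul_unitClosedBall, Real.norm_of_nonneg hr]
    have hl : Tendsto (fun r : ℝ => volume.real (mixedBody cls a c r))
        (nhdsWithin 0 (Set.Ioi 0)) (nhds (volume.real (mixedBody cls a c 0))) := by
      have h1 := (ENNReal.tendsto_toReal hK.measure_lt_top.ne).comp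
        (tendsto_measure_cthickening_of_isCompact (μ := volume) hK)
      rw [hbody 0 le_rfl, Metric.cthickening_zero, hK.isClosed.closure_eq]
      refine (h1.mono_left nhdsWithin_le_nhds).congr' ?_
      filter_upwards [self_mem_nhdsWithin] with r hr
      rw [hbody r (le_of_lt hr)]
      rfl
    have hrr := fun (c : ι → ℝ) => Continuous.tendsto (f := fun r : ℝ =>
        ∑ S : Cell cls a b,
          ((∏ d : Σ i, OffBase cls S.1 (F S).base i, c d.1) * r ^ (F S).k) *
          (C S * volume (simplexProduct (OffBase cls S.1 (F S).base)) *
            volume ((F S).gradientSlice t)).toReal) (by fun_prop) 0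
    refine tendsto_nhds_unique hl (((hrr c).mono_left nhdsWithin_le_nhds).congr' ?_)
    filter_upwards [self_mem_nhdsWithin] with r hr
    exact (hpos r hr).symm

/-- A lower bound for the polarized volume, in terms of the slices of the gradient images of the
cells whose type matches the family of bodies. -/
theorem sum_factorial_mul_slice_le
    (hint : ∀ p, ∃ w : Fin n → ℤ, a p = WithLp.toLp 2 (fun j => (w j : ℝ)))
    (hcls : Function.Surjective cls)
    (F : ∀ S : Cell cls a b, CellFrame cls a b S.1)
    {κ : Type*} [Fintype κ] (hκ : Fintype.card κ = n) {c : κ → ι → ℝ}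
    (hc : ∀ j i, 0 ≤ c j i) {ρ : κ → ℝ} (hρ : ∀ j, 0 ≤ ρ j)
    (𝒮 : Finset (Cell cls a b))
    (γ : Cell cls a b → κ → Option ι)
    (hγc : ∀ S ∈ 𝒮, ∀ j i, γ S j = some i → c j i = 1)
    (hγρ : ∀ S ∈ 𝒮, ∀ j, γ S j = none → ρ j = 1)
    (hcard : ∀ S ∈ 𝒮, ∀ i, Nat.card {j // γ S j = some i} =
      Fintype.card (OffBase cls S.1 (F S).base i))
    (hcard' : ∀ S ∈ 𝒮, Nat.card {j // γ S j = none} = (F S).k)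
    {t : ℝ} (ht : 0 < t) :
    ∑ S ∈ 𝒮, ((F S).k ! : ℝ) * volume.real ((F S).gradientSlice t) ≤
      ∑ J : Finset κ, (-1 : ℝ) ^ (n + J.card) *
        volume.real (∑ j ∈ J, mixedBody cls a (c j) (ρ j)) := by
  classical
  obtain ⟨W, hW0, hW, hpoly⟩ := exists_volume_mixedBody_eq hint hcls F ht
  let B : ∀ S : Cell cls a b,
      ((Σ i, OffBase cls S.1 (F S).base i) ⊕ Fin (F S).k) → κ → ℝ :=
    fun S => Sum.elim (fun d j => c j d.1) (fun _ j => ρ j)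
  have hB : ∀ S l j, 0 ≤ B S l j := by
    rintro S (d | l) j
    · exact hc j d.1
    · exact hρ j
  have hvol : ∀ J : Finset κ, volume.real (∑ j ∈ J, mixedBody cls a (c j) (ρ j)) =
      ∑ S : Cell cls a b, (∏ l, ∑ j ∈ J, B S l j) * W S := by
    intro J
    rw [sum_mixedBody hcls hc hρ, hpoly _ (fun i => Finset.sum_nonneg fun j _ => hc j i) _
      (Finset.sum_nonneg fun j _ => hρ j)]
    refine Finset.sum_congr rfl fun S _ => ?_
    rw [Fintype.prod_sum_type]
    simp [B]
  have hswap : ∑ J : Finset κ, (-1 : ℝ) ^ (n + J.card) *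
      volume.real (∑ j ∈ J, mixedBody cls a (c j) (ρ j)) =
      ∑ S : Cell cls a b,
        (∑ f : _ → κ with Function.Surjective f, ∏ l, B S l (f l)) * W S := by
    simp only [hvol, ← sum_neg_one_pow_prod_sum, hκ, Finset.mul_sum, Finset.sum_mul]
    rw [Finset.sum_comm]
    refine Finset.sum_congr rfl fun S _ => Finset.sum_congr rfl fun J _ => by ring
  rw [hswap]
  refine le_trans ?_ (Finset.sum_le_sum_of_subset_of_nonneg (Finset.subset_univ 𝒮) fun S _ _ =>
    mul_nonneg (Finset.sum_nonneg fun f _ => Finset.prod_nonneg fun l _ => hB S _ _) (hW0 S))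
  refine Finset.sum_le_sum fun S hS => ?_
  let γL : ((Σ i, OffBase cls S.1 (F S).base i) ⊕ Fin (F S).k) → Option ι :=
    Sum.elim (fun d => some d.1) (fun _ => none)
  have hsome : ∀ i, Fintype.card {l // γL l = some i} =
      Fintype.card (OffBase cls S.1 (F S).base i) := by
    intro i
    refine Fintype.card_congr (Equiv.ofBijective
      (fun p : OffBase cls S.1 (F S).base i => (⟨Sum.inl ⟨i, p⟩, rfl⟩ : {l // γL l = some i}))
      ⟨?_, ?_⟩).symm
    · intro p q hpq
      have h1 := Sum.inl_injective (congrArg Subtype.val hpq)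
      exact eq_of_heq (Sigma.mk.inj h1).2
    · rintro ⟨⟨i', p⟩ | l, hl⟩
      · obtain rfl : i' = i := by simpa [γL] using hl
        exact ⟨p, rfl⟩
      · simp [γL] at hl
  have hnone : Fintype.card {l // γL l = none} = (F S).k := by
    refine Eq.trans (Fintype.card_congr (Equiv.ofBijective
      (fun p : Fin (F S).k => (⟨Sum.inr p, rfl⟩ : {l // γL l = none})) ⟨?_, ?_⟩).symm)
      (Fintype.card_fin _)
    · intro p q hpq
      exact Sum.inr_injective (congrArg Subtype.val hpq)
    · rintro ⟨d | l, hl⟩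
      · simp [γL] at hl
      · exact ⟨l, rfl⟩
  have hperm := prod_factorial_le_sum_surjective (hB S) γL (γ S) (fun l j h => by
      rcases l with d | l
      · exact hγc S hS j d.1 h.symm
      · exact hγρ S hS j h.symm) (fun o => by
      rw [← Nat.card_eq_fintype_card (α := {j // γ S j = o})]
      cases o with
      | none => rw [hcard' S hS, hnone]
      | some i => rw [hcard S hS, hsome])
  rw [Fintype.prod_option, hnone] at hperm
  simp only [hsome] at hperm
  calc ((F S).k ! : ℝ) * volume.real ((F S).gradientSlice t)
      ≤ (F S).k ! * ((∏ i, (Fintype.card (OffBase cls S.1 (F S).base i))! : ℕ) * W S) :=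
        mul_le_mul_of_nonneg_left (hW S) (by positivity)
    _ = (((F S).k ! * ∏ i, (Fintype.card (OffBase cls S.1 (F S).base i))! : ℕ) : ℝ) * W S := by
        push_cast; ring
    _ ≤ _ := mul_le_mul_of_nonneg_right hperm (hW0 S)

end VolumePolynomial

/-! ### Recession cones of the cells -/

section Recession

variable {n : ℕ} {ι P : Type*} [Fintype ι] [Fintype P]
variable {cls : P → ι} {a : P → EuclideanSpace ℝ (Fin n)} {b : P → ℝ}

namespace CellFrame

variable {S : Finset P} (F : CellFrame cls a b S)

/-- The normal vector, within the affine hull of the cell, of the inequality given by `p ∉ S`. -/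
noncomputable def normal (p : P) : EuclideanSpace ℝ (Fin F.k) :=
  WithLp.toLp 2 fun j => inner ℝ (a p - a (F.base (cls p))) (F.u j)

theorem inner_sub_base_incl (p : P) (z : EuclideanSpace ℝ (Fin F.k)) :
    inner ℝ (a p - a (F.base (cls p))) (F.incl z) = inner ℝ (F.normal p) z := by
  rw [incl, inner_sum, PiLp.inner_apply]
  refine Finset.sum_congr rfl fun j _ => ?_
  rw [real_inner_smul_right]
  rfl

/-- The slack at `origin` of the inequality given by `p`. -/
noncomputable def slack (p : P) : ℝ :=
  b p - b (F.base (cls p)) - inner ℝ (a p - a (F.base (cls p))) F.origin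

theorem activeSet_eq_iff_lt_slack (z : EuclideanSpace ℝ (Fin F.k)) :
    activeSet cls a b (F.origin + F.incl z) = S ↔
      ∀ p ∉ S, inner ℝ (F.normal p) z < F.slack p := by
  rw [F.activeSet_eq_iff]
  refine forall₂_congr fun p _ => ?_
  rw [inner_add_right, F.inner_sub_base_incl, slack]
  constructor <;> intro h <;> linarith

theorem slack_pos_of_normal_eq_zero {p : P} (hp : p ∉ S) (h : F.normal p = 0) : 0 < F.slack p := by
  have := (F.activeSet_eq_iff_lt_slack F.point).1 F.activeSet_origin_add_incl_point p hp
  rwa [h, inner_zero_left] at this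

/-- The interior of the recession cone of the cell, relative to the affine hull of the cell.
Inequalities which are constant on the affine hull impose no condition. -/
def openRecessionCone : Set (EuclideanSpace ℝ (Fin F.k)) :=
  {z | ∀ p ∉ S, F.normal p ≠ 0 → inner ℝ (F.normal p) z < 0}

theorem measurableSet_openRecessionCone : MeasurableSet F.openRecessionCone := by
  simp only [openRecessionCone, Set.ofPred_forall]
  refine MeasurableSet.iInter fun p => MeasurableSet.iInter fun _ => MeasurableSet.iInter fun _ => ?_
  exact measurableSet_lt (measurable_const.inner measurable_id) measurable_const

theorem smul_mem_openRecessionCone_iff {r : ℝ} (hr : 0 < r) (z : EuclideanSpace ℝ (Fin F.k)) :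
    r • z ∈ F.openRecessionCone ↔ z ∈ F.openRecessionCone := by
  refine forall₃_congr fun p _ _ => ?_
  rw [real_inner_smul_right, mul_neg_iff]
  simp [hr, not_lt.2 hr.le]

theorem tendsto_scale : Tendsto F.scale atTop atTop := by
  refine tendsto_atTop_mono (fun t => ?_) tendsto_id
  exact (le_abs_self t).trans (Real.abs_le_sqrt (by nlinarith [sq_nonneg ‖F.origin‖]))

theorem eventually_mem_gradientSlice {z : EuclideanSpace ℝ (Fin F.k)} (hz : ‖z‖ < 1)
    (hrec : z ∈ F.openRecessionCone) : ∀ᶠ t in atTop, z ∈ F.gradientSlice t := by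
  have h : ∀ p, ∀ᶠ t in atTop, p ∉ S →
      inner ℝ (F.normal p) (ballGradientInv (F.scale t) z) < F.slack p := by
    intro p
    by_cases hp : p ∈ S
    · exact Eventually.of_forall fun t h => absurd hp h
    by_cases h0 : F.normal p = 0
    · exact Eventually.of_forall fun t _ => by
        rw [h0, inner_zero_left]; exact F.slack_pos_of_normal_eq_zero hp h0
    have hneg := hrec p hp h0
    have hc : 0 < √(1 - ‖z‖ ^ 2) := Real.sqrt_pos.2 (one_sub_norm_sq_pos hz)
    have ht : Tendsto (fun t => F.scale t / √(1 - ‖z‖ ^ 2) * inner ℝ (F.normal p) z) atTop atBot :=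
      (F.tendsto_scale.atTop_div_const hc).atTop_mul_const_of_neg hneg
    filter_upwards [ht.eventually_lt_atBot (F.slack p)] with t ht _
    rw [ballGradientInv, real_inner_smul_right]
    exact ht
  filter_upwards [eventually_all.2 h] with t ht
  exact ⟨hz, (F.activeSet_eq_iff_lt_slack _).2 ht⟩

end CellFrame

/-- As the smoothing parameter tends to infinity, the slices fill the recession cones. -/
theorem sum_mul_volume_openRecessionCone_le
    (F : ∀ S : Cell cls a b, CellFrame cls a b S.1) (𝒮 : Finset (Cell cls a b))
    {q : Cell cls a b → ℝ} (hq : ∀ S, 0 ≤ q S) {V : ℝ}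
    (hV : ∀ t : ℝ, 0 < t → ∑ S ∈ 𝒮, q S * volume.real ((F S).gradientSlice t) ≤ V) :
    ∑ S ∈ 𝒮, q S * volume.real ((F S).openRecessionCone ∩ Metric.ball 0 1) ≤ V := by
  let E : ∀ S, ℕ → Set (EuclideanSpace ℝ (Fin (F S).k)) := fun S N =>
    {z | z ∈ (F S).openRecessionCone ∩ Metric.ball 0 1 ∧ ∀ j ≥ N, z ∈ (F S).gradientSlice j}
  have hmono : ∀ S, Monotone (E S) := fun S N N' h z hz => ⟨hz.1, fun j hj => hz.2 j (h.trans hj)⟩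
  have hunion : ∀ S, ⋃ N, E S N = (F S).openRecessionCone ∩ Metric.ball 0 1 := by
    intro S
    refine subset_antisymm (Set.iUnion_subset fun N z hz => hz.1) fun z hz => ?_
    have h1 := tendsto_natCast_atTop_atTop.eventually
      ((F S).eventually_mem_gradientSlice (by simpa using hz.2) hz.1)
    obtain ⟨N, hN⟩ := eventually_atTop.1 h1
    exact Set.mem_iUnion.2 ⟨N, hz, hN⟩
  have hfin : ∀ (S) (X : Set (EuclideanSpace ℝ (Fin (F S).k))), X ⊆ Metric.ball 0 1 →
      volume X ≠ ⊤ := fun S X hX => ((measure_mono hX).trans_lt measure_ball_lt_top).ne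
  have hlim : ∀ S, Tendsto (fun N => volume.real (E S N)) atTop
      (nhds (volume.real ((F S).openRecessionCone ∩ Metric.ball 0 1))) := by
    intro S
    have h1 := tendsto_measure_iUnion_atTop (μ := volume) (hmono S)
    rw [hunion S] at h1
    exact (ENNReal.tendsto_toReal (hfin S _ Set.inter_subset_right)).comp h1
  refine le_of_tendsto (tendsto_finsetSum 𝒮 fun S _ => (hlim S).const_mul (q S)) ?_
  filter_upwards [eventually_gt_atTop 0] with N hN
  refine le_trans ?_ (hV N (by exact_mod_cast hN))
  refine Finset.sum_le_sum fun S _ => mul_le_mul_of_nonneg_left ?_ (hq S)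
  exact measureReal_mono (fun z hz => hz.2 N le_rfl)
    (hfin S _ fun z hz => by simpa using hz.1)

end Recession

/-! ### Haar measure on the orthogonal group -/

section OrthogonalGroup

instance compactSpace_orthogonalGroup (n : ℕ) : CompactSpace (Matrix.orthogonalGroup (Fin n) ℝ) := by
  refine (isCompact_iff_compactSpace
    (s := (Matrix.orthogonalGroup (Fin n) ℝ : Set (Matrix (Fin n) (Fin n) ℝ)))).1 ?_
  have hbox : IsCompact (Set.univ.pi fun _ : Fin n => Set.univ.pi fun _ : Fin n =>
      Set.Icc (-1 : ℝ) 1) :=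
    isCompact_univ_pi fun _ => isCompact_univ_pi fun _ => isCompact_Icc
  refine IsCompact.of_isClosed_subset (X := Matrix (Fin n) (Fin n) ℝ) hbox isClosed_unitary ?_
  intro Q hQ i _ j _
  have h : ‖Q i j‖ ≤ 1 := entry_norm_bound_of_unitary hQ i j
  rwa [Real.norm_eq_abs, abs_le] at h

/-- A finite Haar measure on a compact group is right invariant. -/
theorem measurePreserving_mul_right_of_compactSpace {G : Type*} [Group G] [TopologicalSpace G]
    [IsTopologicalGroup G] [CompactSpace G] [MeasurableSpace G] [BorelSpace G] (μ : Measure G)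
    [μ.IsHaarMeasure] (g : G) : MeasurePreserving (· * g) μ μ := by
  have hm : Measurable (· * g : G → G) := (continuous_mul_const g).measurable
  refine ⟨hm, ?_⟩
  have hinv : (μ.map (· * g)).IsMulLeftInvariant := by
    refine ⟨fun h => ?_⟩
    have hm' : Measurable (h * · : G → G) := (continuous_const_mul h).measurable
    rw [Measure.map_map hm' hm]
    have : (h * ·) ∘ (· * g) = (· * g) ∘ (h * ·) := by
      funext x; simp [mul_assoc]
    rw [this, ← Measure.map_map hm hm', map_mul_left_eq_self]
  have hfin : IsFiniteMeasure (μ.map (· * g)) := by infer_instance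
  have h := Measure.isMulInvariant_eq_smul_of_compactSpace (μ.map (· * g)) μ
  have huniv := congrArg (fun m : Measure G => m Set.univ) h
  simp only [Measure.map_apply hm MeasurableSet.univ, Set.preimage_univ, Measure.smul_apply] at huniv
  have hne : μ Set.univ ≠ 0 := isOpen_univ.measure_ne_zero μ Set.univ_nonempty
  have hone : (((μ.map (· * g)).haarScalarFactor μ : NNReal) : ENNReal) = 1 := by
    refine (ENNReal.mul_left_inj hne (measure_ne_top μ _)).1 ?_
    rw [one_mul]
    exact huniv.symm
  rw [h, ENNReal.coe_eq_one.1 hone, one_smul]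

variable {n k : ℕ}

/-- Every orthonormal `k`-tuple of vectors forms the first columns of an orthogonal matrix. -/
theorem exists_orthogonalGroup_submatrix (hk : k ≤ n) {U : Matrix (Fin n) (Fin k) ℝ}
    (hU : U.transpose * U = 1) :
    ∃ O : Matrix.orthogonalGroup (Fin n) ℝ, O.1.submatrix id (Fin.castLE hk) = U := by
  let v : Fin n → EuclideanSpace ℝ (Fin n) := fun i =>
    if h : (i : ℕ) < k then WithLp.toLp 2 fun l => U l ⟨i, h⟩ else 0
  let s : Set (Fin n) := {i | (i : ℕ) < k}
  have hv : Orthonormal ℝ (s.domRestrict v) := by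
    rw [orthonormal_iff_ite]
    rintro ⟨i, hi⟩ ⟨j, hj⟩
    have hi' : (i : ℕ) < k := hi
    have hj' : (j : ℕ) < k := hj
    have h := congrFun (congrFun hU ⟨i, hi'⟩) ⟨j, hj'⟩
    rw [Matrix.mul_apply, Matrix.one_apply] at h
    simp only [Set.domRestrict_apply, v, hi', hj', dif_pos, PiLp.inner_apply, RCLike.inner_apply,
      conj_trivial]
    simp only [Matrix.transpose_apply, Fin.mk.injEq] at h
    simp only [Subtype.mk.injEq, Fin.ext_iff]
    rw [← h]
    exact Finset.sum_congr rfl fun l _ => mul_comm _ _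
  obtain ⟨B, hB⟩ := hv.exists_orthonormalBasis_extension_of_card_eq (by simp)
  refine ⟨⟨_, (EuclideanSpace.basisFun (Fin n) ℝ).toMatrix_orthonormalBasis_mem_unitary B⟩, ?_⟩
  ext i j
  have h1 := hB (Fin.castLE hk j) (show ((Fin.castLE hk j : Fin n) : ℕ) < k from j.2)
  simp [Module.Basis.toMatrix_apply, h1, v]

theorem ae_det_mul_ne_zero {A : Matrix (Fin k) (Fin n) ℝ} (hA : A * A.transpose = 1) :
    ∀ᵐ W : Fin n → Fin k → ℝ, (A * Matrix.of W).det ≠ 0 := by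
  have hcont : Continuous fun W : Fin n → Fin k → ℝ => (A * Matrix.of W).det := by
    refine Continuous.matrix_det (Continuous.matrix_mul continuous_const ?_)
    exact continuous_matrix fun i j => by simpa using (continuous_apply_apply i j)
  let L : ℝ →ₗ[ℝ] (Fin n → Fin k → ℝ) :=
    LinearMap.toSpanSingleton ℝ _ (fun i j => A.transpose i j)
  refine ae_mem_of_ae_add_linearMap_mem L (volume : Measure ℝ) volume
    (s := {W : Fin n → Fin k → ℝ | (A * Matrix.of W).det ≠ 0})
    (measurableSet_eq_fun hcont.measurable measurable_const).compl fun W => ?_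
  -- along each line in the direction of `Aᵀ` the determinant is a characteristic polynomial
  have hdet : ∀ s : ℝ, (A * Matrix.of (W + L s)).det =
      ((-(A * Matrix.of W)).charpoly).eval s := by
    intro s
    rw [Matrix.eval_charpoly]
    have : Matrix.of (W + L s) = Matrix.of W + s • A.transpose := by
      ext i j
      simp [L]
    rw [this, Matrix.mul_add, Matrix.mul_smul, hA, Matrix.scalar_apply, sub_neg_eq_add, add_comm,
      Matrix.smul_one_eq_diagonal]
  have hfin : {s : ℝ | ((-(A * Matrix.of W)).charpoly).eval s = 0}.Finite := by
    refine ((-(A * Matrix.of W)).charpoly.roots.toFinset.finite_toSet).subset fun s hs => ?_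
    simpa [Polynomial.mem_roots, (Matrix.charpoly_monic _).ne_zero] using hs
  have hnull : volume {s : ℝ | ((-(A * Matrix.of W)).charpoly).eval s = 0} = 0 :=
    hfin.measure_zero _
  filter_upwards [compl_mem_ae_iff.2 hnull] with s hs
  simpa [hdet] using hs

variable [MeasurableSpace (Matrix.orthogonalGroup (Fin n) ℝ)]
  [BorelSpace (Matrix.orthogonalGroup (Fin n) ℝ)]

theorem measurable_orthogonalGroup_apply (i j : Fin n) :
    Measurable fun Q : Matrix.orthogonalGroup (Fin n) ℝ => Q.1 i j :=
  (continuous_subtype_val.matrix_elem i j).measurable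

/-- The selected rows of an orthogonal matrix, applied to the columns of `U`. -/
def rowMinor (row : Fin k → Fin n) (U : Matrix (Fin n) (Fin k) ℝ)
    (Q : Matrix.orthogonalGroup (Fin n) ℝ) : Matrix (Fin k) (Fin k) ℝ :=
  (Q.1 * U).submatrix row id

omit [MeasurableSpace (Matrix.orthogonalGroup (Fin n) ℝ)]
  [BorelSpace (Matrix.orthogonalGroup (Fin n) ℝ)] in
theorem rowMinor_eq (row : Fin k → Fin n) (U : Matrix (Fin n) (Fin k) ℝ)
    (Q : Matrix.orthogonalGroup (Fin n) ℝ) :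
    rowMinor row U Q = Q.1.submatrix row id * U := by
  ext i j
  simp [rowMinor, Matrix.mul_apply]

omit [MeasurableSpace (Matrix.orthogonalGroup (Fin n) ℝ)]
  [BorelSpace (Matrix.orthogonalGroup (Fin n) ℝ)] in
theorem rowMinor_mul (row : Fin k → Fin n) (U : Matrix (Fin n) (Fin k) ℝ)
    (Q h : Matrix.orthogonalGroup (Fin n) ℝ) :
    rowMinor row U (Q * h) = rowMinor row (h.1 * U) Q := by
  rw [rowMinor, rowMinor, Submonoid.coe_mul, Matrix.mul_assoc]

/-- Almost every orthogonal matrix is transversal to a given subspace: the linear system given by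
some of its rows is nonsingular on the subspace of the complementary dimension. -/
theorem ae_det_rowMinor_ne_zero (μ : Measure (Matrix.orthogonalGroup (Fin n) ℝ))
    [μ.IsHaarMeasure] [IsProbabilityMeasure μ] {row : Fin k → Fin n}
    (hrow : Function.Injective row) {U : Matrix (Fin n) (Fin k) ℝ} (hU : U.transpose * U = 1) :
    ∀ᵐ Q ∂μ, (rowMinor row U Q).det ≠ 0 := by
  have hk : k ≤ n := by simpa using Fintype.card_le_of_injective row hrow
  have hrows : ∀ Q : Matrix.orthogonalGroup (Fin n) ℝ,
      Q.1.submatrix row id * (Q.1.submatrix row id).transpose = 1 := by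
    intro Q
    have h := (Matrix.mem_orthogonalGroup_iff (Fin n) ℝ).1 Q.2
    ext i j
    have h2 := congrFun (congrFun h (row i)) (row j)
    rw [Matrix.mul_apply, Matrix.one_apply] at h2
    rw [Matrix.mul_apply, Matrix.one_apply]
    simpa [hrow.eq_iff] using h2
  have hswap : ∀ᵐ W : Fin n → Fin k → ℝ, ∀ᵐ Q ∂μ, (rowMinor row (Matrix.of W) Q).det ≠ 0 := by
    refine (Measure.ae_ae_comm (μ := μ) (ν := volume) (p := fun Q W =>
      (rowMinor row (Matrix.of W) Q).det ≠ 0) ?_).1 (Eventually.of_forall fun Q => ?_)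
    · refine (measurableSet_eq_fun ?_ measurable_const).compl
      simp only [rowMinor, Matrix.det_apply, Matrix.submatrix_apply, Matrix.mul_apply, Matrix.of_apply]
      refine Finset.measurable_sum _ fun σ _ => Measurable.const_smul (Finset.measurable_prod _
        fun i _ => Finset.measurable_sum _ fun l _ => ?_) _
      exact ((measurable_orthogonalGroup_apply _ _).comp measurable_fst).mul
        ((measurable_pi_apply _).comp ((measurable_pi_apply _).comp measurable_snd))
    · simp only [rowMinor_eq]
      exact ae_det_mul_ne_zero (hrows Q)
  obtain ⟨W, hW⟩ := hswap.exists
  obtain ⟨Q₀, hQ₀⟩ := hW.exists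
  -- factor `W = U' S` with orthonormal columns `U'`
  let w : Fin k → EuclideanSpace ℝ (Fin n) := fun j => WithLp.toLp 2 fun l => W l j
  have hw : LinearIndependent ℝ w := by
    rw [Fintype.linearIndependent_iff]
    intro g hg
    have h1 : (Matrix.of W).mulVec g = 0 := by
      ext l
      have := congrArg (fun x : EuclideanSpace ℝ (Fin n) => x l) hg
      simpa [w, Matrix.mulVec, dotProduct, mul_comm] using this
    have h2 : (rowMinor row (Matrix.of W) Q₀).mulVec g = 0 := by
      rw [rowMinor_eq, ← Matrix.mulVec_mulVec, h1, Matrix.mulVec_zero]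
    exact congrFun (Matrix.eq_zero_of_mulVec_eq_zero hQ₀ h2)
  let K := Submodule.span ℝ (Set.range w)
  have hKrank : Module.finrank ℝ K = k := by
    rw [finrank_span_eq_card hw, Fintype.card_fin]
  let v : OrthonormalBasis (Fin k) ℝ K :=
    (stdOrthonormalBasis ℝ K).reindex (finCongr hKrank)
  let U' : Matrix (Fin n) (Fin k) ℝ := Matrix.of fun l j => (v j : EuclideanSpace ℝ (Fin n)) l
  have hU' : U'.transpose * U' = 1 := by
    ext i j
    have h := orthonormal_iff_ite.1 v.orthonormal i j
    rw [Submodule.coe_inner, PiLp.inner_apply] at h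
    rw [Matrix.mul_apply, Matrix.one_apply, ← h]
    exact Finset.sum_congr rfl fun l _ => by simp [U', mul_comm]
  let Sm : Matrix (Fin k) (Fin k) ℝ :=
    Matrix.of fun i j => v.repr ⟨w j, Submodule.subset_span ⟨j, rfl⟩⟩ i
  have hfac : Matrix.of W = U' * Sm := by
    ext l j
    have h := congrArg (fun x : K => (x : EuclideanSpace ℝ (Fin n)) l)
      (v.sum_repr ⟨w j, Submodule.subset_span ⟨j, rfl⟩⟩)
    rw [Matrix.mul_apply]
    simpa [U', Sm, w, mul_comm] using h.symm
  have hU'ae : ∀ᵐ Q ∂μ, (rowMinor row U' Q).det ≠ 0 := by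
    filter_upwards [hW] with Q hQ h0
    refine hQ ?_
    rw [hfac, rowMinor_eq, ← Matrix.mul_assoc, Matrix.det_mul, ← rowMinor_eq, h0, zero_mul]
  obtain ⟨O₁, hO₁⟩ := exists_orthogonalGroup_submatrix hk hU
  obtain ⟨O₂, hO₂⟩ := exists_orthogonalGroup_submatrix hk hU'
  filter_upwards [(measurePreserving_mul_right_of_compactSpace μ
    (O₁ * O₂⁻¹)).quasiMeasurePreserving.ae hU'ae] with Q hQ
  have hU'U : (O₁ * O₂⁻¹).1 * U' = U := by
    have hsub : ∀ O O' : Matrix.orthogonalGroup (Fin n) ℝ,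
        O.1 * O'.1.submatrix id (Fin.castLE hk) = (O * O').1.submatrix id (Fin.castLE hk) := by
      intro O O'
      ext i j
      simp [Matrix.mul_apply]
    rw [← hO₂, hsub, inv_mul_cancel_right, hO₁]
  rwa [rowMinor_mul, hU'U] at hQ

/-! ### The law of the solution of the random linear system -/

/-- The action of the orthogonal group on the Euclidean space. -/
noncomputable def orthogonalAct (g : Matrix.orthogonalGroup (Fin k) ℝ)
    (y : EuclideanSpace ℝ (Fin k)) : EuclideanSpace ℝ (Fin k) :=
  WithLp.toLp 2 (g.1.mulVec y.ofLp)

omit [MeasurableSpace (Matrix.orthogonalGroup (Fin n) ℝ)]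
  [BorelSpace (Matrix.orthogonalGroup (Fin n) ℝ)] in
theorem orthogonalAct_mul (g h : Matrix.orthogonalGroup (Fin k) ℝ) (y : EuclideanSpace ℝ (Fin k)) :
    orthogonalAct (g * h) y = orthogonalAct g (orthogonalAct h y) := by
  simp [orthogonalAct, Matrix.mulVec_mulVec]

theorem orthogonalAct_one (y : EuclideanSpace ℝ (Fin k)) : orthogonalAct 1 y = y := by
  simp [orthogonalAct]

theorem orthogonalAct_smul (g : Matrix.orthogonalGroup (Fin k) ℝ) (r : ℝ)
    (y : EuclideanSpace ℝ (Fin k)) : orthogonalAct g (r • y) = r • orthogonalAct g y := by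
  simp [orthogonalAct, Matrix.mulVec_smul]

/-- The action of an orthogonal matrix as a linear isometry. -/
noncomputable def orthogonalIsometry (g : Matrix.orthogonalGroup (Fin k) ℝ) :
    EuclideanSpace ℝ (Fin k) →ₗᵢ[ℝ] EuclideanSpace ℝ (Fin k) where
  toFun := orthogonalAct g
  map_add' x y := by simp [orthogonalAct, Matrix.mulVec_add]
  map_smul' r x := by simp [orthogonalAct, Matrix.mulVec_smul]
  norm_map' x := by
    have h := (Matrix.mem_orthogonalGroup_iff' (Fin k) ℝ).1 g.2
    have h1 : (g.1.mulVec x.ofLp) ⬝ᵥ (g.1.mulVec x.ofLp) = x.ofLp ⬝ᵥ x.ofLp := by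
      rw [Matrix.dotProduct_mulVec, Matrix.vecMul_mulVec, ← Matrix.dotProduct_mulVec, h,
        Matrix.one_mulVec]
    have h2 : ∀ y : EuclideanSpace ℝ (Fin k), ‖y‖ ^ 2 = y.ofLp ⬝ᵥ y.ofLp := fun y => by
      rw [EuclideanSpace.real_norm_sq_eq]
      exact Finset.sum_congr rfl fun i _ => pow_two _
    have h3 : ‖orthogonalAct g x‖ ^ 2 = ‖x‖ ^ 2 := by
      rw [h2, h2]
      exact h1
    exact (sq_eq_sq₀ (norm_nonneg _) (norm_nonneg _)).1 h3

theorem measurePreserving_orthogonalAct (g : Matrix.orthogonalGroup (Fin k) ℝ) :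
    MeasurePreserving (orthogonalAct g) volume volume :=
  ((orthogonalIsometry g).toLinearIsometryEquiv rfl).measurePreserving

/-- The orthogonal group acts transitively on the rays. -/
theorem exists_orthogonalAct_eq_smul {y y' : EuclideanSpace ℝ (Fin k)} (h : y = 0 ↔ y' = 0) :
    ∃ g : Matrix.orthogonalGroup (Fin k) ℝ, ∃ r : ℝ, 0 < r ∧ orthogonalAct g y = r • y' := by
  by_cases hy : y = 0
  · exact ⟨1, 1, one_pos, by rw [orthogonalAct_one, hy, h.1 hy, smul_zero]⟩
  have hy' : y' ≠ 0 := fun h' => hy (h.2 h')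
  have h1 : 0 < ‖y‖ := norm_pos_iff.2 hy
  have h2 : 0 < ‖y'‖ := norm_pos_iff.2 hy'
  have hnorm : ‖y‖ = ‖(‖y‖ / ‖y'‖) • y'‖ := by
    rw [norm_smul, norm_div, norm_norm, norm_norm, div_mul_cancel₀ _ h2.ne']
  let R := (Submodule.span ℝ {y - (‖y‖ / ‖y'‖) • y'})ᗮ.reflection
  have hR : R y = (‖y‖ / ‖y'‖) • y' := Submodule.reflection_sub hnorm
  let e := EuclideanSpace.basisFun (Fin k) ℝ
  refine ⟨⟨_, e.toMatrix_orthonormalBasis_mem_unitary (e.map R)⟩, ‖y‖ / ‖y'‖, by positivity, ?_⟩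
  rw [← hR]
  have hsum := congrArg R (e.sum_repr y)
  rw [map_sum] at hsum
  ext i
  rw [← hsum]
  simp [orthogonalAct, Matrix.mulVec, dotProduct, Module.Basis.toMatrix_apply, e, mul_comm]

/-- A random vector whose law is invariant under the orthogonal group lies in a given cone with the
probability that is determined by the Haar measure of the group. -/
theorem measure_cone_mul_measure_univ [MeasurableSpace (Matrix.orthogonalGroup (Fin k) ℝ)]
    [BorelSpace (Matrix.orthogonalGroup (Fin k) ℝ)]
    (ν : Measure (Matrix.orthogonalGroup (Fin k) ℝ)) [ν.IsHaarMeasure]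
    {K : Set (EuclideanSpace ℝ (Fin k))} (hK : MeasurableSet K)
    (hcone : ∀ r : ℝ, 0 < r → ∀ z, r • z ∈ K ↔ z ∈ K) (y₀ : EuclideanSpace ℝ (Fin k))
    {Ω : Type*} [MeasurableSpace Ω] (m : Measure Ω) [IsFiniteMeasure m]
    {η : Ω → EuclideanSpace ℝ (Fin k)} (hη : Measurable η)
    (hη0 : ∀ᵐ ω ∂m, (η ω = 0 ↔ y₀ = 0))
    (hinv : ∀ g, m {ω | orthogonalAct g (η ω) ∈ K} = m {ω | η ω ∈ K}) :
    m {ω | η ω ∈ K} * ν Set.univ = m Set.univ * ν {g | orthogonalAct g y₀ ∈ K} := by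
  have hmeas : Measurable fun p : Ω × Matrix.orthogonalGroup (Fin k) ℝ =>
      orthogonalAct p.2 (η p.1) := by
    refine (WithLp.measurable_toLp 2 _).comp (measurable_pi_lambda _ fun i => ?_)
    simp only [Matrix.mulVec, dotProduct]
    refine Finset.measurable_sum _ fun j _ => ?_
    exact ((measurable_orthogonalGroup_apply i j).comp measurable_snd).mul
      ((measurable_pi_apply j).comp ((WithLp.measurable_ofLp 2 _).comp (hη.comp measurable_fst)))
  have hconst : ∀ y, (y = 0 ↔ y₀ = 0) →
      ν {g | orthogonalAct g y ∈ K} = ν {g | orthogonalAct g y₀ ∈ K} := by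
    intro y hy
    obtain ⟨h, r, hr, hh⟩ := exists_orthogonalAct_eq_smul hy
    have h0 : orthogonalAct h⁻¹ (r • y₀) = y := by
      rw [← hh, ← orthogonalAct_mul, inv_mul_cancel, orthogonalAct_one]
    have hset : {g | orthogonalAct g y ∈ K} = (· * h⁻¹) ⁻¹' {g | orthogonalAct g y₀ ∈ K} := by
      ext g
      simp only [Set.mem_ofPred_eq, Set.mem_preimage]
      rw [← h0, ← orthogonalAct_mul, orthogonalAct_smul, hcone r hr]
    rw [hset]
    refine (measurePreserving_mul_right_of_compactSpace ν h⁻¹).measure_preimage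
      (MeasurableSet.nullMeasurableSet ?_)
    have : Measurable fun g : Matrix.orthogonalGroup (Fin k) ℝ => orthogonalAct g y₀ := by
      refine (WithLp.measurable_toLp 2 _).comp (measurable_pi_lambda _ fun i => ?_)
      simp only [Matrix.mulVec, dotProduct]
      exact Finset.measurable_sum _ fun j _ =>
        (measurable_orthogonalGroup_apply i j).mul_const _
    exact this hK
  have hset := hmeas hK
  have h1 := Measure.prod_apply (μ := m) (ν := ν) hset
  rw [Measure.prod_apply_symm hset] at h1
  have h2 : ∀ g, m ((fun ω => (ω, g)) ⁻¹' ((fun p : Ω × Matrix.orthogonalGroup (Fin k) ℝ =>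
      orthogonalAct p.2 (η p.1)) ⁻¹' K)) = m {ω | η ω ∈ K} := hinv
  have h3 : ∀ᵐ ω ∂m, ν (Prod.mk ω ⁻¹' ((fun p : Ω × Matrix.orthogonalGroup (Fin k) ℝ =>
      orthogonalAct p.2 (η p.1)) ⁻¹' K)) = ν {g | orthogonalAct g y₀ ∈ K} := by
    filter_upwards [hη0] with ω hω
    exact hconst _ hω
  rw [lintegral_congr_ae h3, lintegral_const] at h1
  simp only [h2, lintegral_const] at h1
  rw [h1, mul_comm]

/-- The solution `z` of the linear system `∑_j (Q U)_{row i, j} z_j = e_i`. -/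
noncomputable def rowSolution (row : Fin k → Fin n) (U : Matrix (Fin n) (Fin k) ℝ) (e : Fin k → ℝ)
    (Q : Matrix.orthogonalGroup (Fin n) ℝ) : EuclideanSpace ℝ (Fin k) :=
  WithLp.toLp 2 ((rowMinor row U Q)⁻¹.mulVec e)

theorem measurable_rowSolution (row : Fin k → Fin n) (U : Matrix (Fin n) (Fin k) ℝ)
    (e : Fin k → ℝ) : Measurable (rowSolution row U e) := by
  have hcont : Continuous (rowMinor row U) := by
    unfold rowMinor
    exact (continuous_subtype_val.matrix_mul continuous_const).matrix_submatrix _ _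
  have hinv : ∀ i j, Measurable fun Q => (rowMinor row U Q)⁻¹ i j := by
    intro i j
    simp only [Matrix.inv_def, Ring.inverse_eq_inv', Matrix.smul_apply, smul_eq_mul]
    exact (hcont.matrix_det.measurable.inv).mul (hcont.matrix_adjugate.matrix_elem i j).measurable
  refine (WithLp.measurable_toLp 2 _).comp (measurable_pi_lambda _ fun i => ?_)
  simp only [Matrix.mulVec, dotProduct]
  exact Finset.measurable_sum _ fun j _ => (hinv i j).mul_const _

omit [MeasurableSpace (Matrix.orthogonalGroup (Fin n) ℝ)]
  [BorelSpace (Matrix.orthogonalGroup (Fin n) ℝ)] in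
/-- A rotation of the coordinates of the subspace spanned by the columns of `U` is induced by a
rotation of the whole space. -/
theorem exists_orthogonalGroup_mul_eq {U : Matrix (Fin n) (Fin k) ℝ} (hU : U.transpose * U = 1)
    (g : Matrix.orthogonalGroup (Fin k) ℝ) :
    ∃ h : Matrix.orthogonalGroup (Fin n) ℝ, h.1 * U = U * g.1 := by
  have hg := (Matrix.mem_orthogonalGroup_iff (Fin k) ℝ).1 g.2
  set N : Matrix (Fin n) (Fin n) ℝ := 1 - U * U.transpose with hN
  have hNU : N * U = 0 := by
    rw [hN, Matrix.sub_mul, Matrix.mul_assoc, hU, Matrix.one_mul, Matrix.mul_one, sub_self]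
  have hUN : U.transpose * N = 0 := by
    rw [hN, Matrix.mul_sub, ← Matrix.mul_assoc, hU, Matrix.one_mul, Matrix.mul_one, sub_self]
  have hNT : N.transpose = N := by
    simp [hN, Matrix.transpose_sub, Matrix.transpose_mul]
  have hNN : N * N = N := by
    nth_rewrite 2 [hN]
    rw [Matrix.mul_sub, ← Matrix.mul_assoc, hNU, Matrix.zero_mul, Matrix.mul_one, sub_zero]
  refine ⟨⟨U * g.1 * U.transpose + N, ?_⟩, ?_⟩
  · rw [Matrix.mem_orthogonalGroup_iff, Matrix.transpose_add, hNT, Matrix.transpose_mul,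
      Matrix.transpose_mul, Matrix.transpose_transpose, Matrix.add_mul, Matrix.mul_add,
      Matrix.mul_add, hNN]
    have h1 : U * g.1 * U.transpose * (U * (g.1.transpose * U.transpose)) = U * U.transpose := by
      calc U * g.1 * U.transpose * (U * (g.1.transpose * U.transpose))
          = U * g.1 * (U.transpose * U) * (g.1.transpose * U.transpose) := by
            simp only [Matrix.mul_assoc]
        _ = U * (g.1 * g.1.transpose) * U.transpose := by
            rw [hU, Matrix.mul_one]; simp only [Matrix.mul_assoc]
        _ = _ := by rw [hg, Matrix.mul_one]
    rw [h1, Matrix.mul_assoc _ U.transpose N, hUN, Matrix.mul_zero, ← Matrix.mul_assoc N, hNU,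
      Matrix.zero_mul, add_zero, zero_add, hN]
    abel
  · change (U * g.1 * U.transpose + N) * U = U * g.1
    rw [Matrix.add_mul, hNU, add_zero, Matrix.mul_assoc, hU, Matrix.mul_one]

/-- The direction of the solution is uniformly distributed: the probability that the solution lies
in a cone is the solid angle of the cone. -/
theorem measure_rowSolution_mul_volume_ball
    (μ : Measure (Matrix.orthogonalGroup (Fin n) ℝ))
    [μ.IsHaarMeasure] [IsProbabilityMeasure μ] {row : Fin k → Fin n}
    (hrow : Function.Injective row) {U : Matrix (Fin n) (Fin k) ℝ} (hU : U.transpose * U = 1)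
    {e : Fin k → ℝ} (he : k ≠ 0 → e ≠ 0)
    {K : Set (EuclideanSpace ℝ (Fin k))} (hK : MeasurableSet K)
    (hcone : ∀ r : ℝ, 0 < r → ∀ z, r • z ∈ K ↔ z ∈ K) :
    μ {Q | rowSolution row U e Q ∈ K} * volume (Metric.ball (0 : EuclideanSpace ℝ (Fin k)) 1) =
      volume (K ∩ Metric.ball 0 1) := by
  let _ : MeasurableSpace (Matrix.orthogonalGroup (Fin k) ℝ) := borel _
  have _ : BorelSpace (Matrix.orthogonalGroup (Fin k) ℝ) := ⟨rfl⟩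
  let ν : Measure (Matrix.orthogonalGroup (Fin k) ℝ) := Measure.haar
  let y₀ : EuclideanSpace ℝ (Fin k) := WithLp.toLp 2 e
  have hzero : ∀ᵐ Q ∂μ, (rowSolution row U e Q = 0 ↔ y₀ = 0) := by
    filter_upwards [ae_det_rowMinor_ne_zero μ hrow hU] with Q hQ
    have hunit : IsUnit (rowMinor row U Q).det := isUnit_iff_ne_zero.2 hQ
    simp only [rowSolution, y₀, WithLp.toLp_eq_zero]
    constructor
    · intro h
      have := congrArg (rowMinor row U Q).mulVec h
      rwa [Matrix.mulVec_mulVec, Matrix.mul_nonsing_inv _ hunit, Matrix.one_mulVec,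
        Matrix.mulVec_zero] at this
    · rintro rfl
      exact Matrix.mulVec_zero _
  have h1 := measure_cone_mul_measure_univ ν hK hcone y₀ μ (measurable_rowSolution row U e) hzero
    (fun g => by
      obtain ⟨h, hh⟩ := exists_orthogonalGroup_mul_eq hU g⁻¹
      have hset : {Q | orthogonalAct g (rowSolution row U e Q) ∈ K} =
          (· * h) ⁻¹' {Q | rowSolution row U e Q ∈ K} := by
        ext Q
        have : rowSolution row U e (Q * h) = orthogonalAct g (rowSolution row U e Q) := by
          have hinv : (g⁻¹).1⁻¹ = g.1 := by
            refine Matrix.inv_eq_left_inv ?_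
            rw [← Submonoid.coe_mul, mul_inv_cancel]
            rfl
          rw [rowSolution, rowMinor_mul, hh, rowMinor_eq, ← Matrix.mul_assoc, ← rowMinor_eq,
            Matrix.mul_inv_rev, hinv, ← Matrix.mulVec_mulVec]
          rfl
        simp only [Set.mem_ofPred_eq, Set.mem_preimage, this]
      rw [hset]
      exact (measurePreserving_mul_right_of_compactSpace μ h).measure_preimage
        (measurable_rowSolution row U e hK).nullMeasurableSet)
  have hfin : IsFiniteMeasure ((volume : Measure (EuclideanSpace ℝ (Fin k))).restrict
      (Metric.ball 0 1)) := ⟨by rw [Measure.restrict_apply_univ]; exact measure_ball_lt_top⟩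
  have hae : ∀ᵐ y : EuclideanSpace ℝ (Fin k), (y = 0 ↔ y₀ = 0) := by
    rcases Nat.eq_zero_or_pos k with rfl | hk
    · exact Eventually.of_forall fun y => by simp [Subsingleton.elim y 0, Subsingleton.elim y₀ 0]
    · have : Nontrivial (EuclideanSpace ℝ (Fin k)) := by
        have : Nonempty (Fin k) := ⟨⟨0, hk⟩⟩
        infer_instance
      have hy₀ : y₀ ≠ 0 := by simpa [y₀] using he hk.ne'
      filter_upwards [compl_mem_ae_iff.2 (measure_singleton (0 : EuclideanSpace ℝ (Fin k)))] with y hy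
      simpa [hy₀] using hy
  have h2 := measure_cone_mul_measure_univ ν hK hcone y₀
    ((volume : Measure (EuclideanSpace ℝ (Fin k))).restrict (Metric.ball 0 1)) measurable_id
    (ae_restrict_of_ae hae) (fun g => by
      have hgm := (measurePreserving_orthogonalAct g)
      have hs : MeasurableSet {ω : EuclideanSpace ℝ (Fin k) | orthogonalAct g (id ω) ∈ K} :=
        hgm.measurable hK
      have hK' : {ω : EuclideanSpace ℝ (Fin k) | id ω ∈ K} = K := rfl
      rw [hK', Measure.restrict_apply hs, Measure.restrict_apply hK]
      have hset : {ω : EuclideanSpace ℝ (Fin k) | orthogonalAct g (id ω) ∈ K} ∩ Metric.ball 0 1 =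
          orthogonalAct g ⁻¹' (K ∩ Metric.ball 0 1) := by
        ext y
        have := (orthogonalIsometry g).norm_map y
        have h' : ‖orthogonalAct g y‖ = ‖y‖ := this
        simp [h']
      rw [hset]
      exact hgm.measure_preimage (hK.inter measurableSet_ball).nullMeasurableSet)
  have hK' : {ω : EuclideanSpace ℝ (Fin k) | id ω ∈ K} = K := rfl
  rw [hK', Measure.restrict_apply hK, Measure.restrict_apply_univ] at h2
  rw [measure_univ (μ := μ), one_mul] at h1
  have hν0 : ν Set.univ ≠ 0 := isOpen_univ.measure_ne_zero ν Set.univ_nonempty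
  have hν1 : ν Set.univ ≠ ⊤ := measure_ne_top ν _
  refine (ENNReal.mul_left_inj hν0 hν1).1 ?_
  rw [h2, ← h1]
  ring

end OrthogonalGroup

noncomputable section

/-! ### Intersections of the cells with the affine flag -/

section Flag

variable {n : ℕ} {ι P : Type*} [Fintype ι] [Fintype P]
variable {cls : P → ι} {a : P → EuclideanSpace ℝ (Fin n)} {b : P → ℝ}

namespace CellFrame

variable {S : Finset P} (F : CellFrame cls a b S) {d : ℕ} (hd : d + F.k = n)

/-- The matrix with the columns `u j`. -/
def columns : Matrix (Fin n) (Fin F.k) ℝ := Matrix.of fun l j => F.u j l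

theorem transpose_columns_mul_columns : F.columns.transpose * F.columns = 1 := by
  ext i j
  have h := orthonormal_iff_ite.1 F.orthonormal i j
  rw [PiLp.inner_apply] at h
  rw [Matrix.mul_apply, Matrix.one_apply, ← h]
  exact Finset.sum_congr rfl fun l _ => by simp [columns, mul_comm]

theorem ofLp_incl (z : EuclideanSpace ℝ (Fin F.k)) :
    (F.incl z).ofLp = F.columns.mulVec z.ofLp := by
  ext l
  simp [incl, columns, Matrix.mulVec, dotProduct, mul_comm]

include hd in
theorem lastRow_lt (i : Fin F.k) : d + (i : ℕ) < n := by
  have := i.2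
  omega

/-- The indices of the equations of the member `F_d` of the flag. -/
def lastRow (i : Fin F.k) : Fin n := ⟨d + i, F.lastRow_lt hd i⟩

theorem lastRow_injective : Function.Injective (F.lastRow hd) := by
  intro i j h
  have h1 : d + (i : ℕ) = d + j := congrArg Fin.val h
  exact Fin.ext (by omega)

/-- The direction, within the affine hull of the cell, in which the intersection point with the
flag escapes to infinity. -/
def escapeDirection (Q : Matrix.orthogonalGroup (Fin n) ℝ) : EuclideanSpace ℝ (Fin F.k) :=
  rowSolution (F.lastRow hd) F.columns (fun i => if (i : ℕ) = 0 then 1 else 0) Q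

/-- The coordinates of the intersection point of the flag with the affine hull of the cell. -/
def flagPoint (Q : Matrix.orthogonalGroup (Fin n) ℝ) (R : ℝ) : EuclideanSpace ℝ (Fin F.k) :=
  rowSolution (F.lastRow hd) F.columns
    (fun i => R ^ (F.k - (i : ℕ)) - Q.1.mulVec F.origin.ofLp (F.lastRow hd i)) Q

theorem mem_flagSpace_iff {Q : Matrix.orthogonalGroup (Fin n) ℝ}
    (hQ : (rowMinor (F.lastRow hd) F.columns Q).det ≠ 0) (R : ℝ)
    (z : EuclideanSpace ℝ (Fin F.k)) :
    (F.origin + F.incl z).ofLp ∈ flagSpace Q R d ↔ z = F.flagPoint hd Q R := by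
  have hunit : IsUnit (rowMinor (F.lastRow hd) F.columns Q).det := isUnit_iff_ne_zero.2 hQ
  have hrow : ∀ i, Q.1.mulVec (F.origin + F.incl z).ofLp (F.lastRow hd i) =
      Q.1.mulVec F.origin.ofLp (F.lastRow hd i) +
        (rowMinor (F.lastRow hd) F.columns Q).mulVec z.ofLp i := by
    intro i
    rw [WithLp.ofLp_add, Matrix.mulVec_add, Pi.add_apply, F.ofLp_incl, Matrix.mulVec_mulVec]
    rfl
  have hflag : (F.origin + F.incl z).ofLp ∈ flagSpace Q R d ↔
      (rowMinor (F.lastRow hd) F.columns Q).mulVec z.ofLp =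
        fun i : Fin F.k =>
          R ^ (F.k - (i : ℕ)) - Q.1.mulVec F.origin.ofLp (F.lastRow hd i) := by
    have hexp : ∀ i : Fin F.k, n - ((F.lastRow hd i : Fin n) : ℕ) = F.k - (i : ℕ) := by
      intro i
      simp only [lastRow]
      omega
    constructor
    · intro h
      funext i
      have h1 := h (F.lastRow hd i) (Nat.le_add_right d i)
      rw [hrow, hexp] at h1
      linarith
    · intro h j hj
      have hj' : j = F.lastRow hd ⟨j - d, by have := j.2; omega⟩ := by
        apply Fin.ext
        simp only [lastRow]
        omega
      rw [hj', hrow, hexp, h]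
      ring
  rw [hflag]
  constructor
  · intro h
    rw [flagPoint, rowSolution, ← h, Matrix.mulVec_mulVec, Matrix.nonsing_inv_mul _ hunit,
      Matrix.one_mulVec]
  · intro h
    rw [h]
    change (rowMinor (F.lastRow hd) F.columns Q).mulVec
      ((rowMinor (F.lastRow hd) F.columns Q)⁻¹.mulVec _) = _
    rw [Matrix.mulVec_mulVec, Matrix.mul_nonsing_inv _ hunit, Matrix.one_mulVec]

/-- The point `flagPoint Q R` is asymptotic to `R ^ k • escapeDirection Q`, as the first equation has
the dominant right hand side. -/
theorem eventually_inner_flagPoint_lt_iff (Q : Matrix.orthogonalGroup (Fin n) ℝ)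
    {w : EuclideanSpace ℝ (Fin F.k)} (hw : w ≠ 0) (hne : inner ℝ w (F.escapeDirection hd Q) ≠ 0)
    (κ : ℝ) : ∀ᶠ R : ℝ in atTop,
      (inner ℝ w (F.flagPoint hd Q R) < κ ↔ inner ℝ w (F.escapeDirection hd Q) < 0) := by
  have hk : F.k ≠ 0 := by
    intro h0
    apply hw
    ext i
    exact absurd i.2 (by omega)
  let f : (Fin F.k → ℝ) →ₗ[ℝ] ℝ := (innerₛₗ ℝ w).comp
    ((WithLp.linearEquiv 2 ℝ (Fin F.k → ℝ)).symm.toLinearMap.comp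
      (rowMinor (F.lastRow hd) F.columns Q)⁻¹.mulVecLin)
  have hf : ∀ e, f e = inner ℝ w (rowSolution (F.lastRow hd) F.columns e Q) := fun e => rfl
  have hfc : Continuous f := f.continuous_of_finiteDimensional
  set q : Fin F.k → ℝ := fun i => Q.1.mulVec F.origin.ofLp (F.lastRow hd i) with hq
  let e : Fin F.k → ℝ := fun i => if (i : ℕ) = 0 then 1 else 0
  have hfe : f e = inner ℝ w (F.escapeDirection hd Q) := rfl
  have hpoint : ∀ R : ℝ, inner ℝ w (F.flagPoint hd Q R) = f (fun i => R ^ (F.k - (i : ℕ)) - q i) :=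
    fun R => rfl
  have hlim : Tendsto (fun R : ℝ => f (fun i => (R ^ F.k)⁻¹ * (R ^ (F.k - (i : ℕ)) - q i))) atTop
      (nhds (f e)) := by
    refine (hfc.tendsto e).comp (tendsto_pi_nhds.2 fun i => ?_)
    have hzero : Tendsto (fun R : ℝ => (R ^ F.k)⁻¹ * q i) atTop (nhds 0) := by
      simpa using (tendsto_inv_atTop_zero.comp (tendsto_pow_atTop hk)).mul_const (q i)
    have hmain : Tendsto (fun R : ℝ => (R ^ F.k)⁻¹ * R ^ (F.k - (i : ℕ))) atTop (nhds (e i)) := by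
      have hik : (i : ℕ) ≤ F.k := i.2.le
      have heq : (fun R : ℝ => (R ^ (i : ℕ))⁻¹) =ᶠ[atTop]
          fun R : ℝ => (R ^ F.k)⁻¹ * R ^ (F.k - (i : ℕ)) := by
        filter_upwards [eventually_gt_atTop 0] with R hR
        rw [pow_sub₀ R hR.ne' hik]
        field_simp
      refine Tendsto.congr' heq ?_
      by_cases hi : (i : ℕ) = 0
      · simp [e, hi]
      · simpa [e, hi, Function.comp_def] using
          tendsto_inv_atTop_zero.comp (tendsto_pow_atTop (α := ℝ) hi)
    simpa [mul_sub] using hmain.sub hzero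
  have hscale : (fun R : ℝ => R ^ F.k *
      f (fun i => (R ^ F.k)⁻¹ * (R ^ (F.k - (i : ℕ)) - q i))) =ᶠ[atTop]
      fun R => inner ℝ w (F.flagPoint hd Q R) := by
    filter_upwards [eventually_gt_atTop 0] with R hR
    have hR' : (R ^ F.k) ≠ 0 := (pow_pos hR _).ne'
    rw [hpoint, ← smul_eq_mul, ← map_smul]
    congr 1
    funext i
    simp [hR']
  rw [← hfe] at hne ⊢
  rcases lt_or_gt_of_ne hne with hneg | hpos
  · have ht := ((tendsto_pow_atTop hk).atTop_mul_neg hneg hlim).congr' hscale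
    filter_upwards [ht.eventually_lt_atBot κ] with R hR
    exact iff_of_true hR hneg
  · have ht := ((tendsto_pow_atTop hk).atTop_mul_pos hpos hlim).congr' hscale
    filter_upwards [ht.eventually_gt_atTop κ] with R hR
    exact iff_of_false (not_lt.2 hR.le) (not_lt.2 hpos.le)

/-- For large `R` the cell meets the flag if and only if its recession cone contains the escape
direction, unless this direction lies on the boundary of the cone. -/
theorem eventually_activeSet_flagPoint_eq_iff (Q : Matrix.orthogonalGroup (Fin n) ℝ)
    (hne : ∀ p, F.normal p ≠ 0 → inner ℝ (F.normal p) (F.escapeDirection hd Q) ≠ 0) :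
    ∀ᶠ R : ℝ in atTop, (activeSet cls a b (F.origin + F.incl (F.flagPoint hd Q R)) = S ↔
      F.escapeDirection hd Q ∈ F.openRecessionCone) := by
  have h : ∀ p, ∀ᶠ R : ℝ in atTop, F.normal p ≠ 0 →
      (inner ℝ (F.normal p) (F.flagPoint hd Q R) < F.slack p ↔
        inner ℝ (F.normal p) (F.escapeDirection hd Q) < 0) := by
    intro p
    by_cases h0 : F.normal p = 0
    · exact Eventually.of_forall fun R h => absurd h0 h
    · filter_upwards [F.eventually_inner_flagPoint_lt_iff hd Q h0 (hne p h0) (F.slack p)]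
        with R hR _ using hR
  filter_upwards [eventually_all.2 h] with R hR
  rw [F.activeSet_eq_iff_lt_slack]
  refine forall₂_congr fun p hp => ?_
  by_cases h0 : F.normal p = 0
  · simp [h0, F.slack_pos_of_normal_eq_zero hp h0]
  · simp [h0, hR p h0]

theorem activeSet_flagPoint_of_mem
    (hint : ∀ p, ∃ w : Fin n → ℤ, a p = WithLp.toLp 2 (fun j => (w j : ℝ)))
    {Q : Matrix.orthogonalGroup (Fin n) ℝ}
    (hQ : (rowMinor (F.lastRow hd) F.columns Q).det ≠ 0) {R : ℝ} {ξ : Fin n → ℝ}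
    (hξ : ξ ∈ flagSpace Q R d) (hS : activeSet cls a b (WithLp.toLp 2 ξ) = S) :
    WithLp.toLp 2 ξ = F.origin + F.incl (F.flagPoint hd Q R) := by
  obtain ⟨z, hz⟩ := F.exists_eq_origin_add_incl hint hS
  rw [hz, ← (F.mem_flagSpace_iff hd hQ R z).1 (by rw [← hz]; exact hξ)]

section Probability

variable [MeasurableSpace (Matrix.orthogonalGroup (Fin n) ℝ)]
  [BorelSpace (Matrix.orthogonalGroup (Fin n) ℝ)]

theorem measurable_escapeDirection : Measurable (F.escapeDirection hd) :=
  measurable_rowSolution _ _ _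

variable (μ : Measure (Matrix.orthogonalGroup (Fin n) ℝ)) [μ.IsHaarMeasure]
  [IsProbabilityMeasure μ]

theorem measure_escapeDirection_mul {K : Set (EuclideanSpace ℝ (Fin F.k))} (hK : MeasurableSet K)
    (hcone : ∀ r : ℝ, 0 < r → ∀ z, r • z ∈ K ↔ z ∈ K) :
    μ {Q | F.escapeDirection hd Q ∈ K} *
      volume (Metric.ball (0 : EuclideanSpace ℝ (Fin F.k)) 1) = volume (K ∩ Metric.ball 0 1) := by
  refine measure_rowSolution_mul_volume_ball μ (F.lastRow_injective hd)
    F.transpose_columns_mul_columns (fun hk h0 => ?_) hK hcone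
  have := congrFun h0 ⟨0, Nat.pos_of_ne_zero hk⟩
  simp at this

theorem ae_inner_escapeDirection_ne_zero {w : EuclideanSpace ℝ (Fin F.k)} (hw : w ≠ 0) :
    ∀ᵐ Q ∂μ, inner ℝ w (F.escapeDirection hd Q) ≠ 0 := by
  have hK : MeasurableSet {z : EuclideanSpace ℝ (Fin F.k) | inner ℝ w z = 0} :=
    measurableSet_eq_fun (measurable_const.inner measurable_id) measurable_const
  have h := F.measure_escapeDirection_mul hd μ hK fun r hr z => by
    simp [real_inner_smul_right, hr.ne']
  have hnull : volume {z : EuclideanSpace ℝ (Fin F.k) | inner ℝ w z = 0} = 0 := by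
    have h1 := Measure.addHaar_submodule (volume : Measure (EuclideanSpace ℝ (Fin F.k)))
      (LinearMap.ker (innerₛₗ ℝ w)) (fun htop => hw (by
        have : w ∈ LinearMap.ker (innerₛₗ ℝ w) := htop ▸ Submodule.mem_top
        simpa using this))
    exact h1
  rw [measure_mono_null Set.inter_subset_left hnull] at h
  have hball : volume (Metric.ball (0 : EuclideanSpace ℝ (Fin F.k)) 1) ≠ 0 :=
    (Metric.measure_ball_pos volume _ one_pos).ne'
  exact compl_mem_ae_iff.2 ((mul_eq_zero.1 h).resolve_right hball)

/-- The probability that the cell contributes a vertex, bounded through the cross-polytope. -/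
theorem measureReal_escapeDirection_le :
    μ.real {Q | F.escapeDirection hd Q ∈ F.openRecessionCone} ≤
      (F.k ! : ℝ) / 2 ^ F.k * volume.real (F.openRecessionCone ∩ Metric.ball 0 1) := by
  have h := congrArg ENNReal.toReal (F.measure_escapeDirection_mul hd μ
    F.measurableSet_openRecessionCone fun r hr z => F.smul_mem_openRecessionCone_iff hr z)
  rw [ENNReal.toReal_mul] at h
  change μ.real _ * volume.real _ = volume.real _ at h
  have hball := ENNReal.toReal_mono measure_ball_lt_top.ne (le_volume_ball F.k)
  rw [ENNReal.toReal_ofReal (by positivity)] at hball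
  change _ ≤ volume.real _ at hball
  rw [← h]
  have h0 : 0 ≤ μ.real {Q | F.escapeDirection hd Q ∈ F.openRecessionCone} := measureReal_nonneg
  have h1 : (1 : ℝ) = (F.k ! : ℝ) / 2 ^ F.k * (2 ^ F.k / F.k !) := by
    field_simp
  calc μ.real {Q | F.escapeDirection hd Q ∈ F.openRecessionCone}
      = μ.real {Q | F.escapeDirection hd Q ∈ F.openRecessionCone} *
          ((F.k ! : ℝ) / 2 ^ F.k * (2 ^ F.k / F.k !)) := by rw [← h1, mul_one]
    _ ≤ μ.real {Q | F.escapeDirection hd Q ∈ F.openRecessionCone} * ((F.k ! : ℝ) / 2 ^ F.k *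
          volume.real (Metric.ball (0 : EuclideanSpace ℝ (Fin F.k)) 1)) := by gcongr
    _ = _ := by ring

end Probability

end CellFrame

end Flag

end

noncomputable section

/-! ### The lifted point configuration -/

section Configuration

variable {n s : ℕ} {A : Fin s → Finset (Fin n → ℤ)}

/-- The lattice points of the supports as points of the Euclidean space. -/
def latticePoint (p : SupportUnion A) : EuclideanSpace ℝ (Fin n) :=
  WithLp.toLp 2 fun k => (p.2.1 k : ℝ)

theorem inner_latticePoint (p : SupportUnion A) (ξ : Fin n → ℝ) :
    inner ℝ (latticePoint p) (WithLp.toLp 2 ξ) = latticePairing ξ p.2.1 := by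
  simp [latticePoint, latticePairing, PiLp.inner_apply]

theorem surjective_fst (hA : ∀ i, (A i).Nonempty) :
    Function.Surjective (Sigma.fst : SupportUnion A → Fin s) := fun i =>
  ⟨⟨i, ⟨_, (hA i).choose_spec⟩⟩, rfl⟩

theorem le_legendreDual (b : SupportUnion A → ℝ) (ξ : Fin n → ℝ) (p : SupportUnion A) :
    latticePairing ξ p.2.1 - b p ≤ legendreDual b p.1 ξ :=
  le_ciSup (f := fun a : {a : Fin n → ℤ // a ∈ A p.1} => latticePairing ξ a.1 - b ⟨p.1, a⟩)
    (Set.finite_range _).bddAbove p.2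

theorem mem_activeSet_iff_eq_legendreDual (b : SupportUnion A → ℝ) (ξ : Fin n → ℝ)
    (p : SupportUnion A) :
    p ∈ activeSet Sigma.fst latticePoint b (WithLp.toLp 2 ξ) ↔
      latticePairing ξ p.2.1 - b p = legendreDual b p.1 ξ := by
  rw [mem_activeSet]
  simp only [inner_latticePoint]
  constructor
  · intro h
    refine le_antisymm (le_legendreDual b ξ p) ?_
    have : Nonempty {a : Fin n → ℤ // a ∈ A p.1} := ⟨p.2⟩
    exact ciSup_le fun a => h ⟨p.1, a⟩ rfl
  · rintro h ⟨i, a⟩ hq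
    obtain rfl : i = p.1 := hq
    rw [h]
    exact le_legendreDual b ξ ⟨p.1, a⟩

theorem tropicalType_eq_card (b : SupportUnion A → ℝ) (ξ : Fin n → ℝ) (i : Fin s) :
    tropicalType b i ξ =
      ((activeSet Sigma.fst latticePoint b (WithLp.toLp 2 ξ)).filter fun p => p.1 = i).card - 1 := by
  rw [tropicalType]
  congr 1
  have hinj : Function.Injective (fun a : {a : Fin n → ℤ // a ∈ A i} =>
      (⟨i, a⟩ : SupportUnion A)) := fun a a' h => eq_of_heq (Sigma.mk.inj h).2
  rw [← Set.ncard_image_of_injective _ hinj, ← Set.ncard_coe_finset]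
  congr 1
  ext ⟨i', a⟩
  simp only [Set.mem_image, Set.mem_ofPred_eq, Finset.coe_filter]
  rw [mem_activeSet_iff_eq_legendreDual]
  constructor
  · rintro ⟨a', h, h'⟩
    cases h'
    exact ⟨h, rfl⟩
  · rintro ⟨h, rfl⟩
    exact ⟨a, h, rfl⟩

/-- A lifting in general position has linearly independent active sets: the active vectors lie in a
hyperplane which does not contain `[0, …, 0, 1]`. -/
theorem LiftingInGeneralPosition.activeSetsIndependent {b : SupportUnion A → ℝ}
    (hb : LiftingInGeneralPosition b) :
    ActiveSetsIndependent Sigma.fst latticePoint b := by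
  intro x
  obtain ⟨ξ, rfl⟩ : ∃ ξ, x = WithLp.toLp 2 ξ := ⟨x.ofLp, rfl⟩
  set S := activeSet Sigma.fst latticePoint b (WithLp.toLp 2 ξ) with hS
  let L : ((Fin s → ℝ) × (Fin n → ℝ) × ℝ) →ₗ[ℝ] ℝ :=
    { toFun := fun v => ∑ i, v.1 i * legendreDual b i ξ + ∑ k, ξ k * v.2.1 k - v.2.2
      map_add' := fun v w => by
        simp only [Prod.fst_add, Prod.snd_add, Pi.add_apply, add_mul, mul_add,
          Finset.sum_add_distrib]
        ring
      map_smul' := fun r v => by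
        simp only [Prod.smul_fst, Prod.smul_snd, Pi.smul_apply, smul_eq_mul, RingHom.id_apply,
          mul_sub, mul_add, Finset.mul_sum]
        congr 2
        · exact Finset.sum_congr rfl fun _ _ => by ring
        · exact Finset.sum_congr rfl fun _ _ => by ring }
  have hL : ∀ v, L v = ∑ i, v.1 i * legendreDual b i ξ + ∑ k, ξ k * v.2.1 k - v.2.2 :=
    fun _ => rfl
  have hLS : ∀ p ∈ S, L (liftedCayleyVector b p) = 0 := by
    intro p hp
    have h := (mem_activeSet_iff_eq_legendreDual b ξ p).1 hp
    rw [latticePairing] at h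
    rw [hL, liftedCayleyVector, ← sub_eq_zero.2 h]
    simp [Pi.single_apply]
    ring
  have hindep : ∀ T ⊆ S, T.card ≤ n + s + 1 →
      LinearIndependent ℝ (fun p : T => liftedCayleyVector b p.1) := by
    intro T hT hcard
    refine (hb T hcard).resolve_right fun hmem => ?_
    have hle : Submodule.span ℝ (liftedCayleyVector b '' (T : Set (SupportUnion A))) ≤
        LinearMap.ker L := by
      rw [Submodule.span_le]
      rintro _ ⟨p, hp, rfl⟩
      exact hLS p (hT hp)
    have h := hle hmem
    rw [LinearMap.mem_ker, hL] at h
    simp at h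
  have hcard : S.card ≤ n + s + 1 := by
    by_contra hlt
    obtain ⟨T, hTS, hTc⟩ := Finset.exists_subset_card_eq (le_of_lt (not_le.1 hlt))
    have hli := hindep T hTS hTc.le
    have hspan := hli.span_eq_top_of_card_eq_finrank' (by simp [hTc]; ring)
    have h : ((0, 0, 1) : (Fin s → ℝ) × (Fin n → ℝ) × ℝ) ∈ LinearMap.ker L := by
      have hle : Submodule.span ℝ (Set.range fun p : T => liftedCayleyVector b p.1) ≤
          LinearMap.ker L := by
        rw [Submodule.span_le]
        rintro _ ⟨p, rfl⟩
        exact hLS p (hTS p.2)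
      exact hle (hspan ▸ Submodule.mem_top)
    rw [LinearMap.mem_ker, hL] at h
    simp at h
  have hli := hindep S subset_rfl hcard
  rw [Fintype.linearIndependent_iff] at hli ⊢
  intro g hg
  refine hli g ?_
  have h1 : ∑ p : S, g p • (Pi.single p.1.1 1 : Fin s → ℝ) = 0 := by
    have := congrArg Prod.fst hg
    simpa [Prod.fst_sum] using this
  have h2 : ∑ p : S, g p • latticePoint p.1 = 0 := by
    have := congrArg Prod.snd hg
    simpa [Prod.snd_sum] using this
  have h3 : L (∑ p : S, g p • liftedCayleyVector b p.1) = 0 := by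
    rw [map_sum]
    refine Finset.sum_eq_zero fun p _ => ?_
    rw [map_smul, hLS p.1 p.2, smul_zero]
  have h4 : (∑ p : S, g p • liftedCayleyVector b p.1).1 = 0 := by
    rw [Prod.fst_sum]
    simpa [liftedCayleyVector] using h1
  have h5 : (∑ p : S, g p • liftedCayleyVector b p.1).2.1 = 0 := by
    have := congrArg WithLp.ofLp h2
    rw [Prod.snd_sum, Prod.fst_sum]
    simpa [liftedCayleyVector, latticePoint, WithLp.ofLp_sum] using this
  have h6 : (∑ p : S, g p • liftedCayleyVector b p.1).2.2 = 0 := by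
    rw [hL, h4, h5] at h3
    simpa using h3
  exact Prod.ext h4 (Prod.ext h5 h6)

end Configuration

/-! ### Mixed volumes as polarized volumes -/

section MixedVolume

theorem natCard_sigma_fin {X O : Type*} [Fintype X] [DecidableEq O] (m : X → ℕ) (g : X → O) (o : O) :
    Nat.card {j : Σ x, Fin (m x) // g j.1 = o} = ∑ x, if g x = o then m x else 0 := by
  classical
  rw [Nat.card_eq_fintype_card, Fintype.card_subtype, Finset.card_filter, Fintype.sum_sigma]
  refine Finset.sum_congr rfl fun x _ => ?_
  by_cases h : g x = o <;> simp [h]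

variable {n s : ℕ} {A : Fin s → Finset (Fin n → ℤ)}

theorem convexHull_latticePoint_eq (i : Fin s) :
    convexHull ℝ (latticePoint '' {p : SupportUnion A | p ∈ (Set.univ : Set (SupportUnion A)) ∧
      p.1 = i}) = supportPolytope (A i) := by
  rw [supportPolytope]
  congr 1
  ext x
  constructor
  · rintro ⟨⟨i', a⟩, ⟨-, h⟩, rfl⟩
    obtain rfl : i' = i := h
    exact ⟨a.1, a.2, rfl⟩
  · rintro ⟨a, ha, rfl⟩
    exact ⟨⟨i, a, ha⟩, ⟨trivial, rfl⟩, rfl⟩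

theorem mixedCell_latticePoint (c : Fin s → ℝ) :
    mixedCell Sigma.fst latticePoint c (Set.univ : Set (SupportUnion A)) =
      ∑ i, c i • supportPolytope (A i) := by
  simp only [mixedCell, convexHull_latticePoint_eq]

theorem supportPolytope_nonempty (hA : ∀ i, (A i).Nonempty) (i : Fin s) :
    (supportPolytope (A i)).Nonempty := by
  obtain ⟨a, ha⟩ := hA i
  exact ⟨_, subset_convexHull ℝ _ ⟨a, ha, rfl⟩⟩

theorem zero_smul_closedBall :
    (0 : ℝ) • Metric.closedBall (0 : EuclideanSpace ℝ (Fin n)) 1 = 0 :=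
  Set.zero_smul_set ⟨0, by simp⟩

/-- The bodies of the mixed volume are of the form `∑ c_i 𝒜_i + r B`. -/
theorem mixedBody_eq_elim (hA : ∀ i, (A i).Nonempty) (x : Fin s ⊕ Fin 2) :
    mixedBody (Sigma.fst : SupportUnion A → Fin s) latticePoint
      (Sum.elim (fun i => Pi.single i 1) ![1, 0] x) (Sum.elim (fun _ => 0) ![0, 1] x) =
    Sum.elim (fun i : Fin s => supportPolytope (A i))
      ![∑ i, supportPolytope (A i), Metric.closedBall 0 1] x := by
  rw [mixedBody, mixedCell_latticePoint]
  rcases x with i | x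
  · simp only [Sum.elim_inl, zero_smul_closedBall, add_zero]
    rw [Finset.sum_eq_single i]
    · simp
    · intro i' _ hne
      rw [Pi.single_eq_of_ne hne, Set.zero_smul_set (supportPolytope_nonempty hA i')]
    · simp
  · fin_cases x
    · simp
    · simp [Set.zero_smul_set (supportPolytope_nonempty hA _)]

end MixedVolume

end

noncomputable section

/-! ### Counting the vertices -/

section Vertices

variable {n s : ℕ} {A : Fin s → Finset (Fin n → ℤ)} {b : SupportUnion A → ℝ}

/-- A family dominating `m` whose sum is larger by one differs from `m` at one index only. -/
theorem exists_eq_add_ite_of_sum_eq_add_one {ι : Type*} [Fintype ι] [DecidableEq ι]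
    {m c : ι → ℕ} (hle : ∀ i, m i ≤ c i) (hsum : ∑ i, c i = ∑ i, m i + 1) :
    ∃ i₀, ∀ i, c i = m i + if i₀ = i then 1 else 0 := by
  have h1 : ∑ i, (c i - m i) = 1 := by
    rw [Finset.sum_tsub_distrib _ fun i _ => hle i, hsum]
    omega
  obtain ⟨i₀, -, hi₀⟩ := Finset.exists_ne_zero_of_sum_ne_zero (h1.trans_ne one_ne_zero)
  refine ⟨i₀, fun i => ?_⟩
  rw [← Finset.add_sum_erase _ _ (Finset.mem_univ i₀)] at h1
  have h2 : ∑ i ∈ Finset.univ.erase i₀, (c i - m i) = 0 := by omega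
  have := hle i
  split_ifs with h
  · subst h
    omega
  · have := Finset.sum_eq_zero_iff.1 h2 i (by simp [Ne.symm h])
    omega

theorem exists_latticePoint_eq (p : SupportUnion A) :
    ∃ w : Fin n → ℤ, latticePoint p = WithLp.toLp 2 (fun j => (w j : ℝ)) := ⟨p.2.1, rfl⟩

variable (F : ∀ S : Cell Sigma.fst latticePoint b, CellFrame Sigma.fst latticePoint b S.1)

/-- The cells whose relative interiors consist of the points `ξ` with `m_i(ξ) ≥ m_i` for all `i`
and `∑ m_i(ξ) = d`. -/
def cellsOfType (m : Fin s → ℕ) (d : ℕ) : Finset (Cell Sigma.fst latticePoint b) :=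
  {S | (∀ i, m i ≤ Fintype.card (OffBase Sigma.fst S.1 (F S).base i)) ∧
    ∑ i, Fintype.card (OffBase Sigma.fst S.1 (F S).base i) = d}

theorem mem_cellsOfType {m : Fin s → ℕ} {d : ℕ} {S : Cell Sigma.fst latticePoint b} :
    S ∈ cellsOfType F m d ↔ (∀ i, m i ≤ Fintype.card (OffBase Sigma.fst S.1 (F S).base i)) ∧
      ∑ i, Fintype.card (OffBase Sigma.fst S.1 (F S).base i) = d := by
  simp [cellsOfType]

theorem add_k_of_mem_cellsOfType {m : Fin s → ℕ} {d : ℕ} {S : Cell Sigma.fst latticePoint b}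
    (hS : S ∈ cellsOfType F m d) : d + (F S).k = n := by
  rw [← ((mem_cellsOfType F).1 hS).2, ← Fintype.card_sigma]
  exact (F S).card_add

/-- The total size of the recession cones of the cells of a given type is bounded by a mixed
volume. -/
theorem sum_factorial_mul_volume_openRecessionCone_le (hA : ∀ i, (A i).Nonempty)
    {m : Fin s → ℕ} {d : ℕ} (hd : d ≤ n) (hm : ∑ i, m i + 1 = d) :
    ∑ S ∈ cellsOfType F m d,
      ((F S).k ! : ℝ) * volume.real ((F S).openRecessionCone ∩ Metric.ball 0 1) ≤
    (n ! : ℝ) * semiMixedVolume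
      (Sum.elim (fun i : Fin s => supportPolytope (A i))
        ![∑ i, supportPolytope (A i), Metric.closedBall 0 1])
      (Sum.elim m ![1, n - d]) := by
  -- A cell with the numbers `c_i` has `c_i = m_i` except for one `i₀` with `c_{i₀} = m_{i₀} + 1`:
  -- the factor `∑ i, 𝒜_i` accounts for `i₀`.
  have hi₀ : ∀ S, ∃ i₀ : Option (Fin s), S ∈ cellsOfType F m d → ∃ i₁, i₀ = some i₁ ∧
      ∀ i, Fintype.card (OffBase Sigma.fst S.1 (F S).base i) = m i + if i₁ = i then 1 else 0 := by
    intro S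
    by_cases hS : S ∈ cellsOfType F m d
    · obtain ⟨h1, h2⟩ := (mem_cellsOfType F).1 hS
      obtain ⟨i₁, hi₁⟩ := exists_eq_add_ite_of_sum_eq_add_one h1 (h2.trans hm.symm)
      exact ⟨some i₁, fun _ => ⟨i₁, rfl, hi₁⟩⟩
    · exact ⟨none, fun h => absurd h hS⟩
  choose i₀ hi₀ using hi₀
  let g : Cell Sigma.fst latticePoint b → Fin s ⊕ Fin 2 → Option (Fin s) := fun S =>
    Sum.elim (fun i => some i) ![i₀ S, none]
  let K : Fin s ⊕ Fin 2 → ℕ := Sum.elim m ![1, n - d]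
  have hκ : Fintype.card (Σ x, Fin (K x)) = n := by
    simp [Fintype.card_sigma, K]
    omega
  refine sum_mul_volume_openRecessionCone_le F _ (fun S => by positivity) fun t ht => ?_
  have key := sum_factorial_mul_slice_le (b := b) exists_latticePoint_eq (surjective_fst hA) F hκ
    (c := fun j => Sum.elim (fun i => Pi.single i 1) ![1, 0] j.1)
    (fun ⟨x, _⟩ i => by
      rcases x with i' | x
      · by_cases h : i = i'
        · subst h; simp
        · simp [h]
      · fin_cases x <;> simp)
    (ρ := fun j => Sum.elim (fun _ => 0) ![0, 1] j.1)
    (fun ⟨x, _⟩ => by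
      rcases x with i' | x
      · simp
      · fin_cases x <;> simp)
    (cellsOfType F m d) (fun S j => g S j.1)
    (fun S hS ⟨x, _⟩ i h => by
      rcases x with i' | x
      · obtain rfl : i' = i := by simpa [g] using h
        simp
      · fin_cases x
        · simp
        · simp [g] at h)
    (fun S hS ⟨x, _⟩ h => by
      obtain ⟨i₁, hi₁, -⟩ := hi₀ S hS
      rcases x with i' | x
      · simp [g] at h
      · fin_cases x
        · simp [g, hi₁] at h
        · simp)
    (fun S hS i => by
      obtain ⟨i₁, hi₁, hc⟩ := hi₀ S hS
      rw [natCard_sigma_fin, Fintype.sum_sum_type, Fin.sum_univ_two, hc]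
      simp [g, K, hi₁])
    (fun S hS => by
      obtain ⟨i₁, hi₁, -⟩ := hi₀ S hS
      rw [natCard_sigma_fin, Fintype.sum_sum_type, Fin.sum_univ_two]
      have := add_k_of_mem_cellsOfType F hS
      simp [g, K, hi₁]
      omega) ht
  refine key.trans_eq ?_
  rw [semiMixedVolume, mixedVolume, mul_div_cancel₀ _ (by positivity)]
  simp only [mixedBody_eq_elim hA]
  rfl

/-- The cell `S` has codimension `d`, and its open recession cone contains the escape direction of
`Q`. For almost every `Q` this means that the cell meets `F_d(Q, R)` for all sufficiently large
`R`. -/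
def MeetsFlag (d : ℕ) (Q : Matrix.orthogonalGroup (Fin n) ℝ)
    (S : Cell Sigma.fst latticePoint b) : Prop :=
  ∃ hd : d + (F S).k = n, (F S).escapeDirection hd Q ∈ (F S).openRecessionCone

open Classical in
/-- The number of the cells that contribute a vertex for large `R`; it has a meaning for every `Q`,
but is the number of vertices for almost every `Q` only. -/
def vertexCount (m : Fin s → ℕ) (d : ℕ) (Q : Matrix.orthogonalGroup (Fin n) ℝ) : ℕ :=
  {S ∈ cellsOfType F m d | MeetsFlag F d Q S}.card

theorem mem_tropicalCurveVertices_iff {M : ℕ → Fin s → ℕ} {Q : Matrix.orthogonalGroup (Fin n) ℝ}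
    {R : ℝ} {d : ℕ} {ξ : Fin n → ℝ} :
    ξ ∈ tropicalCurveVertices b M Q R d ↔ ξ ∈ flagSpace Q R d ∧
      ⟨activeSet Sigma.fst latticePoint b (WithLp.toLp 2 ξ), Set.mem_range_self _⟩ ∈
        cellsOfType F (M (d - 1)) d := by
  rw [mem_cellsOfType, ← and_assoc]
  set S : Cell Sigma.fst latticePoint b :=
    ⟨activeSet Sigma.fst latticePoint b (WithLp.toLp 2 ξ), Set.mem_range_self _⟩
  have hcard : ∀ i, Fintype.card (OffBase Sigma.fst S.1 (F S).base i) = tropicalType b i ξ :=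
    fun i => (card_offBase (F S).base_mem (F S).cls_base i).trans (tropicalType_eq_card b ξ i).symm
  simp only [hcard]
  rfl

/-- For large `R`, mapping a vertex to its active set is a bijection from the vertices to the cells
counted by `vertexCount`. -/
theorem ae_eventually_ncard_tropicalCurveVertices (M : ℕ → Fin s → ℕ) (d : ℕ)
    [MeasurableSpace (Matrix.orthogonalGroup (Fin n) ℝ)]
    [BorelSpace (Matrix.orthogonalGroup (Fin n) ℝ)]
    (μ : Measure (Matrix.orthogonalGroup (Fin n) ℝ)) [μ.IsHaarMeasure] [IsProbabilityMeasure μ] :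
    ∀ᵐ Q ∂μ, ∀ᶠ R : ℝ in atTop, (tropicalCurveVertices b M Q R d).Finite ∧
      (tropicalCurveVertices b M Q R d).ncard = vertexCount F (M (d - 1)) d Q := by
  have h1 : ∀ᵐ Q ∂μ, ∀ (S) (hd : d + (F S).k = n),
      (rowMinor ((F S).lastRow hd) (F S).columns Q).det ≠ 0 :=
    ae_all_iff.2 fun S => by
      by_cases hd : d + (F S).k = n
      · filter_upwards [ae_det_rowMinor_ne_zero μ ((F S).lastRow_injective hd)
          (F S).transpose_columns_mul_columns] with Q hQ _ using hQ
      · exact Eventually.of_forall fun Q h => absurd h hd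
  have h2 : ∀ᵐ Q ∂μ, ∀ (S) (p), ∀ hd : d + (F S).k = n, (F S).normal p ≠ 0 →
      inner ℝ ((F S).normal p) ((F S).escapeDirection hd Q) ≠ 0 :=
    ae_all_iff.2 fun S => ae_all_iff.2 fun p => by
      by_cases hd : d + (F S).k = n ∧ (F S).normal p ≠ 0
      · filter_upwards [(F S).ae_inner_escapeDirection_ne_zero hd.1 μ hd.2] with Q hQ _ _ using hQ
      · exact Eventually.of_forall fun Q h h' => absurd ⟨h, h'⟩ hd
  filter_upwards [h1, h2] with Q hQ1 hQ2
  have h3 : ∀ᶠ R : ℝ in atTop, ∀ (S) (hd : d + (F S).k = n),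
      (activeSet Sigma.fst latticePoint b ((F S).origin + (F S).incl ((F S).flagPoint hd Q R)) = S ↔
        (F S).escapeDirection hd Q ∈ (F S).openRecessionCone) :=
    eventually_all.2 fun S => by
      by_cases hd : d + (F S).k = n
      · filter_upwards [(F S).eventually_activeSet_flagPoint_eq_iff hd Q fun p => hQ2 S p hd]
          with R hR _ using hR
      · exact Eventually.of_forall fun Q h => absurd h hd
  filter_upwards [h3] with R hR
  classical
  -- A vertex is determined by its cell.
  let σ : (Fin n → ℝ) → Cell Sigma.fst latticePoint b := fun ξ =>
    ⟨activeSet Sigma.fst latticePoint b (WithLp.toLp 2 ξ), Set.mem_range_self _⟩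
  have hpoint : ∀ ξ ∈ tropicalCurveVertices b M Q R d, ∀ hd : d + (F (σ ξ)).k = n,
      WithLp.toLp 2 ξ = (F (σ ξ)).origin + (F (σ ξ)).incl ((F (σ ξ)).flagPoint hd Q R) :=
    fun ξ hξ hd => (F (σ ξ)).activeSet_flagPoint_of_mem hd exists_latticePoint_eq (hQ1 _ hd)
      ((mem_tropicalCurveVertices_iff F).1 hξ).1 rfl
  have hinj : Set.InjOn σ (tropicalCurveVertices b M Q R d) := by
    intro ξ hξ ξ' hξ' h
    have hd := add_k_of_mem_cellsOfType F ((mem_tropicalCurveVertices_iff F).1 hξ).2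
    have e := hpoint ξ hξ hd
    have e' := hpoint ξ' hξ'
    rw [← h] at e'
    exact congrArg WithLp.ofLp (e.trans (e' hd).symm)
  have himage : σ '' tropicalCurveVertices b M Q R d =
      ({S ∈ cellsOfType F (M (d - 1)) d | MeetsFlag F d Q S} :
        Finset (Cell Sigma.fst latticePoint b)) := by
    ext S
    simp only [Finset.coe_filter, Set.mem_image, Set.mem_ofPred_eq]
    constructor
    · rintro ⟨ξ, hξ, rfl⟩
      have hS := ((mem_tropicalCurveVertices_iff F).1 hξ).2
      have hd := add_k_of_mem_cellsOfType F hS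
      refine ⟨hS, hd, (hR _ hd).1 ?_⟩
      rw [← hpoint ξ hξ hd]
    · rintro ⟨hS, hd, hmem⟩
      have hact := (hR S hd).2 hmem
      have hσ : σ ((F S).origin + (F S).incl ((F S).flagPoint hd Q R)).ofLp = S :=
        Subtype.ext hact
      refine ⟨_, (mem_tropicalCurveVertices_iff F).2
        ⟨((F S).mem_flagSpace_iff hd (hQ1 S hd) R _).2 rfl, ?_⟩, hσ⟩
      change σ _ ∈ _
      rwa [hσ]
  refine ⟨Set.Finite.of_finite_image (himage ▸ Finset.finite_toSet _) hinj, ?_⟩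
  rw [← hinj.ncard_image, himage, Set.ncard_coe_finset, vertexCount]

theorem measurableSet_meetsFlag (d : ℕ) [MeasurableSpace (Matrix.orthogonalGroup (Fin n) ℝ)]
    [BorelSpace (Matrix.orthogonalGroup (Fin n) ℝ)] (S : Cell Sigma.fst latticePoint b) :
    MeasurableSet {Q | MeetsFlag F d Q S} := by
  by_cases hd : d + (F S).k = n
  · simp only [MeetsFlag, hd, exists_true_left]
    exact (F S).measurable_escapeDirection hd (F S).measurableSet_openRecessionCone
  · simp [MeetsFlag, hd]

theorem vertexCount_eq_sum_indicator (m : Fin s → ℕ) (d : ℕ)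
    (Q : Matrix.orthogonalGroup (Fin n) ℝ) :
    (vertexCount F m d Q : ℝ) =
      ∑ S ∈ cellsOfType F m d, {Q | MeetsFlag F d Q S}.indicator (fun _ => (1 : ℝ)) Q := by
  classical
  rw [vertexCount, Finset.card_filter, Nat.cast_sum]
  refine Finset.sum_congr rfl fun S _ => ?_
  simp [Set.indicator_apply]

theorem integrable_vertexCount (m : Fin s → ℕ) (d : ℕ)
    [MeasurableSpace (Matrix.orthogonalGroup (Fin n) ℝ)]
    [BorelSpace (Matrix.orthogonalGroup (Fin n) ℝ)]
    (μ : Measure (Matrix.orthogonalGroup (Fin n) ℝ)) [IsFiniteMeasure μ] :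
    Integrable (fun Q => (vertexCount F m d Q : ℝ)) μ := by
  simp only [vertexCount_eq_sum_indicator]
  exact integrable_finsetSum _ fun S _ =>
    (integrable_const 1).indicator (measurableSet_meetsFlag F d S)

theorem integral_vertexCount_le (hA : ∀ i, (A i).Nonempty)
    {m : Fin s → ℕ} {d : ℕ} (hd : d ≤ n) (hm : ∑ i, m i + 1 = d)
    [MeasurableSpace (Matrix.orthogonalGroup (Fin n) ℝ)]
    [BorelSpace (Matrix.orthogonalGroup (Fin n) ℝ)]
    (μ : Measure (Matrix.orthogonalGroup (Fin n) ℝ)) [μ.IsHaarMeasure] [IsProbabilityMeasure μ] :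
    ∫ Q, (vertexCount F m d Q : ℝ) ∂μ ≤ (n ! : ℝ) / 2 ^ (n - d) *
      semiMixedVolume
        (Sum.elim (fun i : Fin s => supportPolytope (A i))
          ![∑ i, supportPolytope (A i), Metric.closedBall 0 1])
        (Sum.elim m ![1, n - d]) := by
  have hint : ∫ Q, (vertexCount F m d Q : ℝ) ∂μ =
      ∑ S ∈ cellsOfType F m d, μ.real {Q | MeetsFlag F d Q S} := by
    simp only [vertexCount_eq_sum_indicator]
    rw [integral_finsetSum _ fun S _ =>
      (integrable_const 1).indicator (measurableSet_meetsFlag F d S)]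
    refine Finset.sum_congr rfl fun S _ => ?_
    rw [integral_indicator_const _ (measurableSet_meetsFlag F d S), smul_eq_mul, mul_one]
  calc ∫ Q, (vertexCount F m d Q : ℝ) ∂μ
      = ∑ S ∈ cellsOfType F m d, μ.real {Q | MeetsFlag F d Q S} := hint
    _ ≤ ∑ S ∈ cellsOfType F m d, ((2 : ℝ) ^ (n - d))⁻¹ *
          (((F S).k ! : ℝ) * volume.real ((F S).openRecessionCone ∩ Metric.ball 0 1)) := by
        refine Finset.sum_le_sum fun S hS => ?_
        have hk := add_k_of_mem_cellsOfType F hS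
        have h := (F S).measureReal_escapeDirection_le hk μ
        have hset : {Q | MeetsFlag F d Q S} =
            {Q | (F S).escapeDirection hk Q ∈ (F S).openRecessionCone} :=
          Set.ext fun Q => ⟨fun h => h.2, fun h => ⟨hk, h⟩⟩
        rw [hset, show n - d = (F S).k by omega]
        exact h.trans_eq (by ring)
    _ ≤ ((2 : ℝ) ^ (n - d))⁻¹ * ((n ! : ℝ) * semiMixedVolume
          (Sum.elim (fun i : Fin s => supportPolytope (A i))
            ![∑ i, supportPolytope (A i), Metric.closedBall 0 1])
          (Sum.elim m ![1, n - d])) := by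
        rw [← Finset.mul_sum]
        exact mul_le_mul_of_nonneg_left
          (sum_factorial_mul_volume_openRecessionCone_le F hA hd hm) (by positivity)
    _ = _ := by ring

end Vertices

end

theorem proposition7p1 {n s : ℕ} (hsn : s ≤ n)
    (A : Fin s → Finset (Fin n → ℤ)) (hA : ∀ i, (A i).Nonempty)
    (m : Fin s → ℕ) (M : ℕ → Fin s → ℕ)
    (hM_mono : ∀ d < n, ∀ i, M d i ≤ M (d + 1) i)
    (hM_zero : ∀ i, M 0 i = 0)
    (hM_sum : ∀ d ≤ n, ∑ i, M d i = d)
    (hM_last : ∀ i, M n i = m i)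
    (b : SupportUnion A → ℝ) (hb : LiftingInGeneralPosition b)
    (hV : semiMixedVolume (fun i => supportPolytope (A i)) m ≠ 0)
    (d : ℕ) (hd1 : 1 ≤ d) (hdn : d ≤ n)
    [MeasurableSpace (Matrix.orthogonalGroup (Fin n) ℝ)]
    [BorelSpace (Matrix.orthogonalGroup (Fin n) ℝ)]
    (μ : Measure (Matrix.orthogonalGroup (Fin n) ℝ))
    [μ.IsHaarMeasure] [IsProbabilityMeasure μ] :
    ∃ v : Matrix.orthogonalGroup (Fin n) ℝ → ℕ,
      (∀ᵐ Q ∂μ, ∀ᶠ R : ℝ in atTop,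
        (tropicalCurveVertices b M Q R d).Finite ∧
          (tropicalCurveVertices b M Q R d).ncard = v Q) ∧
      Integrable (fun Q => (v Q : ℝ)) μ ∧
      ∫ Q, (v Q : ℝ) ∂μ ≤
        (n ! : ℝ) / 2 ^ (n - d) *
          semiMixedVolume
            (Sum.elim (fun i : Fin s => supportPolytope (A i))
              ![∑ i, supportPolytope (A i), Metric.closedBall 0 1])
            (Sum.elim (M (d - 1)) ![1, n - d]) := by
  have hframe : ∀ S : Cell Sigma.fst latticePoint b,
      Nonempty (CellFrame Sigma.fst latticePoint b S.1) := by
    rintro ⟨_, x, rfl⟩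
    exact nonempty_cellFrame (surjective_fst hA) exists_latticePoint_eq hb.activeSetsIndependent x
  let F := fun S => (hframe S).some
  have hsum : ∑ i, M (d - 1) i + 1 = d := by
    rw [hM_sum (d - 1) (by omega)]
    omega
  exact ⟨vertexCount F (M (d - 1)) d, ae_eventually_ncard_tropicalCurveVertices F M d μ,
    integrable_vertexCount F _ d μ, integral_vertexCount_le F hA hdn hsum μ⟩
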